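/- Let $k\ge 1$ be an integer and let $\lambda\ge 1$ be real. Let $D_{2k}=\langle\delta,\sigma:\delta^k=\sigma^2=1,\ \sigma\delta\sigma^{-1}=\delta^{-1}\rangle$ be the dihedral group of order $2k$, realised as the reflection group $G(k,k,2)$ on $\mathbb C^2$ by $\delta(z_1,z_2)=(\omega z_1,\omega^{-1}z_2)$ with $\omega=e^{2\pi i/k}$, and $\sigma(z_1,z_2)=(z_2,z_1)$; it acts on $\mathbb D^2$ by $g\cdot z=g^{-1}z$. Put $\phi_1(z)=z_1^k+z_2^k$, $\phi_2(z)=z_1z_2$, $\boldsymbol\phi=(\phi_1,\phi_2)$ and $\mathscr D_{2k}=\boldsymbol\phi(\mathbb D^2)$. A commuting pair $(T_1,T_2)$ of bounded operators on a Hilbert space is called a $\mathscr D_{2k}$-contraction if $\|p(T_1,T_2)\|\le\sup_{\overline{\mathscr D}_{2k}}|p|$ for every $p\in\mathbb C[z_1,z_2]$. For $\lambda>1$ let $\mathbb A^{(\lambda)}(\mathbb D^2)$ be the space of holomorphic functions in $L^2(\mathbb D^2,dV^{(\lambda)})$, where $dV^{(\lambda)}=\big(\frac{\lambda-1}{\pi}\big)^2\prod_{i=1}^2(1-|z_i|^2)^{\lambda-2}\,dV$,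 and let $\mathbb A^{(1)}(\mathbb D^2)$ be the Hardy space $H^2(\mathbb D^2)$, regarded through boundary values as a subspace of $L^2(\mathbb T^2)$. For an irreducible unitary representation $\mu$ of $D_{2k}$, written as unitary matrices $(\mu^{ij}(g))$ in an orthonormal basis, let $$(\mathbb P_\mu^{11}f)(z)=\frac{\deg\mu}{2k}\sum_{g\in D_{2k}}\mu^{11}(g^{-1})\,f(g^{-1}\cdot z).$$ Then: 1. for every $\mu$, the pair $(M_{\phi_1},M_{\phi_2})$ of multiplication operators restricted to $\mathbb P_\mu^{11}(\mathbb A^{(\lambda)}(\mathbb D^2))$ is a $\mathscr D_{2k}$-contraction; 2. if $\mu$ and $\nu$ are inequivalent irreducible unitary representations of $D_{2k}$, then there is no unitary operator from $\mathbb P_\mu^{11}(\mathbb A^{(\lambda)}(\mathbb D^2))$ onto $\mathbb P_\nu^{11}(\mathbb A^{(\lambda)}(\mathbb D^2))$ that intertwines both $M_{\phi_1}$ and $M_{\phi_2}$; that is, the restricted pairs $(M_{\phi_1},M_{\phi_2})$ are not unitarily equivalent. -/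

import Mathlib

open MeasureTheory Filter Topology
open scoped ENNReal Real

/-! ### Tuples of operators: spectral sets and unitary equivalence -/

/-- The value `p(T₁, T₂) = ∑ aₘₙ T₁ᵐ T₂ⁿ` of a polynomial at a (commuting) pair of operators. -/
noncomputable def polyEval {H : Type*} [NormedAddCommGroup H] [InnerProductSpace ℂ H]
    (T₁ T₂ : H →L[ℂ] H) (p : MvPolynomial (Fin 2) ℂ) : H →L[ℂ] H :=
  ∑ m ∈ p.support, p.coeff m • (T₁ ^ m 0 * T₂ ^ m 1)

/-- `K` is a spectral set for `(T₁, T₂)`: `‖p(T₁, T₂)‖ ≤ sup_K |p|` for every polynomial `p`. The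
inequality is read in `[0, ∞]`, so that the supremum has its usual meaning for every set `K`. -/
def IsSpectralSet {H : Type*} [NormedAddCommGroup H] [InnerProductSpace ℂ H]
    (K : Set (ℂ × ℂ)) (T₁ T₂ : H →L[ℂ] H) : Prop :=
  ∀ p : MvPolynomial (Fin 2) ℂ,
    ‖polyEval T₁ T₂ p‖ₑ ≤ ⨆ w ∈ K, ‖MvPolynomial.eval ![w.1, w.2] p‖ₑ

/-- Unitary equivalence of two pairs of operators: one unitary operator intertwines both. -/
def UnitarilyEquivalentPairs {H H' : Type*} [NormedAddCommGroup H] [InnerProductSpace ℂ H]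
    [NormedAddCommGroup H'] [InnerProductSpace ℂ H']
    (T₁ T₂ : H →L[ℂ] H) (S₁ S₂ : H' →L[ℂ] H') : Prop :=
  ∃ U : H ≃ₗᵢ[ℂ] H', (∀ x, U (T₁ x) = S₁ (U x)) ∧ (∀ x, U (T₂ x) = S₂ (U x))

/-! ### The bidisc, the basic polynomials and the domain `𝒟₂ₖ` -/

/-- The open unit bidisc. -/
def bidisc : Set (ℂ × ℂ) := {z | ‖z.1‖ < 1 ∧ ‖z.2‖ < 1}

/-- `φ₁(z) = z₁ᵏ + z₂ᵏ`. -/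
def phiOne (k : ℕ) (z : ℂ × ℂ) : ℂ := z.1 ^ k + z.2 ^ k

/-- `φ₂(z) = z₁ z₂`. -/
def phiTwo (z : ℂ × ℂ) : ℂ := z.1 * z.2

/-- The quotient domain `𝒟₂ₖ = φ(𝔻²)`. -/
def dihedralDomain (k : ℕ) : Set (ℂ × ℂ) := (fun z => (phiOne k z, phiTwo z)) '' bidisc

/-- A `𝒟₂ₖ`-contraction: a commuting pair with the closure of `𝒟₂ₖ` as a spectral set. -/
def IsDihedralContraction {H : Type*} [NormedAddCommGroup H] [InnerProductSpace ℂ H]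
    (k : ℕ) (T₁ T₂ : H →L[ℂ] H) : Prop :=
  Commute T₁ T₂ ∧ IsSpectralSet (closure (dihedralDomain k)) T₁ T₂

/-! ### The dihedral group, its action and its irreducible unitary representations -/

/-- The dihedral group of order `2k` realised on `ℂ²` as the reflection group `G(k,k,2)`: the
rotation `r i = δⁱ` is `diag(ωⁱ, ω⁻ⁱ)` with `ω = exp(2πi/k)`, and the reflection
`sr i = σδⁱ` is that matrix followed by the exchange of the two coordinates. -/
noncomputable def dihedralMap {k : ℕ} [NeZero k] : DihedralGroup k → ℂ × ℂ → ℂ × ℂ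
  | .r i, z => ((ZMod.toCircle i : ℂ) * z.1, (ZMod.toCircle (-i) : ℂ) * z.2)
  | .sr i, z => ((ZMod.toCircle (-i) : ℂ) * z.2, (ZMod.toCircle i : ℂ) * z.1)

/-- The realisation above is a representation of the dihedral group on `ℂ²`. -/
noncomputable def dihedralRep (k : ℕ) [NeZero k] :
    Representation ℂ (DihedralGroup k) (ℂ × ℂ) where
  toFun g :=
    { toFun := dihedralMap g
      map_add' := by
        intro x y
        cases g <;> simp [dihedralMap, mul_add]
      map_smul' := by
        intro c x
        cases g <;> simp [dihedralMap, mul_left_comm] }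
  map_one' := by
    apply LinearMap.ext
    intro z
    change dihedralMap (DihedralGroup.r 0) z = z
    simp [dihedralMap]
  map_mul' a b := by
    apply LinearMap.ext
    intro z
    cases a <;> cases b <;>
      simp [dihedralMap, AddChar.map_add_eq_mul, sub_eq_add_neg, mul_comm, mul_left_comm]

/-- The (right) action `g · z = g⁻¹ z` of the dihedral group on `ℂ²`. -/
noncomputable def dihedralAct {k : ℕ} [NeZero k] (g : DihedralGroup k) (z : ℂ × ℂ) : ℂ × ℂ :=
  dihedralRep k g⁻¹ z

/-- The representation on `ℂᵈ` given by a homomorphism into the unitary matrices. -/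
noncomputable def unitaryMatrixRep {G : Type*} [Group G] {d : ℕ}
    (M : G →* Matrix.unitaryGroup (Fin d) ℂ) : Representation ℂ G (Fin d → ℂ) where
  toFun g := Matrix.toLin' (M g : Matrix (Fin d) (Fin d) ℂ)
  map_one' := by simp; rfl
  map_mul' a b := by simp [Matrix.toLin'_mul, Module.End.mul_eq_comp]

/-- An irreducible unitary representation of `D₂ₖ`, written as matrices in an orthonormal basis. -/
structure DihedralIrrep (k : ℕ) where
  /-- the degree -/
  deg : ℕ
  deg_pos : 0 < deg
  /-- the unitary matrices `(μ^{ij}(g))` -/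
  mat : DihedralGroup k →* Matrix.unitaryGroup (Fin deg) ℂ
  irreducible : (unitaryMatrixRep mat).IsIrreducible

/-- The representation of `D₂ₖ` that the matrices describe. -/
noncomputable def DihedralIrrep.rep {k : ℕ} (μ : DihedralIrrep k) :
    Representation ℂ (DihedralGroup k) (Fin μ.deg → ℂ) :=
  unitaryMatrixRep μ.mat

/-- Equivalence of representations: `μ` and `ν` define the same element of the dual of `D₂ₖ`. -/
def DihedralIrrep.Equivalent {k : ℕ} (μ ν : DihedralIrrep k) : Prop :=
  Nonempty (Representation.Equiv μ.rep ν.rep)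

/-- The first basis index. -/
def DihedralIrrep.first {k : ℕ} (μ : DihedralIrrep k) : Fin μ.deg := ⟨0, μ.deg_pos⟩

/-! ### The measures -/

/-- Normalised arc length on the unit circle. -/
noncomputable def circleMeasure : Measure ℂ :=
  Measure.map (fun t : UnitAddCircle => (AddCircle.toCircle t : ℂ)) volume

/-- The probability measure `((λ-1)/π) (1-|z|²)^(λ-2) dA(z)` on the unit disc, for `λ > 1`. -/
noncomputable def weightedDiscMeasure (lam : ℝ) : Measure ℂ :=
  (volume.restrict (Metric.ball (0 : ℂ) 1)).withDensity
    fun z => ENNReal.ofReal ((lam - 1) / π * (1 - ‖z‖ ^ 2) ^ (lam - 2))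

open Classical in
/-- The one-variable measure: weighted area measure on the disc for `λ > 1`, and, in the limiting
case `λ = 1`, normalised arc length on the circle. -/
noncomputable def discMeasure (lam : ℝ) : Measure ℂ :=
  if lam = 1 then circleMeasure else weightedDiscMeasure lam

/-- The measure `dV^(λ)` on `𝔻²` for `λ > 1`; the normalised Lebesgue measure on `𝕋²` for
`λ = 1`. -/
noncomputable def bidiscMeasure (lam : ℝ) : Measure (ℂ × ℂ) :=
  (discMeasure lam).prod (discMeasure lam)

lemma measurable_toCircle_coe :
    Measurable (fun t : UnitAddCircle => (AddCircle.toCircle t : ℂ)) :=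
  (continuous_subtype_val.comp AddCircle.continuous_toCircle).measurable

instance isFiniteMeasure_circleMeasure : IsFiniteMeasure circleMeasure := by
  unfold circleMeasure; infer_instance

instance sFinite_discMeasure (lam : ℝ) : SFinite (discMeasure lam) := by
  unfold discMeasure
  split_ifs
  · infer_instance
  · unfold weightedDiscMeasure; infer_instance

lemma discMeasure_ae_norm_le (lam : ℝ) : ∀ᵐ z ∂(discMeasure lam), ‖z‖ ≤ 1 := by
  unfold discMeasure
  split_ifs
  · unfold circleMeasure
    rw [ae_map_iff measurable_toCircle_coe.aemeasurable
      (measurableSet_le measurable_norm measurable_const)]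
    exact Eventually.of_forall fun t => (Circle.norm_coe _).le
  · unfold weightedDiscMeasure
    refine (withDensity_absolutelyContinuous _ _).ae_le ?_
    filter_upwards [ae_restrict_mem Metric.isOpen_ball.measurableSet] with z hz
    simpa using (mem_ball_zero_iff.mp hz).le

lemma circleMeasure_ae_norm_eq : ∀ᵐ z ∂circleMeasure, ‖z‖ = 1 := by
  unfold circleMeasure
  rw [ae_map_iff measurable_toCircle_coe.aemeasurable
    (measurableSet_eq_fun measurable_norm measurable_const)]
  exact Eventually.of_forall fun t => Circle.norm_coe _

lemma bidiscMeasure_ae_norm_le (lam : ℝ) :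
    ∀ᵐ z ∂(bidiscMeasure lam), ‖z.1‖ ≤ 1 ∧ ‖z.2‖ ≤ 1 := by
  have h := discMeasure_ae_norm_le lam
  have h1 := (Measure.quasiMeasurePreserving_fst
    (μ := discMeasure lam) (ν := discMeasure lam)).ae h
  have h2 := (Measure.quasiMeasurePreserving_snd
    (μ := discMeasure lam) (ν := discMeasure lam)).ae h
  filter_upwards [h1, h2] with z hz1 hz2 using ⟨hz1, hz2⟩

lemma bidiscMeasure_one_ae_norm_eq :
    ∀ᵐ z ∂(bidiscMeasure 1), ‖z.1‖ = 1 ∧ ‖z.2‖ = 1 := by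
  have h : ∀ᵐ z ∂(discMeasure 1), ‖z‖ = 1 := by
    simpa [discMeasure] using circleMeasure_ae_norm_eq
  have h1 := (Measure.quasiMeasurePreserving_fst (μ := discMeasure 1) (ν := discMeasure 1)).ae h
  have h2 := (Measure.quasiMeasurePreserving_snd (μ := discMeasure 1) (ν := discMeasure 1)).ae h
  filter_upwards [h1, h2] with z hz1 hz2 using ⟨hz1, hz2⟩

lemma measurePreserving_rotation (lam : ℝ) (t : UnitAddCircle) :
    MeasurePreserving (fun z : ℂ => (AddCircle.toCircle t : ℂ) * z)
      (discMeasure lam) (discMeasure lam) := by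
  refine ⟨by fun_prop, ?_⟩
  unfold discMeasure
  split_ifs
  · have h := (measurePreserving_add_left (volume : Measure UnitAddCircle) t).map_eq
    unfold circleMeasure
    conv_rhs => rw [← h]
    rw [Measure.map_map (by fun_prop) measurable_toCircle_coe,
      Measure.map_map measurable_toCircle_coe (by fun_prop)]
    congr 1
    funext s
    simp [AddCircle.toCircle_add]
  · unfold weightedDiscMeasure
    set e : ℂ ≃ₗᵢ[ℝ] ℂ := rotation (AddCircle.toCircle t) with he
    have hfun : (fun z : ℂ => (AddCircle.toCircle t : ℂ) * z) = e := by
      funext z; simp [he]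
    rw [hfun]
    have hp : MeasurePreserving e (volume : Measure ℂ) volume := e.measurePreserving
    ext s hs
    have hm : Measurable (e : ℂ → ℂ) := hp.measurable
    rw [Measure.map_apply hm hs, withDensity_apply _ (hm hs), withDensity_apply _ hs,
      Measure.restrict_restrict (hm hs), Measure.restrict_restrict hs]
    have hpre : e ⁻¹' s ∩ Metric.ball (0 : ℂ) 1 = e ⁻¹' (s ∩ Metric.ball (0 : ℂ) 1) := by
      ext z; simp
    rw [hpre, ← hp.setLIntegral_comp_preimage (hs.inter Metric.isOpen_ball.measurableSet)
      (by fun_prop)]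
    simp

lemma measurePreserving_dihedralAct (lam : ℝ) {k : ℕ} [NeZero k] (g : DihedralGroup k) :
    MeasurePreserving (dihedralAct g) (bidiscMeasure lam) (bidiscMeasure lam) := by
  have hrot : ∀ i : ZMod k, MeasurePreserving (fun z : ℂ => (ZMod.toCircle i : ℂ) * z)
      (discMeasure lam) (discMeasure lam) := fun i =>
    measurePreserving_rotation lam (ZMod.toAddCircle i)
  have key : ∀ g : DihedralGroup k,
      MeasurePreserving (dihedralMap g) (bidiscMeasure lam) (bidiscMeasure lam) := by
    intro g
    cases g with
    | r i => exact (hrot i).prod (hrot (-i))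
    | sr i => exact ((hrot (-i)).prod (hrot i)).comp Measure.measurePreserving_swap
  exact key g⁻¹

/-! ### The weighted Bergman spaces and the Hardy space -/

open Classical in
/-- `f ∈ L²` belongs to the space with parameter `λ`. For `λ > 1`: `f` is (the class of) a
holomorphic function on `𝔻²`. For `λ = 1`: `f` is the boundary value on `𝕋²`, in the sense of
`L²`-convergence of the dilates `F(r ·)` as `r → 1-`, of a holomorphic function `F` on `𝔻²`; this
is the Hardy space `H²(𝔻²)`, regarded in the usual way as a subspace of `L²(𝕋²)`. -/
def IsBergman (lam : ℝ) (f : Lp ℂ 2 (bidiscMeasure lam)) : Prop :=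
  ∃ F : ℂ × ℂ → ℂ, DifferentiableOn ℂ F bidisc ∧
    if lam = 1 then
      Tendsto (fun r : ℝ => eLpNorm (fun z => F (r • z) - f z) 2 (bidiscMeasure lam))
        (𝓝[<] 1) (𝓝 0)
    else f =ᵐ[bidiscMeasure lam] F

lemma eventually_aestronglyMeasurable_dilate {F : ℂ × ℂ → ℂ} (hF : DifferentiableOn ℂ F bidisc)
    (lam : ℝ) : ∀ᶠ r : ℝ in 𝓝[<] 1,
      AEStronglyMeasurable (fun z => F (r • z)) (bidiscMeasure lam) := by
  have h0 : ∀ᶠ r : ℝ in 𝓝[<] 1, 0 < r :=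
    nhdsWithin_le_nhds (eventually_gt_nhds (by norm_num))
  filter_upwards [h0, self_mem_nhdsWithin] with r hr hr1
  have hr1' : r < 1 := hr1
  set S : Set (ℂ × ℂ) := {z | ‖z.1‖ ≤ 1 ∧ ‖z.2‖ ≤ 1} with hS
  have hSm : MeasurableSet S :=
    (measurableSet_le (measurable_fst.norm) measurable_const).inter
      (measurableSet_le (measurable_snd.norm) measurable_const)
  have hcont : ContinuousOn (fun z : ℂ × ℂ => F (r • z)) S := by
    refine hF.continuousOn.comp (by fun_prop) ?_
    intro z hz
    have h1 : r * ‖z.1‖ < 1 := by nlinarith [hz.1, norm_nonneg z.1]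
    have h2 : r * ‖z.2‖ < 1 := by nlinarith [hz.2, norm_nonneg z.2]
    simp only [bidisc, Set.mem_ofPred_eq, Prod.smul_fst, Prod.smul_snd, norm_smul,
      Real.norm_eq_abs, abs_of_pos hr]
    exact ⟨h1, h2⟩
  have := hcont.aestronglyMeasurable (μ := bidiscMeasure lam) hSm
  rwa [Measure.restrict_eq_self_of_ae_mem] at this
  exact bidiscMeasure_ae_norm_le lam

/-- The weighted Bergman space `𝔸^(λ)(𝔻²)` (for `λ = 1`, the Hardy space), with the norm and inner
product of `L²`. -/
noncomputable def bergmanSpace (lam : ℝ) : Submodule ℂ (Lp ℂ 2 (bidiscMeasure lam)) where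
  carrier := {f | IsBergman lam f}
  zero_mem' := by
    refine ⟨0, differentiableOn_const 0, ?_⟩
    have h0 := Lp.coeFn_zero ℂ 2 (bidiscMeasure lam)
    split_ifs
    · have : ∀ r : ℝ, eLpNorm (fun z => (0 : ℂ × ℂ → ℂ) (r • z) -
          (0 : Lp ℂ 2 (bidiscMeasure lam)) z) 2 (bidiscMeasure lam) = 0 := by
        intro r
        rw [eLpNorm_congr_ae (g := 0), eLpNorm_zero]
        filter_upwards [h0] with z hz
        rw [hz]
        simp
      simp only [this]
      exact tendsto_const_nhds
    · exact h0
  add_mem' := by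
    rintro f g ⟨F, hF, hf⟩ ⟨G, hG, hg⟩
    refine ⟨F + G, hF.add hG, ?_⟩
    have hadd := Lp.coeFn_add f g
    split_ifs with h
    · rw [if_pos h] at hf hg
      have hlim := hf.add hg
      rw [add_zero] at hlim
      refine tendsto_of_tendsto_of_tendsto_of_le_of_le' tendsto_const_nhds hlim
        (Eventually.of_forall fun _ => zero_le) ?_
      filter_upwards [eventually_aestronglyMeasurable_dilate hF lam,
        eventually_aestronglyMeasurable_dilate hG lam] with r h1 h2
      refine le_trans (le_of_eq (eLpNorm_congr_ae ?_)) (eLpNorm_add_le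
        (h1.sub (Lp.aestronglyMeasurable f)) (h2.sub (Lp.aestronglyMeasurable g)) (by norm_num))
      filter_upwards [hadd] with z hz
      simp only [hz, Pi.add_apply]
      ring
    · rw [if_neg h] at hf hg
      filter_upwards [hadd, hf, hg] with z hz h1 h2
      rw [hz, Pi.add_apply, Pi.add_apply, h1, h2]
  smul_mem' := by
    rintro c f ⟨F, hF, hf⟩
    refine ⟨c • F, hF.const_smul c, ?_⟩
    have hsm := Lp.coeFn_smul c f
    split_ifs with h
    · rw [if_pos h] at hf
      have hlim := ENNReal.Tendsto.const_mul (a := ‖c‖ₑ) hf (Or.inr enorm_ne_top)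
      rw [mul_zero] at hlim
      refine hlim.congr fun r => ?_
      rw [← eLpNorm_const_smul]
      refine eLpNorm_congr_ae ?_
      filter_upwards [hsm] with z hz
      simp only [hz, Pi.smul_apply, smul_eq_mul]
      ring
    · rw [if_neg h] at hf
      filter_upwards [hsm, hf] with z hz h1
      rw [hz, Pi.smul_apply, Pi.smul_apply, h1]

/-! ### Multiplication operators -/

/-- The operator `M_h f = h f` on `L²`, for `h ∈ L^∞`. -/
noncomputable def mulOperator {ν : Measure (ℂ × ℂ)} (h : ℂ × ℂ → ℂ) (hh : MemLp h ∞ ν) :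
    Lp ℂ 2 ν →L[ℂ] Lp ℂ 2 ν :=
  (ContinuousLinearMap.mul ℂ ℂ).holderL ν ∞ 2 2 (hh.toLp h)

lemma mulOperator_coeFn {ν : Measure (ℂ × ℂ)} (h : ℂ × ℂ → ℂ) (hh : MemLp h ∞ ν)
    (f : Lp ℂ 2 ν) : mulOperator h hh f =ᵐ[ν] fun z => h z * f z := by
  have h1 := (ContinuousLinearMap.mul ℂ ℂ).coeFn_holder (r := 2) (hh.toLp h) f
  filter_upwards [h1, hh.coeFn_toLp] with z hz h2
  rw [← h2]
  exact hz

lemma memLp_phiOne (k : ℕ) (lam : ℝ) : MemLp (phiOne k) ∞ (bidiscMeasure lam) := by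
  refine memLp_top_of_bound (C := 2) ?_ ?_
  · have : Continuous (phiOne k) := by unfold phiOne; fun_prop
    exact this.aestronglyMeasurable
  · filter_upwards [bidiscMeasure_ae_norm_le lam] with z hz
    have h1 : ‖z.1‖ ^ k ≤ 1 := pow_le_one₀ (norm_nonneg _) hz.1
    have h2 : ‖z.2‖ ^ k ≤ 1 := pow_le_one₀ (norm_nonneg _) hz.2
    calc ‖phiOne k z‖ ≤ ‖z.1 ^ k‖ + ‖z.2 ^ k‖ := norm_add_le _ _
      _ ≤ 2 := by rw [norm_pow, norm_pow]; linarith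

lemma memLp_phiTwo (lam : ℝ) : MemLp phiTwo ∞ (bidiscMeasure lam) := by
  refine memLp_top_of_bound (C := 2) ?_ ?_
  · have : Continuous phiTwo := by unfold phiTwo; fun_prop
    exact this.aestronglyMeasurable
  · filter_upwards [bidiscMeasure_ae_norm_le lam] with z hz
    rw [phiTwo, norm_mul]
    nlinarith [hz.1, hz.2, norm_nonneg z.1, norm_nonneg z.2]

/-- Multiplication by a homogeneous bounded holomorphic function maps the space to itself. -/
lemma mulOperator_mem_bergmanSpace {lam : ℝ} {h : ℂ × ℂ → ℂ} (hh : MemLp h ∞ (bidiscMeasure lam))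
    (hd : Differentiable ℂ h) {d : ℕ} (hhom : ∀ (r : ℝ) (z : ℂ × ℂ), h (r • z) = (r : ℂ) ^ d * h z)
    {f : Lp ℂ 2 (bidiscMeasure lam)} (hf : f ∈ bergmanSpace lam) :
    mulOperator h hh f ∈ bergmanSpace lam := by
  obtain ⟨F, hF, hf⟩ := hf
  refine ⟨h * F, hd.differentiableOn.mul hF, ?_⟩
  have hmul := mulOperator_coeFn h hh f
  split_ifs with hl
  · rw [if_pos hl] at hf
    -- `h(rz)F(rz) - h(z)f(z) = h(z) (r^d (F(rz) - f(z)) + (r^d - 1) f(z))`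
    have hr : Tendsto (fun r : ℝ => (r : ℂ) ^ d) (𝓝[<] 1) (𝓝 1) := by
      have : Tendsto (fun r : ℝ => (r : ℂ) ^ d) (𝓝 1) (𝓝 (((1 : ℝ) : ℂ) ^ d)) :=
        (by fun_prop : Continuous fun r : ℝ => (r : ℂ) ^ d).tendsto 1
      simpa using this.mono_left nhdsWithin_le_nhds
    have hr1 : Tendsto (fun r : ℝ => ‖(r : ℂ) ^ d‖ₑ) (𝓝[<] 1) (𝓝 1) := by
      have h1 := (continuous_enorm.tendsto (1 : ℂ)).comp hr
      rwa [enorm_one] at h1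
    have hr2 : Tendsto (fun r : ℝ => ‖(r : ℂ) ^ d - 1‖ₑ) (𝓝[<] 1) (𝓝 0) := by
      have h1 := hr.sub_const 1
      rw [sub_self] at h1
      have h2 := (continuous_enorm.tendsto (0 : ℂ)).comp h1
      rwa [enorm_zero] at h2
    have hA : Tendsto (fun r : ℝ => ‖(r : ℂ) ^ d‖ₑ *
        eLpNorm (fun z => F (r • z) - f z) 2 (bidiscMeasure lam)) (𝓝[<] 1) (𝓝 0) := by
      simpa using ENNReal.Tendsto.mul hr1 (Or.inl one_ne_zero) hf (Or.inr ENNReal.one_ne_top)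
    have hB : Tendsto (fun r : ℝ => ‖(r : ℂ) ^ d - 1‖ₑ * eLpNorm f 2 (bidiscMeasure lam))
        (𝓝[<] 1) (𝓝 0) := by
      simpa using ENNReal.Tendsto.mul_const hr2 (Or.inr (Lp.eLpNorm_ne_top f))
    have hAB := hA.add hB
    rw [add_zero] at hAB
    have hlim := ENNReal.Tendsto.const_mul (a := eLpNorm h ∞ (bidiscMeasure lam)) hAB
      (Or.inr hh.eLpNorm_ne_top)
    rw [mul_zero] at hlim
    refine tendsto_of_tendsto_of_tendsto_of_le_of_le' tendsto_const_nhds hlim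
      (Eventually.of_forall fun _ => zero_le) ?_
    filter_upwards [eventually_aestronglyMeasurable_dilate hF lam] with r hm
    have hm1 : AEStronglyMeasurable (fun z => F (r • z) - f z) (bidiscMeasure lam) :=
      hm.sub (Lp.aestronglyMeasurable f)
    set u : ℂ × ℂ → ℂ := (((r : ℂ) ^ d) • fun z => F (r • z) - f z) +
      (((r : ℂ) ^ d - 1) • (f : ℂ × ℂ → ℂ)) with hu
    have hum : AEStronglyMeasurable u (bidiscMeasure lam) :=
      (hm1.const_smul _).add ((Lp.aestronglyMeasurable f).const_smul _)
    calc eLpNorm (fun z => (h * F) (r • z) - mulOperator h hh f z) 2 (bidiscMeasure lam)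
        = eLpNorm (h • u) 2 (bidiscMeasure lam) := by
          refine eLpNorm_congr_ae ?_
          filter_upwards [hmul] with z hz
          simp only [hz, hu, Pi.mul_apply, Pi.smul_apply', Pi.add_apply, Pi.smul_apply,
            smul_eq_mul, hhom]
          ring
      _ ≤ eLpNorm h ∞ (bidiscMeasure lam) * eLpNorm u 2 (bidiscMeasure lam) :=
          eLpNorm_smul_le_mul_eLpNorm hum hh.aestronglyMeasurable
      _ ≤ _ := by
          gcongr
          refine (eLpNorm_add_le (hm1.const_smul _)
            ((Lp.aestronglyMeasurable f).const_smul _) (by norm_num)).trans ?_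
          rw [eLpNorm_const_smul, eLpNorm_const_smul]
  · rw [if_neg hl] at hf
    filter_upwards [hmul, hf] with z hz h1
    rw [hz, Pi.mul_apply, h1]

lemma phiOne_mem_bergmanSpace (k : ℕ) {lam : ℝ} {f : Lp ℂ 2 (bidiscMeasure lam)}
    (hf : f ∈ bergmanSpace lam) :
    mulOperator (phiOne k) (memLp_phiOne k lam) f ∈ bergmanSpace lam := by
  refine mulOperator_mem_bergmanSpace (d := k) _ ?_ ?_ hf
  · unfold phiOne; fun_prop
  · intro r z
    simp [phiOne, mul_pow, mul_add]

lemma phiTwo_mem_bergmanSpace {lam : ℝ} {f : Lp ℂ 2 (bidiscMeasure lam)}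
    (hf : f ∈ bergmanSpace lam) :
    mulOperator phiTwo (memLp_phiTwo lam) f ∈ bergmanSpace lam := by
  refine mulOperator_mem_bergmanSpace (d := 2) _ ?_ ?_ hf
  · unfold phiTwo; fun_prop
  · intro r z
    simp only [phiTwo, Prod.smul_fst, Prod.smul_snd, Complex.real_smul]
    ring

/-! ### The projections `P_μ^{ij}` and the restricted operators -/

/-- `(P_μ^{ij} f)(z) = (deg μ / |G|) ∑_g μ^{ji}(g⁻¹) f(g⁻¹ · z)` on `L²`, with `G = D₂ₖ`. -/
noncomputable def isotypicOperator {k : ℕ} [NeZero k] (lam : ℝ) (μ : DihedralIrrep k)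
    (i j : Fin μ.deg) : Lp ℂ 2 (bidiscMeasure lam) →L[ℂ] Lp ℂ 2 (bidiscMeasure lam) :=
  ((μ.deg : ℂ) / (Fintype.card (DihedralGroup k) : ℂ)) •
    ∑ g : DihedralGroup k, (μ.mat g⁻¹ : Matrix (Fin μ.deg) (Fin μ.deg) ℂ) j i •
      (Lp.compMeasurePreservingₗᵢ ℂ (dihedralAct g⁻¹)
        (measurePreserving_dihedralAct lam g⁻¹)).toContinuousLinearMap

/-- The space `P_μ^{11}(𝔸^(λ)(𝔻²))`. -/
noncomputable def isotypicSpace {k : ℕ} [NeZero k] (lam : ℝ) (μ : DihedralIrrep k) :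
    Submodule ℂ (Lp ℂ 2 (bidiscMeasure lam)) :=
  (bergmanSpace lam).map (isotypicOperator lam μ μ.first μ.first).toLinearMap

lemma mulOperator_comp_action {k : ℕ} [NeZero k] {lam : ℝ} {h : ℂ × ℂ → ℂ}
    (hh : MemLp h ∞ (bidiscMeasure lam)) (g : DihedralGroup k)
    (hinv : ∀ z, h (dihedralAct g z) = h z) (f : Lp ℂ 2 (bidiscMeasure lam)) :
    mulOperator h hh (Lp.compMeasurePreservingₗᵢ ℂ (dihedralAct g)
        (measurePreserving_dihedralAct lam g) f) =
      Lp.compMeasurePreservingₗᵢ ℂ (dihedralAct g)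
        (measurePreserving_dihedralAct lam g) (mulOperator h hh f) := by
  have hmp := measurePreserving_dihedralAct lam g
  apply Lp.ext
  have h1 := Lp.coeFn_compMeasurePreserving f hmp
  have h2 := Lp.coeFn_compMeasurePreserving (mulOperator h hh f) hmp
  have h3 := hmp.quasiMeasurePreserving.ae_eq_comp (mulOperator_coeFn h hh f)
  refine (mulOperator_coeFn h hh _).trans ?_
  refine EventuallyEq.trans ?_ (h2.trans h3).symm
  filter_upwards [h1] with z hz
  have hz' : (Lp.compMeasurePreservingₗᵢ ℂ (dihedralAct g) hmp f) z = f (dihedralAct g z) := hz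
  simp only [hz', Function.comp_apply, hinv]

lemma mulOperator_mem_isotypicSpace {k : ℕ} [NeZero k] {lam : ℝ} (μ : DihedralIrrep k)
    {h : ℂ × ℂ → ℂ} (hh : MemLp h ∞ (bidiscMeasure lam))
    (hinv : ∀ (g : DihedralGroup k) z, h (dihedralAct g z) = h z)
    (hA : ∀ f ∈ bergmanSpace lam, mulOperator h hh f ∈ bergmanSpace lam)
    (f : Lp ℂ 2 (bidiscMeasure lam)) (hf : f ∈ isotypicSpace lam μ) :
    mulOperator h hh f ∈ isotypicSpace lam μ := by
  obtain ⟨u, hu, rfl⟩ := hf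
  refine ⟨mulOperator h hh u, hA u hu, ?_⟩
  simp only [isotypicOperator, ContinuousLinearMap.coe_coe, smul_apply,
    sum_apply, map_smul, map_sum, LinearIsometry.coe_toContinuousLinearMap,
    mulOperator_comp_action hh _ (hinv _)]

lemma phiOne_dihedralAct {k : ℕ} [NeZero k] (g : DihedralGroup k) (z : ℂ × ℂ) :
    phiOne k (dihedralAct g z) = phiOne k z := by
  have hpow : ∀ i : ZMod k, (ZMod.toCircle i : ℂ) ^ k = 1 := by
    intro i
    rw [← Circle.coe_pow, ← AddChar.map_nsmul_eq_pow]
    simp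
  have key : ∀ (g : DihedralGroup k) z, phiOne k (dihedralMap g z) = phiOne k z := by
    rintro (i | i) z
    · simp only [phiOne, dihedralMap, mul_pow, hpow, one_mul]
    · simp only [phiOne, dihedralMap, mul_pow, hpow, one_mul]
      ring
  exact key g⁻¹ z

lemma phiTwo_dihedralAct {k : ℕ} [NeZero k] (g : DihedralGroup k) (z : ℂ × ℂ) :
    phiTwo (dihedralAct g z) = phiTwo z := by
  have hone : ∀ i : ZMod k, (ZMod.toCircle i : ℂ) * (ZMod.toCircle (-i) : ℂ) = 1 := by
    intro i
    rw [← Circle.coe_mul, ← AddChar.map_add_eq_mul]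
    simp
  have key : ∀ (g : DihedralGroup k) z, phiTwo (dihedralMap g z) = phiTwo z := by
    rintro (i | i) z
    · simp only [phiTwo, dihedralMap]
      linear_combination (z.1 * z.2) * hone i
    · simp only [phiTwo, dihedralMap]
      linear_combination (z.1 * z.2) * hone i
  exact key g⁻¹ z

/-- `M_{φ₁}` restricted to `P_μ^{11}(𝔸^(λ)(𝔻²))`. -/
noncomputable def restrictedPhiOne {k : ℕ} [NeZero k] (lam : ℝ) (μ : DihedralIrrep k) :
    isotypicSpace lam μ →L[ℂ] isotypicSpace lam μ :=
  ((mulOperator (phiOne k) (memLp_phiOne k lam)).comp (isotypicSpace lam μ).subtypeL).codRestrict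
    (isotypicSpace lam μ) fun f => mulOperator_mem_isotypicSpace μ (memLp_phiOne k lam) phiOne_dihedralAct
      (fun _ hu => phiOne_mem_bergmanSpace k hu) f.1 f.2

/-- `M_{φ₂}` restricted to `P_μ^{11}(𝔸^(λ)(𝔻²))`. -/
noncomputable def restrictedPhiTwo {k : ℕ} [NeZero k] (lam : ℝ) (μ : DihedralIrrep k) :
    isotypicSpace lam μ →L[ℂ] isotypicSpace lam μ :=
  ((mulOperator phiTwo (memLp_phiTwo lam)).comp (isotypicSpace lam μ).subtypeL).codRestrict
    (isotypicSpace lam μ) fun f => mulOperator_mem_isotypicSpace μ (memLp_phiTwo lam) phiTwo_dihedralAct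
      (fun _ hu => phiTwo_mem_bergmanSpace hu) f.1 f.2

open scoped Matrix

/-! ### Fourier coefficients of holomorphic functions on circles -/

/-! The spectral set property holds because a polynomial in the restricted pair is multiplication by
`p ∘ φ`. The measure lives on the closed bidisc, and `φ` maps the closed bidisc into the closure of
the quotient domain (`phi_mem_closure_dihedralDomain`, `isDihedralContraction`).

For the inequivalence, call a vector a defect vector if it is orthogonal to the ranges of both
restricted operators. A unitary `U` intertwining the pairs maps defect vectors to defect vectors. It
also preserves the numbers `⟨M₁v, M₁v⟩`, `⟨M₁v, M₂ⁿw⟩` and `⟨M₂ⁿv, M₂ⁿw⟩` for defect vectors `v`,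
`w` (`exists_defect_map`). These numbers separate the irreducible representations.

Write `γₙ` for `moment lam n`. Rotation invariance of the measure makes the monomials `z₁ᵐz₂ⁿ`
orthogonal, with squared norms `γₘγₙ`, and complete in the space (`inner_mono_mono`,
`eq_zero_of_inner_mono_eq_zero`). Only positivity of the `γₙ` is ever used, so the Hardy and Bergman
cases are treated alike.

An irreducible representation is determined by an exponent `0 ≤ j ≤ k/2` of an eigenvalue of `μ(δ)`
and, when `j = 0` or `2j = k`, by the sign `ε` of `μ(σ)` (`exists_hasType`, `HasType.equivalent`). A
defect vector of type `j` involves only pure powers with exponents `j` and `k - j`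
(`HasType.mem_defectSupport`).

For `0 < n ≤ k/2` the form `⟨M₁v, M₂ⁿw⟩` on defect vectors is nonzero exactly when `n = j`, which
recovers `j`. If `2j = k`, the defect vectors are the multiples of `z₁ʲ + εz₂ʲ`, and `⟨M₁v, M₂ʲv⟩`
has the sign `ε`. If `j = 0`, they are the constants for `ε = 1` and the multiples of `z₁ᵏ - z₂ᵏ`
for `ε = -1`. There the ratio of `γₖ‖M₁v‖²` to `γ₀‖M₂ᵏv‖²` is `2` in the first case and `1` in the
second. -/

/-- The point of the unit circle in `ℂ` with a given angle. -/
noncomputable def unitPoint (t : UnitAddCircle) : ℂ := (AddCircle.toCircle t : ℂ)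

lemma continuous_unitPoint : Continuous unitPoint :=
  continuous_subtype_val.comp AddCircle.continuous_toCircle

lemma unitPoint_ne_zero (t : UnitAddCircle) : unitPoint t ≠ 0 := Circle.coe_ne_zero _

lemma norm_unitPoint (t : UnitAddCircle) : ‖unitPoint t‖ = 1 := Circle.norm_coe _

lemma unitPoint_add (s t : UnitAddCircle) : unitPoint (s + t) = unitPoint s * unitPoint t := by
  simp [unitPoint, AddCircle.toCircle_add]

lemma unitPoint_zero : unitPoint 0 = 1 := by simp [unitPoint]

lemma continuous_unitPoint_zpow (n : ℤ) : Continuous fun t => unitPoint t ^ n :=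
  continuous_unitPoint.zpow₀ n fun t => Or.inl (unitPoint_ne_zero t)

lemma exists_unitPoint (z : ℂ) : ∃ t, z = unitPoint t * (‖z‖ : ℂ) := by
  by_cases hz : z = 0
  · exact ⟨0, by simp [hz]⟩
  · obtain ⟨t, ht⟩ := (AddCircle.homeomorphCircle (T := 1) one_ne_zero).surjective
      ⟨z / ‖z‖, by simp [Submonoid.unitSphere, hz]⟩
    refine ⟨t, ?_⟩
    have hz' : (‖z‖ : ℂ) ≠ 0 := by simpa using hz
    have : unitPoint t = z / ‖z‖ := by
      rw [AddCircle.homeomorphCircle_apply] at ht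
      simp [unitPoint, ht]
    rw [this]; field_simp

/-- The `n`-th Fourier coefficient of `t ↦ g (e^{2πit} z)`. -/
noncomputable def circleCoeff (g : ℂ → ℂ) (z : ℂ) (n : ℤ) : ℂ :=
  ∫ t : UnitAddCircle, unitPoint t ^ (-n) * g (unitPoint t * z)

lemma circleCoeff_unitPoint_mul (g : ℂ → ℂ) (s : UnitAddCircle) (z : ℂ) (n : ℤ) :
    circleCoeff g (unitPoint s * z) n = unitPoint s ^ n * circleCoeff g z n := by
  unfold circleCoeff
  rw [← integral_const_mul, ← integral_add_right_eq_self (μ := volume)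
    (fun t => unitPoint s ^ n * (unitPoint t ^ (-n) * g (unitPoint t * z))) s]
  congr 1
  funext t
  rw [unitPoint_add, mul_zpow, zpow_neg (unitPoint s)]
  have := zpow_ne_zero n (unitPoint_ne_zero s)
  field_simp

/-- The substitution `θ = 2πx` turns the average over the circle into a contour integral, to which
Cauchy's theorem applies. -/
lemma circleCoeff_eq_circleIntegral (g : ℂ → ℂ) {r : ℝ} (hr : 0 < r) (n : ℤ) :
    (2 * π * Complex.I : ℂ) * ((r : ℂ) ^ (-n) * circleCoeff g r n) =
      ∮ z in C(0, r), (z - 0)⁻¹ • (z ^ (-n) * g z) := by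
  have hr0 : (r : ℂ) ≠ 0 := by exact_mod_cast hr.ne'
  have h1 : circleCoeff g r n =
      ∫ x in (0 : ℝ)..1, (unitPoint (x : UnitAddCircle)) ^ (-n) *
        g (unitPoint (x : UnitAddCircle) * r) := by
    have := UnitAddCircle.intervalIntegral_preimage 0
      (fun t => unitPoint t ^ (-n) * g (unitPoint t * r))
    rw [zero_add] at this
    rw [this]; rfl
  have h2 : ∀ x : ℝ, unitPoint (x : UnitAddCircle) * r = circleMap 0 r (2 * π * x) := by
    intro x
    simp only [unitPoint, circleMap, AddCircle.toCircle_apply_mk, Circle.coe_exp]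
    push_cast; ring_nf
  rw [circleIntegral]
  have h3 := intervalIntegral.smul_integral_comp_mul_left (a := 0) (b := 1)
    (fun θ : ℝ => deriv (circleMap 0 r) θ • ((circleMap 0 r θ - 0)⁻¹ •
      (circleMap 0 r θ ^ (-n) * g (circleMap 0 r θ)))) (2 * π)
  rw [mul_zero, mul_one] at h3
  rw [← h3, h1, ← intervalIntegral.integral_const_mul, ← intervalIntegral.integral_const_mul,
    ← intervalIntegral.integral_smul]
  refine intervalIntegral.integral_congr fun x _ => ?_
  have hne : circleMap 0 r (2 * π * x) ≠ 0 := circleMap_ne_center hr.ne'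
  simp only [deriv_circleMap, sub_zero, ← h2, smul_eq_mul, mul_zpow, Complex.real_smul]
  have := unitPoint_ne_zero (x : UnitAddCircle)
  push_cast
  field_simp

/-- The integrand `z⁻ⁿ⁻¹ g(z)` is holomorphic off the origin, so its contour integral does not
depend on the radius. -/
lemma circleCoeff_radial {g : ℂ → ℂ} (hg : DifferentiableOn ℂ g (Metric.ball 0 1)) {r ρ : ℝ}
    (hr : 0 < r) (hrρ : r ≤ ρ) (hρ : ρ < 1) (n : ℤ) :
    (r : ℂ) ^ (-n) * circleCoeff g r n = (ρ : ℂ) ^ (-n) * circleCoeff g ρ n := by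
  have h2 : (2 * π * Complex.I : ℂ) ≠ 0 := by simp [Real.pi_ne_zero]
  apply mul_left_cancel₀ h2
  rw [circleCoeff_eq_circleIntegral g hr, circleCoeff_eq_circleIntegral g (hr.trans_le hrρ)]
  have hd : ∀ z ∈ Metric.ball (0 : ℂ) 1, z ≠ 0 → DifferentiableAt ℂ (fun z => z ^ (-n) * g z) z :=
    fun z hz h0 => (differentiableAt_zpow.2 (Or.inl h0)).mul
      (hg.differentiableAt (Metric.isOpen_ball.mem_nhds hz))
  symm
  apply Complex.circleIntegral_sub_center_inv_smul_eq_of_differentiable_on_annulus_off_countable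
    hr hrρ Set.countable_empty
  · intro z hz
    refine (hd z ?_ ?_).continuousAt.continuousWithinAt
    · simpa using lt_of_le_of_lt (by simpa using hz.1) hρ
    · rintro rfl
      exact hz.2 (Metric.mem_ball_self hr)
  · intro z hz
    refine hd z ?_ ?_
    · simpa using lt_trans (by simpa using hz.1.1) hρ
    · rintro rfl
      exact hz.1.2 (Metric.mem_closedBall_self hr.le)

/-- A rotation reduces to `z = ‖z‖`, and the radius is then moved to the reference value `1/2`. The
factor `2ⁿ · circleCoeff g (1/2) n` is the `n`-th Taylor coefficient. -/
lemma circleCoeff_eq {g : ℂ → ℂ} (hg : DifferentiableOn ℂ g (Metric.ball 0 1)) {z : ℂ}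
    (hz : z ≠ 0) (hz1 : ‖z‖ < 1) (n : ℤ) :
    circleCoeff g z n = z ^ n * (2 ^ n * circleCoeff g (1 / 2) n) := by
  obtain ⟨s, hs⟩ := exists_unitPoint z
  have hz0 : 0 < ‖z‖ := norm_pos_iff.2 hz
  have key : (‖z‖ : ℂ) ^ (-n) * circleCoeff g ‖z‖ n = 2 ^ n * circleCoeff g (1 / 2) n := by
    have h2 : (((1 / 2 : ℝ)) : ℂ) ^ (-n) * circleCoeff g ((1 / 2 : ℝ) : ℂ) n =
        2 ^ n * circleCoeff g (1 / 2) n := by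
      push_cast
      rw [one_div, inv_zpow', neg_neg]
    rw [← h2]
    rcases le_total ‖z‖ (1 / 2) with h | h
    · exact circleCoeff_radial hg hz0 h (by norm_num) n
    · exact (circleCoeff_radial hg (by norm_num) h hz1 n).symm
  rw [← key]
  conv_lhs => rw [hs]
  rw [circleCoeff_unitPoint_mul]
  conv_rhs => rw [hs]
  have := zpow_ne_zero n (Complex.ofReal_ne_zero.2 hz0.ne')
  simp only [mul_zpow, zpow_neg, norm_mul, norm_unitPoint, one_mul, Complex.norm_real, norm_norm]
  field_simp

/-- For `n = -(m + 1)` the function `zᵐ⁺¹ g(z)` is holomorphic and vanishes at the centre, so the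
Cauchy formula there gives zero. -/
lemma circleCoeff_neg {g : ℂ → ℂ} (hg : DifferentiableOn ℂ g (Metric.ball 0 1)) {z : ℂ}
    (hz : z ≠ 0) (hz1 : ‖z‖ < 1) {n : ℤ} (hn : n < 0) : circleCoeff g z n = 0 := by
  obtain ⟨m, rfl⟩ : ∃ m : ℕ, n = -((m + 1 : ℕ) : ℤ) := ⟨(-n - 1).toNat, by omega⟩
  have half : circleCoeff g (1 / 2) (-((m + 1 : ℕ) : ℤ)) = 0 := by
    have h1 := circleCoeff_eq_circleIntegral g (r := 1 / 2) (by norm_num) (-((m + 1 : ℕ) : ℤ))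
    have hd : ∀ z ∈ Metric.ball (0 : ℂ) 1,
        DifferentiableAt ℂ (fun z => z ^ (- -((m + 1 : ℕ) : ℤ)) * g z) z := by
      intro z hz
      simp only [neg_neg, zpow_natCast]
      exact (differentiableAt_pow _).mul (hg.differentiableAt (Metric.isOpen_ball.mem_nhds hz))
    have h0 := hd 0 (by simp)
    have h3 := Complex.circleIntegral_sub_center_inv_smul_of_differentiable_on_off_countable_of_tendsto
      (c := 0) (R := 1 / 2) (by norm_num) Set.countable_empty
      (f := fun z => z ^ (- -((m + 1 : ℕ) : ℤ)) * g z)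
      (fun z hz => (hd z (by
        have := hz.1
        simp only [mem_closedBall_zero_iff] at this
        simp only [mem_ball_zero_iff]; linarith)).continuousAt.continuousWithinAt)
      (fun z hz => hd z (by
        have := hz.1.1
        simp only [mem_ball_zero_iff] at this ⊢
        linarith))
      (h0.continuousAt.tendsto.mono_left nhdsWithin_le_nhds)
    rw [h3] at h1
    have h4 : (((1 / 2 : ℝ) : ℂ)) ^ (- -((m + 1 : ℕ) : ℤ)) ≠ 0 := zpow_ne_zero _ (by norm_num)
    rw [neg_neg, zero_zpow _ (by positivity), zero_mul, smul_zero] at h1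
    rw [neg_neg] at h4
    have h5 := (mul_eq_zero.1 h1).resolve_left (by simp [Real.pi_ne_zero])
    have h6 := (mul_eq_zero.1 h5).resolve_left h4
    push_cast at h6 ⊢
    exact h6
  rw [circleCoeff_eq hg hz hz1, half, mul_zero, mul_zero]

/-- A Fourier series with zero coefficients is summable, hence converges pointwise to the continuous
function. -/
lemma eq_zero_of_circle_coeff_eq_zero {h : UnitAddCircle → ℂ} (hc : Continuous h)
    (h0 : ∀ n : ℤ, ∫ t, unitPoint t ^ (-n) * h t = 0) (t : UnitAddCircle) : h t = 0 := by
  have hz : ∀ n, fourierCoeff (⟨h, hc⟩ : C(UnitAddCircle, ℂ)) n = 0 := by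
    intro n
    rw [← h0 n, fourierCoeff]
    have : (volume : Measure UnitAddCircle) = AddCircle.haarAddCircle := by
      rw [AddCircle.volume_eq_smul_haarAddCircle]; simp
    rw [this]
    congr 1
    funext t
    simp [fourier_apply, unitPoint, AddCircle.toCircle_neg, AddCircle.toCircle_zsmul]
  have hs := has_pointwise_sum_fourier_series_of_summable
    (f := (⟨h, hc⟩ : C(UnitAddCircle, ℂ))) (by simp only [funext hz]; exact summable_zero) t
  simp only [hz, zero_smul] at hs
  exact hs.unique hasSum_zero

/-! ### Fourier coefficients on tori of functions holomorphic in the bidisc -/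

/-- The rotation of `z` by the angles `x`. -/
noncomputable def torusRotate (x : UnitAddCircle × UnitAddCircle) (z : ℂ × ℂ) : ℂ × ℂ :=
  (unitPoint x.1 * z.1, unitPoint x.2 * z.2)

lemma torusRotate_mem_bidisc {z : ℂ × ℂ} (hz : z ∈ bidisc) (x) : torusRotate x z ∈ bidisc := by
  simpa [torusRotate, bidisc, norm_unitPoint] using hz

/-- The Fourier coefficient of index `(m, n)` of `F` on the torus through `z`. -/
noncomputable def torusCoeff (F : ℂ × ℂ → ℂ) (z : ℂ × ℂ) (m n : ℤ) : ℂ :=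
  ∫ x : UnitAddCircle × UnitAddCircle,
    unitPoint x.1 ^ (-m) * unitPoint x.2 ^ (-n) * F (torusRotate x z)

lemma continuous_torus {F : ℂ × ℂ → ℂ} (hF : ContinuousOn F bidisc) {z : ℂ × ℂ}
    (hz : z ∈ bidisc) : Continuous fun x => F (torusRotate x z) := by
  refine hF.comp_continuous ?_ (torusRotate_mem_bidisc hz)
  have := continuous_unitPoint
  unfold torusRotate
  fun_prop

lemma continuous_torusCoeff_integrand {F : ℂ × ℂ → ℂ} (hF : ContinuousOn F bidisc) {z : ℂ × ℂ}
    (hz : z ∈ bidisc) (m n : ℤ) : Continuous fun x : UnitAddCircle × UnitAddCircle =>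
      unitPoint x.1 ^ (-m) * unitPoint x.2 ^ (-n) * F (torusRotate x z) :=
  (((continuous_unitPoint_zpow (-m)).comp continuous_fst).mul
    ((continuous_unitPoint_zpow (-n)).comp continuous_snd)).mul (continuous_torus hF hz)

/-- Fubini's theorem in the two orders lets the one-variable results act on either coordinate. -/
lemma torusCoeff_eq_fst {F : ℂ × ℂ → ℂ} (hF : ContinuousOn F bidisc) {z : ℂ × ℂ}
    (hz : z ∈ bidisc) (m n : ℤ) : torusCoeff F z m n =
      ∫ t, unitPoint t ^ (-n) * circleCoeff (fun w => F (w, unitPoint t * z.2)) z.1 m := by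
  have hi := (continuous_torusCoeff_integrand hF hz m n).integrable_of_hasCompactSupport
    (μ := volume) (HasCompactSupport.of_compactSpace _)
  rw [torusCoeff]
  rw [Measure.volume_eq_prod] at hi ⊢
  rw [integral_prod_symm _ hi]
  congr 1; funext t
  rw [circleCoeff, ← integral_const_mul]
  congr 1; funext s
  simp only [torusRotate]
  ring

lemma torusCoeff_eq_snd {F : ℂ × ℂ → ℂ} (hF : ContinuousOn F bidisc) {z : ℂ × ℂ}
    (hz : z ∈ bidisc) (m n : ℤ) : torusCoeff F z m n =
      ∫ s, unitPoint s ^ (-m) * circleCoeff (fun w => F (unitPoint s * z.1, w)) z.2 n := by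
  have hi := (continuous_torusCoeff_integrand hF hz m n).integrable_of_hasCompactSupport
    (μ := volume) (HasCompactSupport.of_compactSpace _)
  rw [torusCoeff]
  rw [Measure.volume_eq_prod] at hi ⊢
  rw [integral_prod _ hi]
  congr 1; funext t
  rw [circleCoeff, ← integral_const_mul]
  congr 1; funext s
  simp only [torusRotate]
  ring

lemma differentiableOn_slice_fst {F : ℂ × ℂ → ℂ} (hF : DifferentiableOn ℂ F bidisc) {b : ℂ}
    (hb : ‖b‖ < 1) : DifferentiableOn ℂ (fun w => F (w, b)) (Metric.ball 0 1) :=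
  hF.comp (by fun_prop) fun w hw => ⟨by simpa using hw, hb⟩

lemma differentiableOn_slice_snd {F : ℂ × ℂ → ℂ} (hF : DifferentiableOn ℂ F bidisc) {a : ℂ}
    (ha : ‖a‖ < 1) : DifferentiableOn ℂ (fun w => F (a, w)) (Metric.ball 0 1) :=
  hF.comp (by fun_prop) fun w hw => ⟨ha, by simpa using hw⟩

/-- The Taylor coefficient of index `(m, n)` at the origin of a function holomorphic in the
bidisc; it vanishes unless both indices are nonnegative. -/
noncomputable def taylorCoeff (F : ℂ × ℂ → ℂ) (m n : ℤ) : ℂ :=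
  2 ^ m * 2 ^ n * torusCoeff F (1 / 2, 1 / 2) m n

lemma half_norm_lt : ‖(1 / 2 : ℂ)‖ < 1 := by norm_num

/-- The coordinates are moved to the reference radius `1/2` one at a time. -/
lemma torusCoeff_eq {F : ℂ × ℂ → ℂ} (hF : DifferentiableOn ℂ F bidisc) {z : ℂ × ℂ}
    (hz : z ∈ bidisc) (h1 : z.1 ≠ 0) (h2 : z.2 ≠ 0) (m n : ℤ) :
    torusCoeff F z m n = taylorCoeff F m n * (z.1 ^ m * z.2 ^ n) := by
  have hr : ∀ (t : UnitAddCircle) (b : ℂ), ‖b‖ < 1 → ‖unitPoint t * b‖ < 1 := fun t b hb => by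
    rwa [norm_mul, norm_unitPoint, one_mul]
  have e1 : torusCoeff F z m n = z.1 ^ m * 2 ^ m * torusCoeff F (1 / 2, z.2) m n := by
    rw [torusCoeff_eq_fst hF.continuousOn hz,
      torusCoeff_eq_fst hF.continuousOn (z := (1 / 2, z.2)) ⟨half_norm_lt, hz.2⟩,
      ← integral_const_mul]
    congr 1; funext t
    rw [circleCoeff_eq (differentiableOn_slice_fst hF (hr t _ hz.2)) h1 hz.1]
    ring
  have e2 : torusCoeff F (1 / 2, z.2) m n =
      z.2 ^ n * 2 ^ n * torusCoeff F (1 / 2, 1 / 2) m n := by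
    rw [torusCoeff_eq_snd hF.continuousOn (z := (1 / 2, z.2)) ⟨half_norm_lt, hz.2⟩,
      torusCoeff_eq_snd hF.continuousOn (z := (1 / 2, 1 / 2)) ⟨half_norm_lt, half_norm_lt⟩,
      ← integral_const_mul]
    congr 1; funext t
    rw [circleCoeff_eq (differentiableOn_slice_snd hF (hr t _ half_norm_lt)) h2 hz.2]
    ring
  rw [e1, e2, taylorCoeff]
  ring

lemma taylorCoeff_of_neg_fst {F : ℂ × ℂ → ℂ} (hF : DifferentiableOn ℂ F bidisc) {m : ℤ}
    (hm : m < 0) (n : ℤ) : taylorCoeff F m n = 0 := by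
  rw [taylorCoeff, torusCoeff_eq_fst hF.continuousOn ⟨half_norm_lt, half_norm_lt⟩]
  have : ∀ t, circleCoeff (fun w => F (w, unitPoint t * (1 / 2))) (1 / 2) m = 0 := fun t =>
    circleCoeff_neg (differentiableOn_slice_fst hF
      (by rw [norm_mul, norm_unitPoint, one_mul]; exact half_norm_lt)) (by norm_num)
      half_norm_lt hm
  simp only [this, mul_zero, integral_zero]

lemma taylorCoeff_of_neg_snd {F : ℂ × ℂ → ℂ} (hF : DifferentiableOn ℂ F bidisc) (m : ℤ) {n : ℤ}
    (hn : n < 0) : taylorCoeff F m n = 0 := by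
  rw [taylorCoeff, torusCoeff_eq_snd hF.continuousOn ⟨half_norm_lt, half_norm_lt⟩]
  have : ∀ t, circleCoeff (fun w => F (unitPoint t * (1 / 2), w)) (1 / 2) n = 0 := fun t =>
    circleCoeff_neg (differentiableOn_slice_snd hF
      (by rw [norm_mul, norm_unitPoint, one_mul]; exact half_norm_lt)) (by norm_num)
      half_norm_lt hn
  simp only [this, mul_zero, integral_zero]

/-- The indices are integers so that a shift below zero needs no case distinction: the coefficient
there vanishes for holomorphic functions. -/
lemma torusCoeff_monomial_mul (F : ℂ × ℂ → ℂ) (p q : ℕ) (z : ℂ × ℂ) (m n : ℤ) :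
    torusCoeff (fun w => w.1 ^ p * w.2 ^ q * F w) z m n =
      z.1 ^ p * z.2 ^ q * torusCoeff F z (m - p) (n - q) := by
  unfold torusCoeff
  rw [← integral_const_mul]
  congr 1
  funext x
  simp only [torusRotate, mul_pow]
  rw [neg_sub, sub_eq_add_neg, zpow_add₀ (unitPoint_ne_zero x.1), zpow_natCast,
    neg_sub, sub_eq_add_neg, zpow_add₀ (unitPoint_ne_zero x.2), zpow_natCast]
  ring

lemma continuous_circleCoeff_slice {F : ℂ × ℂ → ℂ} (hF : ContinuousOn F bidisc) {z : ℂ × ℂ}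
    (hz : z ∈ bidisc) (m : ℤ) :
    Continuous fun t => circleCoeff (fun w => F (w, unitPoint t * z.2)) z.1 m := by
  have := continuous_parametric_integral_of_continuous (μ := (volume : Measure UnitAddCircle))
    (s := Set.univ) (f := fun t s : UnitAddCircle =>
    unitPoint s ^ (-m) * F (unitPoint s * z.1, unitPoint t * z.2)) ?_ isCompact_univ
  · simp only [Measure.restrict_univ] at this
    exact this
  · exact ((continuous_unitPoint_zpow (-m)).comp continuous_snd).mul
      ((continuous_torus hF hz).comp continuous_swap)

/-- Uniqueness of Fourier series is used twice, first in the angle of the second coordinate and then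
in that of the first. Points off the coordinate axes suffice later, since the axes are null sets. -/
lemma eq_zero_of_taylorCoeff_eq_zero {F : ℂ × ℂ → ℂ} (hF : DifferentiableOn ℂ F bidisc)
    (h : ∀ m n : ℕ, taylorCoeff F m n = 0) {z : ℂ × ℂ} (hz : z ∈ bidisc) (h1 : z.1 ≠ 0)
    (h2 : z.2 ≠ 0) : F z = 0 := by
  have h0 : ∀ m n : ℤ, torusCoeff F z m n = 0 := by
    intro m n
    rw [torusCoeff_eq hF hz h1 h2]
    rcases lt_or_ge m 0 with hm | hm
    · rw [taylorCoeff_of_neg_fst hF hm, zero_mul]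
    rcases lt_or_ge n 0 with hn | hn
    · rw [taylorCoeff_of_neg_snd hF _ hn, zero_mul]
    lift m to ℕ using hm
    lift n to ℕ using hn
    rw [h, zero_mul]
  have hm : ∀ m t, circleCoeff (fun w => F (w, unitPoint t * z.2)) z.1 m = 0 := by
    intro m
    apply eq_zero_of_circle_coeff_eq_zero (continuous_circleCoeff_slice hF.continuousOn hz m)
    intro n
    rw [← torusCoeff_eq_fst hF.continuousOn hz, h0]
  have hc : Continuous fun s => F (unitPoint s * z.1, unitPoint 0 * z.2) :=
    (continuous_torus hF.continuousOn hz).comp 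
      (by fun_prop : Continuous fun s : UnitAddCircle => (s, (0 : UnitAddCircle)))
  have := eq_zero_of_circle_coeff_eq_zero hc (fun m => hm m 0) 0
  simpa [unitPoint_zero] using this

/-! ### The one-variable measures and their moments -/

lemma discMeasure_ae_ne_zero (lam : ℝ) : ∀ᵐ z ∂(discMeasure lam), z ≠ 0 := by
  unfold discMeasure
  split_ifs
  · filter_upwards [circleMeasure_ae_norm_eq] with z hz h0
    simp [h0] at hz
  · unfold weightedDiscMeasure
    refine (withDensity_absolutelyContinuous _ _).ae_le ?_
    refine ae_restrict_of_ae ?_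
    simp [ae_iff]

lemma discMeasure_ae_norm_lt {lam : ℝ} (h : lam ≠ 1) : ∀ᵐ z ∂(discMeasure lam), ‖z‖ < 1 := by
  rw [discMeasure, if_neg h, weightedDiscMeasure]
  refine (withDensity_absolutelyContinuous _ _).ae_le ?_
  filter_upwards [ae_restrict_mem Metric.isOpen_ball.measurableSet] with z hz
  simpa using hz

/-- The integrand may blow up at `1`, but it is nonnegative and its antiderivative `-(1 - y²)ᵃ /
(2a)` is continuous up to `1`. -/
lemma integrableOn_radial_weight {a : ℝ} (ha : 0 < a) :
    IntegrableOn (fun y : ℝ => y * (1 - y ^ 2) ^ (a - 1)) (Set.Ioc 0 1) := by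
  have h := intervalIntegral.integrableOn_deriv_of_nonneg (a := 0) (b := 1)
    (g := fun y : ℝ => -(1 - y ^ 2) ^ a / (2 * a))
    (g' := fun y : ℝ => y * (1 - y ^ 2) ^ (a - 1)) ?_ ?_ ?_
  · exact h
  · have : Continuous fun y : ℝ => (1 - y ^ 2) ^ a :=
      (by fun_prop : Continuous fun y : ℝ => 1 - y ^ 2).rpow_const fun _ => Or.inr ha.le
    exact (this.neg.div_const _).continuousOn
  · intro y hy
    have hy1 : 0 < 1 - y ^ 2 := by nlinarith [hy.1, hy.2]
    have h1 : HasDerivAt (fun y : ℝ => 1 - y ^ 2) (-(2 * y)) y := by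
      simpa using (hasDerivAt_pow 2 y).const_sub 1
    have h2 := ((h1.rpow_const (p := a) (Or.inl hy1.ne')).neg).div_const (2 * a)
    convert! h2 using 1
    field_simp
  · intro y hy
    have hy1 : 0 < 1 - y ^ 2 := by nlinarith [hy.1, hy.2]
    exact mul_nonneg hy.1.le (Real.rpow_nonneg hy1.le _)

lemma isFiniteMeasure_discMeasure {lam : ℝ} (hlam : 1 ≤ lam) :
    IsFiniteMeasure (discMeasure lam) := by
  unfold discMeasure
  split_ifs with h
  · infer_instance
  · have hl : 1 < lam := lt_of_le_of_ne hlam (Ne.symm h)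
    unfold weightedDiscMeasure
    -- In polar coordinates the density becomes the radial weight with `a = lam - 1`. The indicator
    -- cuts it off outside the disc.
    have key : Integrable (fun z : ℂ => (fun y : ℝ => (Set.Iio (1 : ℝ)).indicator
        (fun y => (lam - 1) / π * (1 - y ^ 2) ^ (lam - 2)) y) ‖z‖) := by
      rw [integrable_fun_norm_addHaar volume]
      have h1 := integrableOn_radial_weight (a := lam - 1) (by linarith)
      have h2 : IntegrableOn ((Set.Iio (1 : ℝ)).indicator
          (fun y => y * (1 - y ^ 2) ^ (lam - 2))) (Set.Ioi 0) := by
        rw [IntegrableOn, integrable_indicator_iff measurableSet_Iio, IntegrableOn,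
          Measure.restrict_restrict measurableSet_Iio]
        refine IntegrableOn.mono_set (t := Set.Ioc 0 1) ?_ fun y hy => ⟨hy.2, le_of_lt hy.1⟩
        rwa [show lam - 1 - 1 = lam - 2 by ring] at h1
      refine IntegrableOn.congr_fun (h2.const_mul ((lam - 1) / π)) ?_ measurableSet_Ioi
      intro y _
      by_cases hy : y ∈ Set.Iio (1 : ℝ)
      · simp only [Set.indicator_of_mem hy, Complex.finrank_real_complex, smul_eq_mul]
        ring
      · simp only [Set.indicator_of_notMem hy, smul_zero, mul_zero]
    refine isFiniteMeasure_withDensity_ofReal ?_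
    refine Integrable.hasFiniteIntegral ?_
    refine (key.integrableOn (s := Metric.ball 0 1)).congr ?_
    filter_upwards [ae_restrict_mem Metric.isOpen_ball.measurableSet] with z hz
    have : ‖z‖ ∈ Set.Iio (1 : ℝ) := by simpa using hz
    simp only [Set.indicator_of_mem this]

lemma discMeasure_ne_zero {lam : ℝ} (hlam : 1 ≤ lam) : discMeasure lam ≠ 0 := by
  unfold discMeasure
  split_ifs with h
  · unfold circleMeasure
    rw [Ne, Measure.map_eq_zero_iff measurable_toCircle_coe.aemeasurable]
    exact NeZero.ne _
  · have hl : 1 < lam := lt_of_le_of_ne hlam (Ne.symm h)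
    unfold weightedDiscMeasure
    rw [Ne, withDensity_eq_zero_iff (by fun_prop)]
    intro h0
    have : ∀ᵐ z : ℂ ∂(volume.restrict (Metric.ball (0 : ℂ) 1)), False := by
      filter_upwards [h0, ae_restrict_mem Metric.isOpen_ball.measurableSet] with z hz hz1
      have hz2 : ‖z‖ < 1 := by simpa using hz1
      have : 0 < 1 - ‖z‖ ^ 2 := by nlinarith [norm_nonneg z]
      have h3 : 0 < (lam - 1) / π * (1 - ‖z‖ ^ 2) ^ (lam - 2) :=
        mul_pos (div_pos (by linarith) Real.pi_pos) (Real.rpow_pos_of_pos this _)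
      simp only [Pi.zero_apply, ENNReal.ofReal_eq_zero] at hz
      linarith
    rw [eventually_false_iff_eq_bot, ae_eq_bot, Measure.restrict_eq_zero] at this
    exact (Metric.measure_ball_pos volume (0 : ℂ) one_pos).ne' this

/-- The squared norm of `zⁿ` in `L²` of the one-variable measure. -/
noncomputable def moment (lam : ℝ) (n : ℕ) : ℝ := ∫ z, ‖z‖ ^ (2 * n) ∂(discMeasure lam)

lemma moment_pos {lam : ℝ} (hlam : 1 ≤ lam) (n : ℕ) : 0 < moment lam n := by
  have := isFiniteMeasure_discMeasure hlam
  unfold moment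
  rw [integral_pos_iff_support_of_nonneg (fun z => by positivity)]
  · have h1 : Function.support (fun z : ℂ => ‖z‖ ^ (2 * n)) =ᵐ[discMeasure lam] Set.univ := by
      rw [eventuallyEq_univ]
      filter_upwards [discMeasure_ae_ne_zero lam] with z hz
      simp [hz]
    rw [measure_congr h1]
    exact (Measure.measure_univ_pos).2 (discMeasure_ne_zero hlam)
  · refine Integrable.of_bound (C := 1) (by fun_prop) ?_
    filter_upwards [discMeasure_ae_norm_le lam] with z hz
    rw [norm_pow, norm_norm]
    exact pow_le_one₀ (norm_nonneg _) hz

instance sFinite_bidiscMeasure (lam : ℝ) : SFinite (bidiscMeasure lam) := by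
  unfold bidiscMeasure; infer_instance

lemma isFiniteMeasure_bidiscMeasure {lam : ℝ} (hlam : 1 ≤ lam) :
    IsFiniteMeasure (bidiscMeasure lam) := by
  have := isFiniteMeasure_discMeasure hlam
  unfold bidiscMeasure
  infer_instance

lemma bidiscMeasure_ae_ne_zero (lam : ℝ) :
    ∀ᵐ z ∂(bidiscMeasure lam), z.1 ≠ 0 ∧ z.2 ≠ 0 := by
  have h := discMeasure_ae_ne_zero lam
  have h1 := (Measure.quasiMeasurePreserving_fst
    (μ := discMeasure lam) (ν := discMeasure lam)).ae h
  have h2 := (Measure.quasiMeasurePreserving_snd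
    (μ := discMeasure lam) (ν := discMeasure lam)).ae h
  filter_upwards [h1, h2] with z hz1 hz2 using ⟨hz1, hz2⟩

lemma bidiscMeasure_ae_mem_bidisc {lam : ℝ} (hl : lam ≠ 1) :
    ∀ᵐ z ∂(bidiscMeasure lam), z ∈ bidisc := by
  have h := discMeasure_ae_norm_lt hl
  have h1 := (Measure.quasiMeasurePreserving_fst
    (μ := discMeasure lam) (ν := discMeasure lam)).ae h
  have h2 := (Measure.quasiMeasurePreserving_snd
    (μ := discMeasure lam) (ν := discMeasure lam)).ae h
  filter_upwards [h1, h2] with z hz1 hz2 using ⟨hz1, hz2⟩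

/-! ### Averaging over the torus -/

/-- Each rotation preserves the measure and the torus has total mass one, so averaging over the
rotations leaves integrals unchanged. -/
lemma measurePreserving_torusRotate (lam : ℝ) :
    MeasurePreserving (fun p : (UnitAddCircle × UnitAddCircle) × (ℂ × ℂ) => torusRotate p.1 p.2)
      ((volume : Measure (UnitAddCircle × UnitAddCircle)).prod (bidiscMeasure lam))
      (bidiscMeasure lam) := by
  have hm : Measurable (Function.uncurry torusRotate) := by
    have := continuous_unitPoint
    apply Continuous.measurable
    unfold torusRotate Function.uncurry
    fun_prop
  have hx : ∀ x, MeasurePreserving (torusRotate x) (bidiscMeasure lam) (bidiscMeasure lam) :=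
    fun x => (measurePreserving_rotation lam x.1).prod (measurePreserving_rotation lam x.2)
  have h := (MeasurePreserving.id (volume : Measure (UnitAddCircle × UnitAddCircle))).skew_product
    (μc := bidiscMeasure lam) hm (ae_of_all _ fun x => (hx x).map_eq)
  have hvol : (volume : Measure (UnitAddCircle × UnitAddCircle)) Set.univ = 1 := by
    rw [Measure.volume_eq_prod, ← Set.univ_prod_univ, Measure.prod_prod]
    simp
  have : IsProbabilityMeasure (volume : Measure (UnitAddCircle × UnitAddCircle)) := ⟨hvol⟩
  exact measurePreserving_snd.comp h

lemma conj_unitPoint (t : UnitAddCircle) : (starRingEnd ℂ) (unitPoint t) = (unitPoint t)⁻¹ := by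
  rw [unitPoint, ← Circle.coe_inv_eq_conj, Circle.coe_inv]

/-- Averaging the integrand over the torus through `z` replaces `G` by its Fourier coefficient of
index `(m, n)`. What remains is `c ‖z₁‖²ᵐ ‖z₂‖²ⁿ`, whose integral is a product of moments. -/
lemma integral_conj_monomial_mul {lam : ℝ} {G : ℂ × ℂ → ℂ} (hG : Integrable G (bidiscMeasure lam))
    {m n : ℕ} {c : ℂ}
    (hc : ∀ᵐ z ∂(bidiscMeasure lam), torusCoeff G z m n = c * (z.1 ^ m * z.2 ^ n)) :
    ∫ z, (starRingEnd ℂ) (z.1 ^ m * z.2 ^ n) * G z ∂(bidiscMeasure lam) =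
      c * (moment lam m * moment lam n) := by
  set H : ℂ × ℂ → ℂ := fun z => (starRingEnd ℂ) (z.1 ^ m * z.2 ^ n) * G z with hH
  have hHi : Integrable H (bidiscMeasure lam) := by
    refine hG.bdd_mul (c := 1) (Continuous.aestronglyMeasurable (by fun_prop)) ?_
    filter_upwards [bidiscMeasure_ae_norm_le lam] with z hz
    simp only [RCLike.norm_conj, norm_mul, norm_pow]
    exact mul_le_one₀ (pow_le_one₀ (norm_nonneg _) hz.1) (by positivity)
      (pow_le_one₀ (norm_nonneg _) hz.2)
  have hmp := measurePreserving_torusRotate lam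
  have h1 : ∫ z, H z ∂(bidiscMeasure lam) = ∫ z, ∫ x, H (torusRotate x z)
      ∂(volume : Measure (UnitAddCircle × UnitAddCircle)) ∂(bidiscMeasure lam) := by
    have hi : Integrable (fun p : (UnitAddCircle × UnitAddCircle) × (ℂ × ℂ) =>
        H (torusRotate p.1 p.2)) ((volume : Measure (UnitAddCircle × UnitAddCircle)).prod
          (bidiscMeasure lam)) := (hmp.integrable_comp hHi.aestronglyMeasurable).2 hHi
    rw [← integral_prod_symm _ hi]
    conv_lhs => rw [← hmp.map_eq]
    rw [integral_map hmp.measurable.aemeasurable]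
    rw [hmp.map_eq]
    exact hHi.aestronglyMeasurable
  rw [h1]
  have h2 : ∀ᵐ z ∂(bidiscMeasure lam), ∫ x, H (torusRotate x z)
      ∂(volume : Measure (UnitAddCircle × UnitAddCircle)) =
      c * ((‖z.1‖ ^ (2 * m) : ℝ) * (‖z.2‖ ^ (2 * n) : ℝ)) := by
    filter_upwards [hc] with z hz
    have : ∀ x, H (torusRotate x z) = (starRingEnd ℂ) (z.1 ^ m * z.2 ^ n) *
        (unitPoint x.1 ^ (-m : ℤ) * unitPoint x.2 ^ (-n : ℤ) * G (torusRotate x z)) := by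
      intro x
      simp only [hH, torusRotate, map_mul, map_pow, conj_unitPoint, mul_pow, zpow_neg,
        zpow_natCast, inv_pow]
      ring
    simp only [this]
    rw [integral_const_mul]
    change _ * torusCoeff G z m n = _
    rw [hz, map_mul, map_pow, map_pow]
    push_cast
    rw [pow_mul, pow_mul, ← Complex.conj_mul', ← Complex.conj_mul']
    ring
  rw [integral_congr_ae h2, integral_const_mul, bidiscMeasure,
    integral_prod_mul (fun z : ℂ => ((‖z‖ ^ (2 * m) : ℝ) : ℂ))
      (fun z : ℂ => ((‖z‖ ^ (2 * n) : ℝ) : ℂ)), integral_complex_ofReal, integral_complex_ofReal]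
  rfl

/-! ### Monomials and Taylor coefficients of elements of the weighted Bergman spaces -/

lemma norm_monomial_le {z : ℂ × ℂ} (h1 : ‖z.1‖ ≤ 1) (h2 : ‖z.2‖ ≤ 1) (m n : ℕ) :
    ‖z.1 ^ m * z.2 ^ n‖ ≤ 1 := by
  rw [norm_mul, norm_pow, norm_pow]
  exact mul_le_one₀ (pow_le_one₀ (norm_nonneg _) h1) (by positivity)
    (pow_le_one₀ (norm_nonneg _) h2)

lemma memLp_top_monomial (lam : ℝ) (m n : ℕ) :
    MemLp (fun z : ℂ × ℂ => z.1 ^ m * z.2 ^ n) ∞ (bidiscMeasure lam) := by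
  refine memLp_top_of_bound (C := 1) (Continuous.aestronglyMeasurable (by fun_prop)) ?_
  filter_upwards [bidiscMeasure_ae_norm_le lam] with z hz using norm_monomial_le hz.1 hz.2 m n

lemma memLp_monomial {lam : ℝ} (hlam : 1 ≤ lam) (m n : ℕ) :
    MemLp (fun z : ℂ × ℂ => z.1 ^ m * z.2 ^ n) 2 (bidiscMeasure lam) :=
  have := isFiniteMeasure_bidiscMeasure hlam
  (memLp_top_monomial lam m n).mono_exponent le_top

/-- The monomial `z₁ᵐ z₂ⁿ` as an element of `L²`. -/
noncomputable def mono {lam : ℝ} (hlam : 1 ≤ lam) (m n : ℕ) : Lp ℂ 2 (bidiscMeasure lam) :=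
  (memLp_monomial hlam m n).toLp _

lemma mono_coeFn {lam : ℝ} (hlam : 1 ≤ lam) (m n : ℕ) :
    mono hlam m n =ᵐ[bidiscMeasure lam] fun z => z.1 ^ m * z.2 ^ n :=
  (memLp_monomial hlam m n).coeFn_toLp

/-- The relation between an element `f` of the space with parameter `λ` and the holomorphic
function `F` that represents it. -/
def IsBergmanRep (lam : ℝ) (f : Lp ℂ 2 (bidiscMeasure lam)) (F : ℂ × ℂ → ℂ) : Prop :=
  DifferentiableOn ℂ F bidisc ∧ (lam = 1 →
      Tendsto (fun r : ℝ => eLpNorm (fun z => F (r • z) - f z) 2 (bidiscMeasure lam))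
        (𝓝[<] 1) (𝓝 0)) ∧ (lam ≠ 1 → f =ᵐ[bidiscMeasure lam] F)

lemma mem_bergmanSpace_iff {lam : ℝ} {f : Lp ℂ 2 (bidiscMeasure lam)} :
    f ∈ bergmanSpace lam ↔ ∃ F, IsBergmanRep lam f F := by
  change IsBergman lam f ↔ _
  unfold IsBergman IsBergmanRep
  by_cases h : lam = 1 <;> simp [h]

lemma isBergmanRep_one {lam : ℝ} (hlam : 1 ≤ lam) : IsBergmanRep lam (mono hlam 0 0) 1 := by
  have h := mono_coeFn hlam 0 0
  refine ⟨differentiableOn_const 1, fun _ => ?_, fun _ => ?_⟩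
  · have : ∀ r : ℝ, eLpNorm (fun z => (1 : ℂ × ℂ → ℂ) (r • z) - mono hlam 0 0 z) 2
        (bidiscMeasure lam) = 0 := by
      intro r
      rw [eLpNorm_congr_ae (g := 0), eLpNorm_zero]
      filter_upwards [h] with z hz
      simp [hz]
    simp only [this]
    exact tendsto_const_nhds
  · filter_upwards [h] with z hz
    simp [hz]

lemma mono_mem_bergmanSpace {lam : ℝ} (hlam : 1 ≤ lam) (m n : ℕ) :
    mono hlam m n ∈ bergmanSpace lam := by
  have h1 : mono hlam 0 0 ∈ bergmanSpace lam := mem_bergmanSpace_iff.2 ⟨1, isBergmanRep_one hlam⟩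
  have h2 := mulOperator_mem_bergmanSpace (memLp_top_monomial lam m n) (by fun_prop)
    (d := m + n) (fun r z => by
      simp only [Prod.smul_fst, Prod.smul_snd, Complex.real_smul, mul_pow, pow_add]; ring) h1
  convert h2
  apply Lp.ext
  refine (mono_coeFn hlam m n).trans (EventuallyEq.trans ?_ (mulOperator_coeFn _ _ _).symm)
  filter_upwards [mono_coeFn hlam 0 0] with z hz
  simp [hz]

lemma smul_mem_bidisc {z : ℂ × ℂ} (h1 : ‖z.1‖ ≤ 1) (h2 : ‖z.2‖ ≤ 1) {r : ℝ} (hr : 0 < r)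
    (hr1 : r < 1) : r • z ∈ bidisc := by
  simp only [bidisc, Set.mem_ofPred_eq, Prod.smul_fst, Prod.smul_snd, norm_smul,
    Real.norm_eq_abs, abs_of_pos hr]
  exact ⟨by nlinarith [norm_nonneg z.1], by nlinarith [norm_nonneg z.2]⟩

lemma eventually_memLp_dilate {lam : ℝ} {f : Lp ℂ 2 (bidiscMeasure lam)} {F : ℂ × ℂ → ℂ}
    (hF : DifferentiableOn ℂ F bidisc)
    (ht : Tendsto (fun r : ℝ => eLpNorm (fun z => F (r • z) - f z) 2 (bidiscMeasure lam))
      (𝓝[<] 1) (𝓝 0)) :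
    ∀ᶠ r : ℝ in 𝓝[<] 1, MemLp (fun z => F (r • z)) 2 (bidiscMeasure lam) := by
  filter_upwards [eventually_aestronglyMeasurable_dilate hF lam,
    ht.eventually (eventually_lt_nhds ENNReal.zero_lt_top)] with r h1 h2
  have h3 : MemLp (fun z => F (r • z) - f z) 2 (bidiscMeasure lam) :=
    ⟨h1.sub (Lp.aestronglyMeasurable f), h2⟩
  exact (h3.add (Lp.memLp f)).congr_norm h1 (ae_of_all _ fun z => by simp)

/-- All later inner products come from this formula. It is proved for the dilates `F(r ·)`, with `r
→ 1-` for the Hardy space and `r = 1` otherwise. -/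
lemma integral_conj_monomial_mul_rep {lam : ℝ} (hlam : 1 ≤ lam) {f : Lp ℂ 2 (bidiscMeasure lam)}
    {F : ℂ × ℂ → ℂ} (hF : IsBergmanRep lam f F) (m n p q : ℕ) :
    ∫ z, (starRingEnd ℂ) (z.1 ^ m * z.2 ^ n) * (z.1 ^ p * z.2 ^ q * f z) ∂(bidiscMeasure lam) =
      taylorCoeff F (m - p) (n - q) * (moment lam m * moment lam n) := by
  have hfin := isFiniteMeasure_bidiscMeasure hlam
  have htorus : ∀ {z : ℂ × ℂ} {r : ℝ}, 0 < r → r • z ∈ bidisc → z.1 ≠ 0 → z.2 ≠ 0 →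
      torusCoeff (fun z => z.1 ^ p * z.2 ^ q * F (r • z)) z m n =
      taylorCoeff F (m - p) (n - q) * ((r : ℂ) ^ ((m : ℤ) - p) * (r : ℂ) ^ ((n : ℤ) - q)) *
        (z.1 ^ m * z.2 ^ n) := by
    intro z r hr hz h1 h2
    have hr0 : (r : ℂ) ≠ 0 := by exact_mod_cast hr.ne'
    rw [torusCoeff_monomial_mul (fun z => F (r • z))]
    have e1 : torusCoeff (fun z => F (r • z)) z (m - p) (n - q) =
        torusCoeff F (r • z) (m - p) (n - q) := by
      unfold torusCoeff
      congr 1; funext x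
      congr 2
      simp only [torusRotate, Prod.smul_mk, Complex.real_smul, Prod.smul_fst, Prod.smul_snd]
      rw [mul_left_comm, mul_left_comm (r : ℂ)]
    rw [e1, torusCoeff_eq hF.1 hz (by simp [hr0, h1]) (by simp [hr0, h2])]
    simp only [Prod.smul_fst, Prod.smul_snd, Complex.real_smul, mul_zpow]
    rw [zpow_sub₀ h1, zpow_sub₀ h2]
    simp only [zpow_natCast]
    field_simp
  have hbd : ∀ {g : ℂ × ℂ → ℂ}, Integrable g (bidiscMeasure lam) →
      Integrable (fun z => z.1 ^ p * z.2 ^ q * g z) (bidiscMeasure lam) := by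
    intro g hg
    refine hg.bdd_mul (c := 1) (Continuous.aestronglyMeasurable (by fun_prop)) ?_
    filter_upwards [bidiscMeasure_ae_norm_le lam] with z hz using norm_monomial_le hz.1 hz.2 p q
  by_cases h : lam = 1
  · have ht := hF.2.1 h
    have hr : ∀ᶠ r : ℝ in 𝓝[<] 1, ∫ z, (starRingEnd ℂ) (z.1 ^ m * z.2 ^ n) *
        (z.1 ^ p * z.2 ^ q * F (r • z)) ∂(bidiscMeasure lam) =
        taylorCoeff F (m - p) (n - q) * ((r : ℂ) ^ ((m : ℤ) - p) * (r : ℂ) ^ ((n : ℤ) - q)) *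
          (moment lam m * moment lam n) := by
      filter_upwards [eventually_memLp_dilate hF.1 ht, self_mem_nhdsWithin,
        nhdsWithin_le_nhds (eventually_gt_nhds (zero_lt_one' ℝ))] with r hm hr1 hr0
      refine integral_conj_monomial_mul (hbd (hm.integrable (by norm_num))) ?_
      filter_upwards [bidiscMeasure_ae_norm_le lam, bidiscMeasure_ae_ne_zero lam] with z hz hz0
      exact htorus hr0 (smul_mem_bidisc hz.1 hz.2 hr0 hr1) hz0.1 hz0.2
    have hl1 : Tendsto (fun r : ℝ => taylorCoeff F (m - p) (n - q) *
        ((r : ℂ) ^ ((m : ℤ) - p) * (r : ℂ) ^ ((n : ℤ) - q)) * (moment lam m * moment lam n))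
        (𝓝[<] 1) (𝓝 (taylorCoeff F (m - p) (n - q) * (moment lam m * moment lam n))) := by
      have hz : ∀ a : ℤ, Tendsto (fun r : ℝ => (r : ℂ) ^ a) (𝓝[<] 1) (𝓝 1) := by
        intro a
        have h1 : ContinuousAt (fun r : ℝ => (r : ℂ) ^ a) 1 :=
          (Complex.continuous_ofReal.continuousAt).zpow₀ a (Or.inl (by simp))
        have h2 := h1.tendsto.mono_left (nhdsWithin_le_nhds (s := Set.Iio 1))
        simpa using h2
      have := (((hz ((m : ℤ) - p)).mul (hz ((n : ℤ) - q))).const_mul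
        (taylorCoeff F (m - p) (n - q))).mul_const ((moment lam m : ℂ) * moment lam n)
      simpa using this
    have hl2 : Tendsto (fun r : ℝ => ∫ z, (starRingEnd ℂ) (z.1 ^ m * z.2 ^ n) *
        (z.1 ^ p * z.2 ^ q * F (r • z)) ∂(bidiscMeasure lam)) (𝓝[<] 1)
        (𝓝 (∫ z, (starRingEnd ℂ) (z.1 ^ m * z.2 ^ n) * (z.1 ^ p * z.2 ^ q * f z)
          ∂(bidiscMeasure lam))) := by
      have hcm : AEStronglyMeasurable (fun z : ℂ × ℂ => (starRingEnd ℂ) (z.1 ^ m * z.2 ^ n))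
          (bidiscMeasure lam) := Continuous.aestronglyMeasurable (by fun_prop)
      have hcb : ∀ᵐ z ∂(bidiscMeasure lam), ‖(starRingEnd ℂ) (z.1 ^ m * z.2 ^ n)‖ ≤ 1 := by
        filter_upwards [bidiscMeasure_ae_norm_le lam] with z hz
        rw [RCLike.norm_conj]
        exact norm_monomial_le hz.1 hz.2 m n
      -- The monomial factors are bounded by `1` and the measure is finite, so the `L²`-convergence
      -- of the dilates gives `L¹`-convergence of the integrands.
      refine tendsto_integral_of_L1 _ ?_ ?_ ?_
      · exact (hbd ((Lp.memLp f).integrable (by norm_num))).bdd_mul hcm hcb |>.aestronglyMeasurable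
      · filter_upwards [eventually_memLp_dilate hF.1 ht] with r hm
        exact (hbd (hm.integrable (by norm_num))).bdd_mul hcm hcb
      · have hlim := ENNReal.Tendsto.mul_const (b := (bidiscMeasure lam) Set.univ ^
          (1 / ENNReal.toReal 1 - 1 / ENNReal.toReal 2)) ht (Or.inr (by
            refine ENNReal.rpow_ne_top_of_nonneg (by norm_num) (measure_ne_top _ _)))
        rw [zero_mul] at hlim
        refine tendsto_of_tendsto_of_tendsto_of_le_of_le' tendsto_const_nhds hlim
          (Eventually.of_forall fun _ => zero_le) ?_
        filter_upwards [eventually_aestronglyMeasurable_dilate hF.1 lam] with r hm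
        refine le_trans ?_ (eLpNorm_le_eLpNorm_mul_rpow_measure_univ (by norm_num : (1 : ℝ≥0∞) ≤ 2)
          (hm.sub (Lp.aestronglyMeasurable f)))
        rw [eLpNorm_one_eq_lintegral_enorm]
        refine lintegral_mono_ae ?_
        filter_upwards [hcb, bidiscMeasure_ae_norm_le lam] with z hz hz1
        rw [← mul_sub, ← mul_sub, enorm_mul, enorm_mul]
        have a1 : ‖(starRingEnd ℂ) (z.1 ^ m * z.2 ^ n)‖ₑ ≤ 1 := by
          rw [← ofReal_norm]
          exact ENNReal.ofReal_le_one.2 hz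
        have a2 : ‖z.1 ^ p * z.2 ^ q‖ₑ ≤ 1 := by
          have := norm_monomial_le hz1.1 hz1.2 p q
          rw [← ofReal_norm]
          exact ENNReal.ofReal_le_one.2 this
        calc _ ≤ 1 * (1 * ‖F (r • z) - f z‖ₑ) := by gcongr
          _ = _ := by simp
    exact tendsto_nhds_unique hl2 (hl1.congr' (hr.mono fun r hr => hr.symm))
  · have hf := hF.2.2 h
    have e : ∫ z, (starRingEnd ℂ) (z.1 ^ m * z.2 ^ n) * (z.1 ^ p * z.2 ^ q * f z)
        ∂(bidiscMeasure lam) = ∫ z, (starRingEnd ℂ) (z.1 ^ m * z.2 ^ n) *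
        (z.1 ^ p * z.2 ^ q * F ((1 : ℝ) • z)) ∂(bidiscMeasure lam) := by
      refine integral_congr_ae ?_
      filter_upwards [hf] with z hz
      rw [hz, one_smul]
    have hFi : Integrable (fun z => F ((1 : ℝ) • z)) (bidiscMeasure lam) := by
      simp only [one_smul]
      exact ((Lp.memLp f).integrable (by norm_num)).congr hf
    rw [e]
    refine integral_conj_monomial_mul (hbd hFi) ?_
    filter_upwards [bidiscMeasure_ae_mem_bidisc h, bidiscMeasure_ae_ne_zero lam] with z hz hz0
    have := htorus one_pos (z := z) (by rwa [one_smul]) hz0.1 hz0.2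
    simpa using this

lemma inner_mono {lam : ℝ} (hlam : 1 ≤ lam) (m n : ℕ) (f : Lp ℂ 2 (bidiscMeasure lam)) :
    inner ℂ (mono hlam m n) f =
      ∫ z, (starRingEnd ℂ) (z.1 ^ m * z.2 ^ n) * f z ∂(bidiscMeasure lam) := by
  rw [L2.inner_def]
  refine integral_congr_ae ?_
  filter_upwards [mono_coeFn hlam m n] with z hz
  rw [hz, RCLike.inner_apply, mul_comm]

lemma inner_mono_rep {lam : ℝ} (hlam : 1 ≤ lam) {f : Lp ℂ 2 (bidiscMeasure lam)}
    {F : ℂ × ℂ → ℂ} (hF : IsBergmanRep lam f F) (m n : ℕ) :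
    inner ℂ (mono hlam m n) f = taylorCoeff F m n * (moment lam m * moment lam n) := by
  have := integral_conj_monomial_mul_rep hlam hF m n 0 0
  simpa [inner_mono] using this

/-- The inner products are nonzero multiples of the Taylor coefficients, so `F` vanishes off the
axes. In the Hardy case every dilate is then zero almost everywhere, and so is the boundary value.
-/
lemma eq_zero_of_inner_mono_eq_zero {lam : ℝ} (hlam : 1 ≤ lam) {f : Lp ℂ 2 (bidiscMeasure lam)}
    (hf : f ∈ bergmanSpace lam) (h0 : ∀ m n, inner ℂ (mono hlam m n) f = 0) : f = 0 := by
  obtain ⟨F, hF⟩ := mem_bergmanSpace_iff.1 hf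
  have hT : ∀ m n : ℕ, taylorCoeff F m n = 0 := by
    intro m n
    have h1 := h0 m n
    rw [inner_mono_rep hlam hF] at h1
    have h2 : (moment lam m : ℂ) * moment lam n ≠ 0 := by
      exact_mod_cast mul_ne_zero (moment_pos hlam m).ne' (moment_pos hlam n).ne'
    exact (mul_eq_zero.1 h1).resolve_right h2
  by_cases h : lam = 1
  · have ht := hF.2.1 h
    have hc : ∀ᶠ r : ℝ in 𝓝[<] 1, eLpNorm (fun z => F (r • z) - f z) 2 (bidiscMeasure lam) =
        eLpNorm f 2 (bidiscMeasure lam) := by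
      filter_upwards [self_mem_nhdsWithin,
        nhdsWithin_le_nhds (eventually_gt_nhds (zero_lt_one' ℝ))] with r hr1 hr0
      rw [← eLpNorm_neg]
      refine eLpNorm_congr_ae ?_
      filter_upwards [bidiscMeasure_ae_norm_le lam, bidiscMeasure_ae_ne_zero lam] with z hz hz0
      have hr : (r : ℂ) ≠ 0 := by exact_mod_cast hr0.ne'
      have : F (r • z) = 0 := eq_zero_of_taylorCoeff_eq_zero hF.1 hT
        (smul_mem_bidisc hz.1 hz.2 hr0 hr1) (by simp [hr, hz0.1]) (by simp [hr, hz0.2])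
      simp [this]
    have h1 : eLpNorm f 2 (bidiscMeasure lam) = 0 :=
      tendsto_nhds_unique (tendsto_const_nhds.congr' (hc.mono fun r hr => hr.symm)) ht
    rw [← Lp.norm_eq_zero_iff (by norm_num), Lp.norm_def, h1, ENNReal.toReal_zero]
  · apply Lp.ext
    filter_upwards [hF.2.2 h, bidiscMeasure_ae_mem_bidisc h, bidiscMeasure_ae_ne_zero lam,
      Lp.coeFn_zero ℂ 2 (bidiscMeasure lam)] with z h1 h2 h3 h4
    rw [h1, h4, eq_zero_of_taylorCoeff_eq_zero hF.1 hT h2 h3.1 h3.2]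
    rfl

lemma inner_mono_phiOne {lam : ℝ} (hlam : 1 ≤ lam) (k : ℕ) {f : Lp ℂ 2 (bidiscMeasure lam)}
    {F : ℂ × ℂ → ℂ} (hF : IsBergmanRep lam f F) (m n : ℕ) :
    inner ℂ (mono hlam m n) (mulOperator (phiOne k) (memLp_phiOne k lam) f) =
      (taylorCoeff F (m - k) n + taylorCoeff F m (n - k)) * (moment lam m * moment lam n) := by
  have h1 := integral_conj_monomial_mul_rep hlam hF m n k 0
  have h2 := integral_conj_monomial_mul_rep hlam hF m n 0 k
  have hfin := isFiniteMeasure_bidiscMeasure hlam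
  have hi : ∀ p q : ℕ, Integrable (fun z : ℂ × ℂ => (starRingEnd ℂ) (z.1 ^ m * z.2 ^ n) *
      (z.1 ^ p * z.2 ^ q * f z)) (bidiscMeasure lam) := by
    intro p q
    have hb : Integrable (fun z => z.1 ^ p * z.2 ^ q * f z) (bidiscMeasure lam) := by
      refine ((Lp.memLp f).integrable (by norm_num)).bdd_mul (c := 1)
        (Continuous.aestronglyMeasurable (by fun_prop)) ?_
      filter_upwards [bidiscMeasure_ae_norm_le lam] with z hz using norm_monomial_le hz.1 hz.2 p q
    refine hb.bdd_mul (c := 1) (Continuous.aestronglyMeasurable (by fun_prop)) ?_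
    filter_upwards [bidiscMeasure_ae_norm_le lam] with z hz
    rw [RCLike.norm_conj]
    exact norm_monomial_le hz.1 hz.2 m n
  rw [Nat.cast_zero, sub_zero] at h1 h2
  rw [add_mul, ← h1, ← h2, ← integral_add (hi k 0) (hi 0 k), inner_mono]
  refine integral_congr_ae ?_
  filter_upwards [mulOperator_coeFn (phiOne k) (memLp_phiOne k lam) f] with z hz
  rw [hz, phiOne]
  ring

lemma inner_mono_phiTwo {lam : ℝ} (hlam : 1 ≤ lam) {f : Lp ℂ 2 (bidiscMeasure lam)}
    {F : ℂ × ℂ → ℂ} (hF : IsBergmanRep lam f F) (m n : ℕ) :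
    inner ℂ (mono hlam m n) (mulOperator phiTwo (memLp_phiTwo lam) f) =
      taylorCoeff F (m - 1) (n - 1) * (moment lam m * moment lam n) := by
  have h1 := integral_conj_monomial_mul_rep hlam hF m n 1 1
  rw [Nat.cast_one] at h1
  rw [← h1, inner_mono]
  refine integral_congr_ae ?_
  filter_upwards [mulOperator_coeFn phiTwo (memLp_phiTwo lam) f] with z hz
  rw [hz, phiTwo]
  ring

/-- The torus coefficients of a constant are the same on all tori, while they scale as `z₁ᵐz₂ⁿ`.
Comparing the radii `1/2` and `1/4` forces them to vanish unless `m = n = 0`. -/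
lemma taylorCoeff_one (m n : ℤ) : taylorCoeff 1 m n = if m = 0 ∧ n = 0 then 1 else 0 := by
  have hd : DifferentiableOn ℂ (1 : ℂ × ℂ → ℂ) bidisc := differentiableOn_const 1
  split_ifs with h
  · rw [h.1, h.2]
    have hvol : (volume : Measure (UnitAddCircle × UnitAddCircle)) Set.univ = 1 := by
      rw [Measure.volume_eq_prod, ← Set.univ_prod_univ, Measure.prod_prod]
      simp
    simp [taylorCoeff, torusCoeff, Measure.real, hvol]
  · have h4 : ‖(1 / 4 : ℂ)‖ < 1 := by norm_num
    have e0 := torusCoeff_eq hd (z := (1 / 2, 1 / 2)) ⟨half_norm_lt, half_norm_lt⟩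
      (by norm_num) (by norm_num) m n
    have e1 := torusCoeff_eq hd (z := (1 / 4, 1 / 2)) ⟨h4, half_norm_lt⟩
      (by norm_num) (by norm_num) m n
    have e2 := torusCoeff_eq hd (z := (1 / 2, 1 / 4)) ⟨half_norm_lt, h4⟩
      (by norm_num) (by norm_num) m n
    have c1 : torusCoeff 1 (1 / 4, 1 / 2) m n = torusCoeff 1 (1 / 2, 1 / 2) m n := rfl
    have c2 : torusCoeff 1 (1 / 2, 1 / 4) m n = torusCoeff 1 (1 / 2, 1 / 2) m n := rfl
    have hq : ∀ a : ℤ, (1 / 4 : ℂ) ^ a = (1 / 2) ^ a → a = 0 := by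
      intro a ha
      have h5 : (1 / 4 : ℂ) = (1 / 2) * (1 / 2) := by norm_num
      rw [h5, mul_zpow] at ha
      have h6 : (1 / 2 : ℂ) ^ a ≠ 0 := zpow_ne_zero _ (by norm_num)
      have h7 : (1 / 2 : ℂ) ^ a = 1 := mul_left_cancel₀ h6 (by rw [ha, mul_one])
      have h8 : ((1 / 2 : ℝ)) ^ a = 1 := by
        have := congrArg norm h7
        rw [norm_zpow] at this
        norm_num at this ⊢
        exact this
      by_contra hne
      exact hne ((zpow_eq_one_iff_right₀ (by norm_num) (by norm_num)).1 h8)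
    have hp : ∀ a : ℤ, (1 / 2 : ℂ) ^ a ≠ 0 := fun a => zpow_ne_zero _ (by norm_num)
    by_contra hT
    rw [c1, e0] at e1
    rw [c2, e0] at e2
    have a1 := mul_right_cancel₀ (hp n) (mul_left_cancel₀ hT e1)
    have a2 := mul_left_cancel₀ (hp m) (mul_left_cancel₀ hT e2)
    exact h ⟨hq m a1.symm, hq n a2.symm⟩

lemma inner_mono_mono {lam : ℝ} (hlam : 1 ≤ lam) (m n a b : ℕ) :
    inner ℂ (mono hlam m n) (mono hlam a b) =
      if m = a ∧ n = b then ((moment lam m : ℂ) * moment lam n) else 0 := by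
  have h := integral_conj_monomial_mul_rep hlam (isBergmanRep_one hlam) m n a b
  rw [taylorCoeff_one] at h
  have e : inner ℂ (mono hlam m n) (mono hlam a b) =
      ∫ z, (starRingEnd ℂ) (z.1 ^ m * z.2 ^ n) * (z.1 ^ a * z.2 ^ b * (mono hlam 0 0) z)
        ∂(bidiscMeasure lam) := by
    rw [inner_mono]
    refine integral_congr_ae ?_
    filter_upwards [mono_coeFn hlam a b, mono_coeFn hlam 0 0] with z h1 h2
    simp [h1, h2]
  rw [e, h]
  have : ((m : ℤ) - a = 0 ∧ (n : ℤ) - b = 0) ↔ (m = a ∧ n = b) := by omega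
  simp only [this]
  split_ifs <;> simp

lemma phiOne_mono {lam : ℝ} (hlam : 1 ≤ lam) (k m n : ℕ) :
    mulOperator (phiOne k) (memLp_phiOne k lam) (mono hlam m n) =
      mono hlam (m + k) n + mono hlam m (n + k) := by
  apply Lp.ext
  filter_upwards [mulOperator_coeFn (phiOne k) (memLp_phiOne k lam) (mono hlam m n),
    mono_coeFn hlam m n, mono_coeFn hlam (m + k) n, mono_coeFn hlam m (n + k),
    Lp.coeFn_add (mono hlam (m + k) n) (mono hlam m (n + k))] with z h1 h2 h3 h4 h5
  rw [h1, h5, Pi.add_apply, h2, h3, h4, phiOne]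
  ring

lemma phiTwo_mono {lam : ℝ} (hlam : 1 ≤ lam) (m n : ℕ) :
    mulOperator phiTwo (memLp_phiTwo lam) (mono hlam m n) = mono hlam (m + 1) (n + 1) := by
  apply Lp.ext
  filter_upwards [mulOperator_coeFn phiTwo (memLp_phiTwo lam) (mono hlam m n),
    mono_coeFn hlam m n, mono_coeFn hlam (m + 1) (n + 1)] with z h1 h2 h3
  rw [h1, h2, h3, phiTwo]
  ring

/-! ### Irreducible representations of the dihedral group -/

section Characters

variable {k : ℕ} [NeZero k]

/-- The character `j ↦ e^{2πij/k}` of `ℤ/k`. -/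
noncomputable def rootChar (i : ZMod k) : ℂ := (ZMod.toCircle i : ℂ)

lemma rootChar_add (i j : ZMod k) : rootChar (i + j) = rootChar i * rootChar j := by
  simp [rootChar, AddChar.map_add_eq_mul]

lemma rootChar_zero : rootChar (0 : ZMod k) = 1 := by simp [rootChar]

lemma sum_rootChar_mul (n : ZMod k) :
    ∑ i : ZMod k, rootChar (i * n) = if n = 0 then (k : ℂ) else 0 := by
  have h := AddChar.sum_mulShift n (ZMod.isPrimitive_stdAddChar k)
  rw [ZMod.card] at h
  rw [Nat.cast_ite, Nat.cast_zero] at h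
  rw [← h]
  rfl

lemma sum_rootChar_mul_left {n : ZMod k} : ∑ i : ZMod k, rootChar (n * i) =
    if n = 0 then (k : ℂ) else 0 := by
  rw [← sum_rootChar_mul]
  exact Finset.sum_congr rfl fun i _ => by rw [mul_comm]

end Characters

namespace DihedralIrrep

variable {k : ℕ} (μ : DihedralIrrep k)

/-- The matrix `μ(g)`. -/
noncomputable def M (g : DihedralGroup k) : Matrix (Fin μ.deg) (Fin μ.deg) ℂ := μ.mat g

lemma M_mul (g h : DihedralGroup k) : μ.M (g * h) = μ.M g * μ.M h := by simp [M]

lemma M_one : μ.M 1 = 1 := by simp [M]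

lemma M_inv (g : DihedralGroup k) : μ.M g⁻¹ = (μ.M g).conjTranspose := by
  rw [M, map_inv]; rfl

lemma M_mul_inv (g : DihedralGroup k) : μ.M g * μ.M g⁻¹ = 1 := by
  rw [← M_mul, mul_inv_cancel, M_one]

lemma rep_apply (g : DihedralGroup k) (x : Fin μ.deg → ℂ) : μ.rep g x = μ.M g *ᵥ x := rfl

instance : (μ.rep).IsIrreducible := μ.irreducible

/-- Schur's lemma over `ℂ`, in matrix form. -/
lemma exists_eq_smul_one {X : Matrix (Fin μ.deg) (Fin μ.deg) ℂ}
    (hX : ∀ g, X * μ.M g = μ.M g * X) : ∃ c : ℂ, X = c • 1 := by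
  let f : Representation.IntertwiningMap μ.rep μ.rep :=
    LinearMap.intertwiningMap_of_isIntertwiningMap (f := Matrix.toLin' X) μ.rep μ.rep
      (fun g v => by
        simp only [rep_apply, Matrix.toLin'_apply, Matrix.mulVec_mulVec, hX])
  obtain ⟨c, hc⟩ := (Representation.IsIrreducible.algebraMap_intertwiningMap_bijective_of_isAlgClosed
    (ρ := μ.rep)).2 f
  refine ⟨c, ?_⟩
  apply Matrix.toLin'.injective
  apply LinearMap.ext
  intro v
  have h1 : f v = X *ᵥ v := rfl
  rw [← hc] at h1
  rw [Matrix.toLin'_apply, ← h1]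
  simp only [map_smul, Matrix.toLin'_one]
  rfl

/-- Schur orthogonality for the first matrix coefficient. -/
lemma sum_M_mul_M [NeZero k] (i : Fin μ.deg) (g : DihedralGroup k) :
    ∑ h, μ.M h i i * μ.M (h⁻¹ * g) i i =
      (Fintype.card (DihedralGroup k) : ℂ) / μ.deg * μ.M g i i := by
  -- The average of a matrix unit over the group commutes with the representation, hence is scalar.
  -- Its trace is the order of the group, which fixes the scalar. The claim is the `(i, i)` entry of
  -- `X * μ.M g`.
  set X : Matrix (Fin μ.deg) (Fin μ.deg) ℂ := ∑ h, μ.M h * Matrix.single i i 1 * μ.M h⁻¹ with hX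
  obtain ⟨c, hc⟩ := μ.exists_eq_smul_one (X := X) (by
    intro g
    rw [hX, Finset.sum_mul, Finset.mul_sum]
    refine Fintype.sum_equiv (Equiv.mulLeft g⁻¹) _ _ fun h => ?_
    simp only [Equiv.coe_mulLeft, mul_inv_rev, inv_inv, M_mul]
    have := μ.M_mul_inv g
    rw [← mul_assoc, ← mul_assoc, ← mul_assoc, ← mul_assoc, this, one_mul])
  have htr : X.trace = Fintype.card (DihedralGroup k) := by
    rw [hX, Matrix.trace_sum]
    have : ∀ h, (μ.M h * Matrix.single i i 1 * μ.M h⁻¹).trace = 1 := by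
      intro h
      have h1 : μ.M h⁻¹ * μ.M h = 1 := by rw [← M_mul, inv_mul_cancel, M_one]
      rw [Matrix.trace_mul_comm, ← mul_assoc, h1, one_mul]
      simp
    simp [this]
  have hd : (μ.deg : ℂ) ≠ 0 := by exact_mod_cast μ.deg_pos.ne'
  have hc' : c = (Fintype.card (DihedralGroup k) : ℂ) / μ.deg := by
    rw [← htr, hc, Matrix.trace_smul, Matrix.trace_one, Fintype.card_fin, smul_eq_mul]
    field_simp
  have h2 : (X * μ.M g) i i = c * μ.M g i i := by rw [hc]; simp
  rw [← hc', ← h2, hX, Finset.sum_mul, Matrix.sum_apply]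
  refine Finset.sum_congr rfl fun h _ => ?_
  rw [mul_assoc, ← M_mul, mul_assoc]
  rw [Matrix.mul_apply, Finset.sum_eq_single i]
  · congr 1
    rw [Matrix.mul_apply, Finset.sum_eq_single i]
    · simp
    · intro b _ hb; simp [hb.symm]
    · simp
  · intro b _ hb
    rw [Matrix.mul_apply, Finset.sum_eq_zero, mul_zero]
    intro a _
    simp [hb.symm]
  · simp

/-! ### Eigenvectors of the rotations -/

lemma M_r_add (i j : ZMod k) : μ.M (.r (i + j)) = μ.M (.r i) * μ.M (.r j) := by
  rw [← M_mul, DihedralGroup.r_mul_r]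

lemma M_sr (i : ZMod k) : μ.M (.sr i) = μ.M (.sr 0) * μ.M (.r i) := by
  rw [← M_mul, DihedralGroup.sr_mul_r, zero_add]

lemma M_r_mul_M_sr (i : ZMod k) :
    μ.M (.r i) * μ.M (.sr 0) = μ.M (.sr 0) * μ.M (.r (-i)) := by
  rw [← M_mul, ← M_mul, DihedralGroup.r_mul_sr, DihedralGroup.sr_mul_r, zero_sub, zero_add]

lemma M_r_zero : μ.M (.r 0) = 1 := by rw [DihedralGroup.r_zero, M_one]

lemma M_sr_mul_self : μ.M (.sr 0) * μ.M (.sr 0) = 1 := by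
  rw [← M_mul, DihedralGroup.sr_mul_sr, sub_zero, M_r_zero]

variable [NeZero k]

/-- `k` times the spectral projection of `μ(δ)` for the eigenvalue `e^{2πin/k}`. -/
noncomputable def E (n : ZMod k) : Matrix (Fin μ.deg) (Fin μ.deg) ℂ :=
  ∑ i : ZMod k, rootChar (i * n) • μ.M (.r (-i))

lemma M_r_mul_E (j n : ZMod k) : μ.M (.r j) * μ.E n = rootChar (j * n) • μ.E n := by
  rw [E, Finset.mul_sum, Finset.smul_sum]
  refine Fintype.sum_equiv (Equiv.subRight j) _ _ fun i => ?_
  rw [Matrix.mul_smul, ← M_r_add, smul_smul, ← rootChar_add, Equiv.subRight_apply, neg_sub,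
    sub_eq_add_neg j i]
  congr 2
  ring

lemma sum_E : ∑ n : ZMod k, μ.E n = (k : ℂ) • 1 := by
  simp only [E]
  rw [Finset.sum_comm]
  simp only [← Finset.sum_smul, sum_rootChar_mul_left]
  simp [M_one]

/-- `e` is an eigenvector of `μ(δ)` for the eigenvalue `e^{2πiJ/k}`. -/
def IsWeight (e : Fin μ.deg → ℂ) (J : ZMod k) : Prop :=
  e ≠ 0 ∧ ∀ i : ZMod k, μ.M (.r i) *ᵥ e = rootChar (i * J) • e

variable {μ}

lemma IsWeight.sr_mulVec {e : Fin μ.deg → ℂ} {J : ZMod k} (h : μ.IsWeight e J) (i : ZMod k) :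
    μ.M (.sr i) *ᵥ e = rootChar (i * J) • (μ.M (.sr 0) *ᵥ e) := by
  rw [M_sr, ← Matrix.mulVec_mulVec, h.2, Matrix.mulVec_smul]

lemma IsWeight.sr {e : Fin μ.deg → ℂ} {J : ZMod k} (h : μ.IsWeight e J) :
    μ.IsWeight (μ.M (.sr 0) *ᵥ e) (-J) := by
  refine ⟨fun h0 => h.1 ?_, fun i => ?_⟩
  · have : μ.M (.sr 0) *ᵥ (μ.M (.sr 0) *ᵥ e) = 0 := by rw [h0, Matrix.mulVec_zero]
    rwa [Matrix.mulVec_mulVec, M_sr_mul_self, Matrix.one_mulVec] at this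
  · rw [Matrix.mulVec_mulVec, M_r_mul_M_sr, ← Matrix.mulVec_mulVec, h.2, Matrix.mulVec_smul,
      neg_mul, mul_neg]

-- The matrices `E n` add up to `k ≠ 0`, so one of them is nonzero, and every nonzero vector in its
-- range is an eigenvector.
variable (μ) in
lemma exists_isWeight : ∃ e J, μ.IsWeight e J := by
  by_contra hne
  push Not at hne
  have h0 : ∀ n, μ.E n = 0 := by
    intro n
    apply Matrix.toLin'.injective
    apply LinearMap.ext
    intro v
    rw [Matrix.toLin'_apply, map_zero, LinearMap.zero_apply]
    by_contra hv
    refine hne _ n ⟨hv, fun i => ?_⟩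
    rw [Matrix.mulVec_mulVec, M_r_mul_E, Matrix.smul_mulVec]
  have h1 := μ.sum_E
  simp only [h0, Finset.sum_const_zero] at h1
  have h2 := congrFun (congrFun h1 μ.first) μ.first
  simp only [Matrix.zero_apply, Matrix.smul_apply, Matrix.one_apply_eq, smul_eq_mul, mul_one] at h2
  exact NeZero.ne k (by exact_mod_cast h2.symm)

/-- The span of `e` and `μ(σ)e` is invariant, hence the whole space by irreducibility. Identities
between matrices can therefore be checked on these two vectors, whose weights are `J` and `-J`. -/
lemma IsWeight.eq_zero {e : Fin μ.deg → ℂ} {J : ZMod k} (h : μ.IsWeight e J)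
    {X : Matrix (Fin μ.deg) (Fin μ.deg) ℂ} (h1 : X *ᵥ e = 0)
    (h2 : X *ᵥ (μ.M (.sr 0) *ᵥ e) = 0) : X = 0 := by
  let W : Subrepresentation μ.rep :=
    { toSubmodule := Submodule.span ℂ {e, μ.M (.sr 0) *ᵥ e}
      apply_mem_toSubmodule := by
        intro g v hv
        have he : e ∈ Submodule.span ℂ {e, μ.M (.sr 0) *ᵥ e} :=
          Submodule.subset_span (by simp)
        have hs : μ.M (.sr 0) *ᵥ e ∈ Submodule.span ℂ {e, μ.M (.sr 0) *ᵥ e} :=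
          Submodule.subset_span (by simp)
        rw [rep_apply]
        induction hv using Submodule.span_induction with
        | mem x hx =>
          rcases hx with rfl | rfl
          · cases g with
            | r i => rw [h.2]; exact Submodule.smul_mem _ _ he
            | sr i =>
              rw [h.sr_mulVec i]
              exact Submodule.smul_mem _ _ hs
          · cases g with
            | r i => rw [h.sr.2]; exact Submodule.smul_mem _ _ hs
            | sr i =>
              rw [h.sr.sr_mulVec, Matrix.mulVec_mulVec, M_sr_mul_self, Matrix.one_mulVec]
              exact Submodule.smul_mem _ _ he
        | zero => rw [Matrix.mulVec_zero]; exact Submodule.zero_mem _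
        | add x y _ _ hx hy => rw [Matrix.mulVec_add]; exact Submodule.add_mem _ hx hy
        | smul c x _ hx => rw [Matrix.mulVec_smul]; exact Submodule.smul_mem _ _ hx }
  have hW : W = ⊤ := by
    refine (eq_bot_or_eq_top W).resolve_left fun hb => h.1 ?_
    have he : e ∈ W := Submodule.subset_span (by simp)
    rw [hb] at he
    exact he
  have hle : Submodule.span ℂ {e, μ.M (.sr 0) *ᵥ e} ≤ LinearMap.ker (Matrix.toLin' X) := by
    rw [Submodule.span_le]
    rintro x (rfl | rfl)
    · exact h1
    · exact h2
  apply Matrix.toLin'.injective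
  apply LinearMap.ext
  intro v
  have hv : v ∈ W := by rw [hW]; trivial
  have := hle hv
  rw [map_zero, LinearMap.zero_apply]
  exact this

lemma IsWeight.E_mulVec {e : Fin μ.deg → ℂ} {J : ZMod k} (h : μ.IsWeight e J) (n : ZMod k) :
    μ.E n *ᵥ e = if n = J then (k : ℂ) • e else 0 := by
  rw [E, Matrix.sum_mulVec]
  have : ∀ i : ZMod k, (rootChar (i * n) • μ.M (.r (-i))) *ᵥ e = rootChar (i * (n - J)) • e := by
    intro i
    rw [Matrix.smul_mulVec, h.2, smul_smul, ← rootChar_add]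
    congr 2; ring
  simp only [this]
  rw [← Finset.sum_smul, sum_rootChar_mul]
  simp only [sub_eq_zero]
  split_ifs <;> simp

lemma IsWeight.E_eq_zero {e : Fin μ.deg → ℂ} {J : ZMod k} (h : μ.IsWeight e J) {n : ZMod k}
    (h1 : n ≠ J) (h2 : n ≠ -J) : μ.E n = 0 :=
  h.eq_zero (by rw [h.E_mulVec, if_neg h1]) (by rw [h.sr.E_mulVec, if_neg h2])

lemma IsWeight.E_self {e : Fin μ.deg → ℂ} {J : ZMod k} (h : μ.IsWeight e J) (hJ : J = -J) :
    μ.E J = (k : ℂ) • 1 := by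
  rw [← sub_eq_zero]
  refine h.eq_zero ?_ ?_
  · rw [Matrix.sub_mulVec, h.E_mulVec, if_pos rfl, Matrix.smul_mulVec, Matrix.one_mulVec, sub_self]
  · rw [Matrix.sub_mulVec, h.sr.E_mulVec, if_pos hJ, Matrix.smul_mulVec, Matrix.one_mulVec, sub_self]

lemma IsWeight.E_add {e : Fin μ.deg → ℂ} {J : ZMod k} (h : μ.IsWeight e J) (hJ : J ≠ -J) :
    μ.E J + μ.E (-J) = (k : ℂ) • 1 := by
  rw [← sub_eq_zero]
  refine h.eq_zero ?_ ?_
  · rw [Matrix.sub_mulVec, Matrix.add_mulVec, h.E_mulVec, h.E_mulVec, if_pos rfl, if_neg hJ.symm,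
      Matrix.smul_mulVec, Matrix.one_mulVec, add_zero, sub_self]
  · rw [Matrix.sub_mulVec, Matrix.add_mulVec, h.sr.E_mulVec, h.sr.E_mulVec, if_pos rfl, if_neg hJ,
      Matrix.smul_mulVec, Matrix.one_mulVec, zero_add, sub_self]

/-! ### Classification of the irreducible representations by type -/

variable (μ) in
/-- The data that determine an irreducible representation up to equivalence: the exponent `j` of
an eigenvalue of `μ(δ)` and, if that eigenvalue is `±1`, the eigenvalue `ε` of `μ(σ)`. -/
structure HasType (j : ℕ) (ε : ℂ) (e : Fin μ.deg → ℂ) : Prop where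
  two_mul_le : 2 * j ≤ k
  isWeight : μ.IsWeight e j
  sign : ε = 1 ∨ ε = -1
  sr_mulVec : (j = 0 ∨ 2 * j = k) → μ.M (.sr 0) *ᵥ e = ε • e

-- Both `J` and `-J` are weights, and one of them has a representative that is at most `k/2`.
variable (μ) in
lemma exists_isWeight_natCast : ∃ e, ∃ j : ℕ, 2 * j ≤ k ∧ μ.IsWeight e (j : ZMod k) := by
  obtain ⟨e, J, h⟩ := μ.exists_isWeight
  by_cases hJ : 2 * J.val ≤ k
  · exact ⟨e, J.val, hJ, by rwa [ZMod.natCast_zmod_val]⟩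
  · refine ⟨μ.M (.sr 0) *ᵥ e, k - J.val, by omega, ?_⟩
    have : ((k - J.val : ℕ) : ZMod k) = -J := by
      rw [Nat.cast_sub (ZMod.val_lt J).le, ZMod.natCast_self, ZMod.natCast_zmod_val, zero_sub]
    rw [this]
    exact h.sr

variable (μ) in
lemma exists_hasType : ∃ j ε e, μ.HasType j ε e := by
  obtain ⟨e, j, hj, h⟩ := μ.exists_isWeight_natCast
  by_cases hs : j = 0 ∨ 2 * j = k
  swap
  · exact ⟨j, 1, e, hj, h, Or.inl rfl, fun h => absurd h hs⟩
  have hJ : -(j : ZMod k) = j := by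
    rcases hs with rfl | hs
    · simp
    · rw [neg_eq_iff_add_eq_zero, ← two_mul]
      have : ((2 * j : ℕ) : ZMod k) = 0 := by rw [hs, ZMod.natCast_self]
      exact_mod_cast this
  have h' := h.sr
  rw [hJ] at h'
  -- Here `e` and `μ(σ)e` have the same weight. Either their sum is an eigenvector fixed by `μ(σ)`,
  -- or `μ(σ)e = -e`.
  by_cases h1 : e + μ.M (.sr 0) *ᵥ e = 0
  · refine ⟨j, -1, e, hj, h, Or.inr rfl, fun _ => ?_⟩
    rw [neg_smul, one_smul]
    exact (neg_eq_of_add_eq_zero_right h1).symm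
  · refine ⟨j, 1, e + μ.M (.sr 0) *ᵥ e, hj, ⟨h1, fun i => ?_⟩, Or.inl rfl, fun _ => ?_⟩
    · rw [Matrix.mulVec_add, h.2, h'.2, smul_add]
    · rw [Matrix.mulVec_add, Matrix.mulVec_mulVec, M_sr_mul_self, Matrix.one_mulVec, one_smul,
        add_comm]

lemma HasType.neg_eq_self {j : ℕ} {ε : ℂ} {e : Fin μ.deg → ℂ} (_ : μ.HasType j ε e)
    (hs : j = 0 ∨ 2 * j = k) : (j : ZMod k) = -j := by
  rcases hs with rfl | hs
  · simp
  · rw [eq_neg_iff_add_eq_zero, ← two_mul]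
    have : ((2 * j : ℕ) : ZMod k) = 0 := by rw [hs, ZMod.natCast_self]
    exact_mod_cast this

lemma HasType.two_mul_ne_zero {j : ℕ} {ε : ℂ} {e : Fin μ.deg → ℂ} (h : μ.HasType j ε e)
    (hs : ¬(j = 0 ∨ 2 * j = k)) : 2 * (j : ZMod k) ≠ 0 := by
  intro h0
  have h1 : ((2 * j : ℕ) : ZMod k) = 0 := by exact_mod_cast h0
  rw [ZMod.natCast_eq_zero_iff] at h1
  have := h.two_mul_le
  have := Nat.le_of_dvd (by omega) h1
  omega

lemma HasType.M_sr_eq {j : ℕ} {ε : ℂ} {e : Fin μ.deg → ℂ} (h : μ.HasType j ε e)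
    (hs : j = 0 ∨ 2 * j = k) : μ.M (.sr 0) = ε • 1 := by
  have he := h.sr_mulVec hs
  rw [← sub_eq_zero]
  have h0 : (μ.M (.sr 0) - ε • 1) *ᵥ e = 0 := by
    rw [Matrix.sub_mulVec, he, Matrix.smul_mulVec, Matrix.one_mulVec, sub_self]
  refine h.isWeight.eq_zero h0 ?_
  rw [he, Matrix.mulVec_smul, h0, smul_zero]

/-- Averaging the rank one map `x ↦ xₐ e'` over the group gives an intertwiner `T`, which would
vanish for inequivalent irreducible representations. Evaluation at `e` shows that it does not. -/
lemma HasType.equivalent {ν : DihedralIrrep k} {j : ℕ} {ε ε' : ℂ} {e : Fin μ.deg → ℂ}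
    {e' : Fin ν.deg → ℂ} (h : μ.HasType j ε e) (h' : ν.HasType j ε' e')
    (hε : (j = 0 ∨ 2 * j = k) → ε = ε') : μ.Equivalent ν := by
  obtain ⟨a, ha⟩ : ∃ a, e a ≠ 0 := by
    by_contra hn
    push Not at hn
    exact h.isWeight.1 (funext hn)
  let T : (Fin μ.deg → ℂ) →ₗ[ℂ] (Fin ν.deg → ℂ) :=
    ∑ g, ((LinearMap.proj a).comp (μ.rep g⁻¹)).smulRight (ν.rep g e')
  have hT : ∀ x, T x = ∑ g, (μ.M g⁻¹ *ᵥ x) a • (ν.M g *ᵥ e') := by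
    intro x
    simp only [T, LinearMap.sum_apply]
    rfl
  let f : Representation.IntertwiningMap μ.rep ν.rep :=
    LinearMap.intertwiningMap_of_isIntertwiningMap (f := T) μ.rep ν.rep (by
      intro g v
      rw [rep_apply, rep_apply, hT, hT, Matrix.mulVec_sum]
      refine Fintype.sum_equiv (Equiv.mulLeft g⁻¹) _ _ fun x => ?_
      rw [Equiv.coe_mulLeft, mul_inv_rev, inv_inv, Matrix.mulVec_smul, Matrix.mulVec_mulVec,
        Matrix.mulVec_mulVec, ← M_mul, ← M_mul, mul_inv_cancel_left])
  by_contra hne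
  have hempty : IsEmpty (Representation.Equiv μ.rep ν.rep) := not_nonempty_iff.1 hne
  have hf : f = 0 := Subsingleton.elim _ _
  have hTe : T e = 0 := by
    have : f e = 0 := by rw [hf]; rfl
    exact this
  rw [hT, ← (DihedralGroup.equivSum (n := k)).symm.sum_comp, Fintype.sum_sum_type] at hTe
  -- The rotations contribute `k eₐ e'` in total.
  have hr : ∀ i : ZMod k, (μ.M (DihedralGroup.r i)⁻¹ *ᵥ e) a • (ν.M (.r i) *ᵥ e') = e a • e' := by
    intro i
    rw [DihedralGroup.inv_r, h.isWeight.2, h'.isWeight.2, Pi.smul_apply, smul_eq_mul, smul_smul,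
      mul_right_comm, ← rootChar_add, neg_mul, neg_add_cancel, rootChar_zero, one_mul]
  -- The reflections contribute a character sum that vanishes unless `2j = 0` in `ZMod k`. In that
  -- case `εε' = 1` and they add another `k eₐ e'`, so there is no cancellation.
  have hsr : ∀ i : ZMod k, (μ.M (DihedralGroup.sr i)⁻¹ *ᵥ e) a • (ν.M (.sr i) *ᵥ e') =
      rootChar (i * (2 * (j : ZMod k))) • ((μ.M (.sr 0) *ᵥ e) a • (ν.M (.sr 0) *ᵥ e')) := by
    intro i
    rw [DihedralGroup.inv_sr, h.isWeight.sr_mulVec, h'.isWeight.sr_mulVec, Pi.smul_apply,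
      smul_eq_mul, smul_smul, smul_smul, two_mul, mul_add, rootChar_add]
    congr 1
    ring
  have hsum : (k : ℂ) • (e a • e') + (∑ i : ZMod k, rootChar (i * (2 * (j : ZMod k)))) •
      ((μ.M (.sr 0) *ᵥ e) a • (ν.M (.sr 0) *ᵥ e')) = 0 := by
    rw [Finset.sum_smul, ← hTe]
    congr 1
    · have : ∀ i : ZMod k, (μ.M ((DihedralGroup.equivSum (n := k)).symm (Sum.inl i))⁻¹ *ᵥ e) a •
          (ν.M ((DihedralGroup.equivSum (n := k)).symm (Sum.inl i)) *ᵥ e') = e a • e' := hr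
      simp only [this, Finset.sum_const, Finset.card_univ, ZMod.card]
      rw [← Nat.cast_smul_eq_nsmul ℂ]
    · exact Finset.sum_congr rfl fun i _ => (hsr i).symm
  have hk : (k : ℂ) ≠ 0 := by exact_mod_cast NeZero.ne k
  rw [sum_rootChar_mul] at hsum
  by_cases hs : j = 0 ∨ 2 * j = k
  · have h2 : 2 * (j : ZMod k) = 0 := by
      rw [two_mul]; exact eq_neg_iff_add_eq_zero.1 (h.neg_eq_self hs)
    have hεε : ε * ε' = 1 := by
      rw [← hε hs]
      rcases h.sign with rfl | rfl <;> ring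
    rw [if_pos h2, h.sr_mulVec hs, h'.sr_mulVec hs, Pi.smul_apply, smul_eq_mul, smul_smul,
      smul_smul, smul_smul, ← add_smul] at hsum
    have h3 : (k : ℂ) * e a + k * (ε * e a) * ε' = 2 * k * e a := by
      linear_combination (k : ℂ) * e a * hεε
    rw [h3] at hsum
    exact h'.isWeight.1 ((smul_eq_zero.1 hsum).resolve_left (by simp [hk, ha]))
  · rw [if_neg (h.two_mul_ne_zero hs), zero_smul, add_zero, smul_smul] at hsum
    exact h'.isWeight.1 ((smul_eq_zero.1 hsum).resolve_left (by simp [hk, ha]))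

end DihedralIrrep

/-! ### The isotypic projections -/

section Pullback

variable {k : ℕ} [NeZero k] (lam : ℝ)

/-- The operator `f ↦ f ∘ (g · )` on `L²`. -/
noncomputable def pullback (g : DihedralGroup k) :
    Lp ℂ 2 (bidiscMeasure lam) →ₗᵢ[ℂ] Lp ℂ 2 (bidiscMeasure lam) :=
  Lp.compMeasurePreservingₗᵢ ℂ (dihedralAct g) (measurePreserving_dihedralAct lam g)

lemma pullback_coeFn (g : DihedralGroup k) (f : Lp ℂ 2 (bidiscMeasure lam)) :
    pullback lam g f =ᵐ[bidiscMeasure lam] fun z => f (dihedralAct g z) :=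
  Lp.coeFn_compMeasurePreserving f (measurePreserving_dihedralAct lam g)

lemma dihedralAct_mul (g h : DihedralGroup k) (z : ℂ × ℂ) :
    dihedralAct (g * h) z = dihedralAct h (dihedralAct g z) := by
  simp [dihedralAct]

lemma pullback_mul (g h : DihedralGroup k) (f : Lp ℂ 2 (bidiscMeasure lam)) :
    pullback lam (g * h) f = pullback lam g (pullback lam h f) := by
  apply Lp.ext
  have h1 := (measurePreserving_dihedralAct lam g).quasiMeasurePreserving.ae_eq_comp
    (pullback_coeFn lam h f)
  filter_upwards [pullback_coeFn lam (g * h) f, pullback_coeFn lam g (pullback lam h f), h1]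
    with z e1 e2 e3
  rw [e1, e2, dihedralAct_mul]
  exact e3.symm

lemma pullback_one (f : Lp ℂ 2 (bidiscMeasure lam)) :
    pullback lam (1 : DihedralGroup k) f = f := by
  apply Lp.ext
  filter_upwards [pullback_coeFn lam (1 : DihedralGroup k) f] with z e1
  rw [e1]
  simp [dihedralAct]

lemma inner_pullback_left (g : DihedralGroup k) (f h : Lp ℂ 2 (bidiscMeasure lam)) :
    inner ℂ (pullback lam g f) h = inner ℂ f (pullback lam g⁻¹ h) := by
  rw [← (pullback lam g).inner_map_map f, ← pullback_mul, mul_inv_cancel, pullback_one]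

lemma rootChar_pow (i : ZMod k) (n : ℕ) : rootChar i ^ n = rootChar (i * (n : ZMod k)) := by
  induction n with
  | zero => simp [rootChar_zero]
  | succ n ih => rw [pow_succ, ih, ← rootChar_add]; push_cast; congr 1; ring

lemma pullback_r_mono {lam : ℝ} (hlam : 1 ≤ lam) (i : ZMod k) (a b : ℕ) :
    pullback lam (.r i) (mono hlam a b) =
      rootChar (-i * ((a : ZMod k) - (b : ZMod k))) • mono hlam a b := by
  apply Lp.ext
  have h1 := (measurePreserving_dihedralAct lam (.r i)).quasiMeasurePreserving.ae_eq_comp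
    (mono_coeFn hlam a b)
  filter_upwards [pullback_coeFn lam (.r i) (mono hlam a b), h1, mono_coeFn hlam a b,
    Lp.coeFn_smul (rootChar (-i * ((a : ZMod k) - (b : ZMod k)))) (mono hlam a b)] with z e1 e2 e3 e4
  rw [e1, e4, Pi.smul_apply, e3]
  refine e2.trans ?_
  have h2 : dihedralAct (.r i) z = (rootChar (-i) * z.1, rootChar (- -i) * z.2) := rfl
  simp only [Function.comp_apply, h2, mul_pow, rootChar_pow, smul_eq_mul]
  rw [mul_sub, sub_eq_add_neg, rootChar_add, neg_mul_eq_neg_mul]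
  ring

lemma pullback_sr_mono {lam : ℝ} (hlam : 1 ≤ lam) (i : ZMod k) (a b : ℕ) :
    pullback lam (.sr i) (mono hlam a b) =
      rootChar (-i * ((a : ZMod k) - (b : ZMod k))) • mono hlam b a := by
  apply Lp.ext
  have h1 := (measurePreserving_dihedralAct lam (.sr i)).quasiMeasurePreserving.ae_eq_comp
    (mono_coeFn hlam a b)
  filter_upwards [pullback_coeFn lam (.sr i) (mono hlam a b), h1, mono_coeFn hlam b a,
    Lp.coeFn_smul (rootChar (-i * ((a : ZMod k) - (b : ZMod k)))) (mono hlam b a)] with z e1 e2 e3 e4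
  rw [e1, e4, Pi.smul_apply, e3]
  refine e2.trans ?_
  have h2 : dihedralAct (.sr i) z = (rootChar (-i) * z.2, rootChar i * z.1) := rfl
  simp only [Function.comp_apply, h2, mul_pow, rootChar_pow, smul_eq_mul]
  rw [mul_sub, sub_eq_add_neg, rootChar_add, neg_mul, neg_mul, neg_neg]
  ring

lemma dihedralAct_mem_bidisc (g : DihedralGroup k) {z : ℂ × ℂ} (hz : z ∈ bidisc) :
    dihedralAct g z ∈ bidisc := by
  have key : ∀ g : DihedralGroup k, dihedralMap g z ∈ bidisc := by
    rintro (i | i)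
    · simpa [dihedralMap, bidisc, Circle.norm_coe] using hz
    · simpa [dihedralMap, bidisc, Circle.norm_coe] using And.symm hz
  exact key g⁻¹

lemma differentiable_dihedralAct (g : DihedralGroup k) :
    Differentiable ℂ (dihedralAct g : ℂ × ℂ → ℂ × ℂ) := by
  have key : ∀ g : DihedralGroup k, Differentiable ℂ (dihedralMap g) := by
    rintro (i | i)
    · change Differentiable ℂ fun z : ℂ × ℂ =>
        ((ZMod.toCircle i : ℂ) * z.1, (ZMod.toCircle (-i) : ℂ) * z.2)
      fun_prop
    · change Differentiable ℂ fun z : ℂ × ℂ =>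
        ((ZMod.toCircle (-i) : ℂ) * z.2, (ZMod.toCircle i : ℂ) * z.1)
      fun_prop
  exact key g⁻¹

lemma dihedralAct_real_smul (g : DihedralGroup k) (r : ℝ) (z : ℂ × ℂ) :
    dihedralAct g (r • z) = r • dihedralAct g z := by
  rw [← Complex.coe_smul, ← Complex.coe_smul]
  exact map_smul (dihedralRep k g⁻¹) (r : ℂ) z

variable {lam}

lemma pullback_mem_bergmanSpace (g : DihedralGroup k) {f : Lp ℂ 2 (bidiscMeasure lam)}
    (hf : f ∈ bergmanSpace lam) : pullback lam g f ∈ bergmanSpace lam := by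
  obtain ⟨F, hF⟩ := mem_bergmanSpace_iff.1 hf
  have hmp := measurePreserving_dihedralAct lam g
  refine mem_bergmanSpace_iff.2 ⟨F ∘ dihedralAct g, ?_, fun h => ?_, fun h => ?_⟩
  · exact hF.1.comp (differentiable_dihedralAct g).differentiableOn
      fun z hz => dihedralAct_mem_bidisc g hz
  · refine (hF.2.1 h).congr' ?_
    filter_upwards [eventually_aestronglyMeasurable_dilate hF.1 lam] with r hr
    refine (eLpNorm_comp_measurePreserving (p := 2)
      (hr.sub (Lp.aestronglyMeasurable f)) hmp).symm.trans (eLpNorm_congr_ae ?_)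
    filter_upwards [pullback_coeFn lam g f] with z hz
    simp only [Function.comp_apply, hz, dihedralAct_real_smul, Pi.sub_apply]
  · refine (pullback_coeFn lam g f).trans ?_
    exact hmp.quasiMeasurePreserving.ae_eq_comp (hF.2.2 h)

end Pullback

/-! ### The orthogonal projection onto an isotypic space and its action on monomials -/

namespace DihedralIrrep

variable {k : ℕ} [NeZero k] (lam : ℝ) (μ : DihedralIrrep k)

/-- The operator `P_μ^{11}`. -/
noncomputable abbrev P : Lp ℂ 2 (bidiscMeasure lam) →L[ℂ] Lp ℂ 2 (bidiscMeasure lam) :=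
  isotypicOperator lam μ μ.first μ.first

/-- The first diagonal entry of a matrix. -/
def entry (X : Matrix (Fin μ.deg) (Fin μ.deg) ℂ) : ℂ := X μ.first μ.first

/-- The normalising constant of `P_μ^{11}`. -/
noncomputable def scale : ℂ := (μ.deg : ℂ) / (Fintype.card (DihedralGroup k) : ℂ)

lemma scale_ne_zero : μ.scale ≠ 0 := by
  refine div_ne_zero ?_ ?_
  · exact_mod_cast μ.deg_pos.ne'
  · exact_mod_cast Fintype.card_ne_zero

lemma conj_scale : (starRingEnd ℂ) μ.scale = μ.scale := by simp [scale]

lemma P_apply (f : Lp ℂ 2 (bidiscMeasure lam)) :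
    μ.P lam f = μ.scale • ∑ g, μ.entry (μ.M g) • pullback lam g f := by
  rw [P, isotypicOperator]
  simp only [smul_apply, sum_apply]
  rw [← Equiv.sum_comp (Equiv.inv (DihedralGroup k))
    (fun g => μ.entry (μ.M g) • pullback lam g f)]
  rfl

omit [NeZero k] in
lemma conj_entry (g : DihedralGroup k) :
    (starRingEnd ℂ) (μ.entry (μ.M g)) = μ.entry (μ.M g⁻¹) := by
  rw [M_inv]; rfl

/-- Self-adjointness comes from unitarity: conjugating a diagonal entry of `μ(g)` gives that of
`μ(g⁻¹)`, and the adjoint of the pullback by `g` is the pullback by `g⁻¹`. -/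
lemma inner_P_left (f h : Lp ℂ 2 (bidiscMeasure lam)) :
    inner ℂ (μ.P lam f) h = inner ℂ f (μ.P lam h) := by
  rw [P_apply, P_apply, inner_smul_left, inner_smul_right, sum_inner, inner_sum, conj_scale]
  congr 1
  refine Fintype.sum_equiv (Equiv.inv _) _ _ fun g => ?_
  rw [inner_smul_left, inner_smul_right, conj_entry, inner_pullback_left]
  rfl

/-- Idempotence is Schur orthogonality, read as the statement that the normalised first matrix
coefficient equals its own convolution square. -/
lemma P_P (f : Lp ℂ 2 (bidiscMeasure lam)) : μ.P lam (μ.P lam f) = μ.P lam f := by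
  conv_lhs => rw [P_apply, P_apply]
  rw [P_apply]
  congr 1
  simp only [map_smul, map_sum, ← pullback_mul, Finset.smul_sum, smul_smul]
  have : ∀ g : DihedralGroup k, ∑ h, (μ.entry (μ.M g) * (μ.scale * μ.entry (μ.M h))) •
      pullback lam (g * h) f = ∑ u, (μ.entry (μ.M g) * (μ.scale * μ.entry (μ.M (g⁻¹ * u)))) •
      pullback lam u f := by
    intro g
    refine Fintype.sum_equiv (Equiv.mulLeft g) _ _ fun h => ?_
    simp
  simp only [this]
  rw [Finset.sum_comm]
  refine Finset.sum_congr rfl fun u _ => ?_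
  rw [← Finset.sum_smul]
  congr 1
  have h1 := μ.sum_M_mul_M μ.first u
  have hd : (μ.deg : ℂ) ≠ 0 := by exact_mod_cast μ.deg_pos.ne'
  have hc : (Fintype.card (DihedralGroup k) : ℂ) ≠ 0 := by exact_mod_cast Fintype.card_ne_zero
  calc ∑ g, μ.entry (μ.M g) * (μ.scale * μ.entry (μ.M (g⁻¹ * u)))
      = μ.scale * ∑ g, μ.M g μ.first μ.first * μ.M (g⁻¹ * u) μ.first μ.first := by
        rw [Finset.mul_sum]
        exact Finset.sum_congr rfl fun g _ => by rw [entry, entry]; ring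
    _ = μ.entry (μ.M u) := by
        rw [h1, scale, entry]
        field_simp

lemma P_phiOne (f : Lp ℂ 2 (bidiscMeasure lam)) :
    μ.P lam (mulOperator (phiOne k) (memLp_phiOne k lam) f) =
      mulOperator (phiOne k) (memLp_phiOne k lam) (μ.P lam f) := by
  rw [P_apply, P_apply]
  simp only [map_smul, map_sum]
  congr 1
  refine Finset.sum_congr rfl fun g _ => ?_
  congr 1
  exact (mulOperator_comp_action (memLp_phiOne k lam) g (phiOne_dihedralAct g) f).symm

lemma P_phiTwo (f : Lp ℂ 2 (bidiscMeasure lam)) :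
    μ.P lam (mulOperator phiTwo (memLp_phiTwo lam) f) =
      mulOperator phiTwo (memLp_phiTwo lam) (μ.P lam f) := by
  rw [P_apply, P_apply]
  simp only [map_smul, map_sum]
  congr 1
  refine Finset.sum_congr rfl fun g _ => ?_
  congr 1
  exact (mulOperator_comp_action (memLp_phiTwo lam) g (phiTwo_dihedralAct g) f).symm

variable {lam}

lemma P_mem_bergmanSpace {f : Lp ℂ 2 (bidiscMeasure lam)} (hf : f ∈ bergmanSpace lam) :
    μ.P lam f ∈ bergmanSpace lam := by
  rw [P_apply]
  exact Submodule.smul_mem _ _ (Submodule.sum_mem _ fun g _ =>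
    Submodule.smul_mem _ _ (pullback_mem_bergmanSpace g hf))

lemma mem_isotypicSpace {f : Lp ℂ 2 (bidiscMeasure lam)} :
    f ∈ isotypicSpace lam μ ↔ f ∈ bergmanSpace lam ∧ μ.P lam f = f := by
  constructor
  · rintro ⟨u, hu, rfl⟩
    exact ⟨μ.P_mem_bergmanSpace hu, μ.P_P lam u⟩
  · rintro ⟨h1, h2⟩
    exact ⟨f, h1, h2⟩

lemma sum_entry_M_r (n : ZMod k) :
    ∑ i : ZMod k, μ.entry (μ.M (.r i)) * rootChar (-i * n) = μ.entry (μ.E n) := by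
  rw [entry, E, Matrix.sum_apply]
  refine Fintype.sum_equiv (Equiv.neg _) _ _ fun i => ?_
  simp [entry, mul_comm]

lemma sum_entry_M_sr (n : ZMod k) :
    ∑ i : ZMod k, μ.entry (μ.M (.sr i)) * rootChar (-i * n) =
      μ.entry (μ.M (.sr 0) * μ.E n) := by
  rw [entry, E, Finset.mul_sum, Matrix.sum_apply]
  refine Fintype.sum_equiv (Equiv.neg _) _ _ fun i => ?_
  simp only [Equiv.neg_apply, neg_neg]
  rw [Matrix.mul_smul, ← M_sr, Matrix.smul_apply, smul_eq_mul, mul_comm]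
  rfl

/-- A rotation multiplies `z₁ᵃz₂ᵇ` by a character depending on `a - b` modulo `k`, so the sum over
rotations is the multiple `E (a - b)` of a spectral projection. The reflections in addition exchange
the exponents. -/
lemma P_mono (hlam : 1 ≤ lam) (a b : ℕ) : μ.P lam (mono hlam a b) = μ.scale •
    (μ.entry (μ.E ((a : ZMod k) - (b : ZMod k))) • mono hlam a b +
      μ.entry (μ.M (.sr 0) * μ.E ((a : ZMod k) - (b : ZMod k))) • mono hlam b a) := by
  rw [P_apply, ← (DihedralGroup.equivSum (n := k)).symm.sum_comp, Fintype.sum_sum_type]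
  congr 2
  · rw [← sum_entry_M_r, Finset.sum_smul]
    refine Finset.sum_congr rfl fun i _ => ?_
    rw [mul_smul, ← pullback_r_mono]
    rfl
  · rw [← sum_entry_M_sr, Finset.sum_smul]
    refine Finset.sum_congr rfl fun i _ => ?_
    rw [mul_smul, ← pullback_sr_mono]
    rfl

end DihedralIrrep

/-! ### Vectors orthogonal to the ranges of both multiplication operators -/

/-- `M_{φ₁}` on `L²`. -/
noncomputable abbrev mulOne (k : ℕ) (lam : ℝ) :
    Lp ℂ 2 (bidiscMeasure lam) →L[ℂ] Lp ℂ 2 (bidiscMeasure lam) :=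
  mulOperator (phiOne k) (memLp_phiOne k lam)

/-- `M_{φ₂}` on `L²`. -/
noncomputable abbrev mulTwo (lam : ℝ) :
    Lp ℂ 2 (bidiscMeasure lam) →L[ℂ] Lp ℂ 2 (bidiscMeasure lam) :=
  mulOperator phiTwo (memLp_phiTwo lam)

lemma mulTwo_pow_mono {lam : ℝ} (hlam : 1 ≤ lam) (n a b : ℕ) :
    (mulTwo lam ^ n) (mono hlam a b) = mono hlam (a + n) (b + n) := by
  induction n with
  | zero => simp
  | succ n ih =>
    rw [pow_succ', mul_apply_eq_comp, ih, phiTwo_mono]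
    rfl

/-- Subtracting the finite orthogonal expansion leaves a vector of the space orthogonal to every
monomial. -/
lemma eq_sum_mono {lam : ℝ} (hlam : 1 ≤ lam) {v : Lp ℂ 2 (bidiscMeasure lam)}
    (hv : v ∈ bergmanSpace lam) (S : Finset (ℕ × ℕ))
    (hS : ∀ a b, inner ℂ (mono hlam a b) v ≠ 0 → (a, b) ∈ S) :
    ∃ x : ℕ × ℕ → ℂ, v = ∑ s ∈ S, x s • mono hlam s.1 s.2 := by
  have hpos : ∀ a b, (moment lam a : ℂ) * moment lam b ≠ 0 := fun a b => by
    exact_mod_cast mul_ne_zero (moment_pos hlam a).ne' (moment_pos hlam b).ne'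
  refine ⟨fun s => inner ℂ (mono hlam s.1 s.2) v / ((moment lam s.1 : ℂ) * moment lam s.2), ?_⟩
  rw [← sub_eq_zero]
  refine eq_zero_of_inner_mono_eq_zero hlam (Submodule.sub_mem _ hv (Submodule.sum_mem _
    fun s _ => Submodule.smul_mem _ _ (mono_mem_bergmanSpace hlam _ _))) fun a b => ?_
  rw [inner_sub_right, inner_sum]
  simp only [inner_smul_right, inner_mono_mono]
  rw [sub_eq_zero]
  by_cases hab : (a, b) ∈ S
  · rw [Finset.sum_eq_single_of_mem (a, b) hab]
    · simp only [and_self, if_true]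
      rw [div_mul_cancel₀ _ (hpos a b)]
    · rintro ⟨c, d⟩ _ hne
      rw [if_neg, mul_zero]
      rintro ⟨rfl, rfl⟩
      exact hne rfl
  · rw [Finset.sum_eq_zero]
    · by_contra h
      exact hab (hS a b h)
    · rintro ⟨c, d⟩ hcd
      rw [if_neg, mul_zero]
      rintro ⟨rfl, rfl⟩
      exact hab hcd

namespace DihedralIrrep

variable {k : ℕ} [NeZero k] {lam : ℝ}

/-- `v` lies in `P_μ^{11}(𝔸^(λ))` and is orthogonal to the images of `M_{φ₁}` and `M_{φ₂}` there. -/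
def IsDefect (lam : ℝ) (μ : DihedralIrrep k) (v : Lp ℂ 2 (bidiscMeasure lam)) : Prop :=
  v ∈ isotypicSpace lam μ ∧ ∀ h ∈ isotypicSpace lam μ,
    inner ℂ (mulOne k lam h) v = 0 ∧ inner ℂ (mulTwo lam h) v = 0

variable {μ : DihedralIrrep k}

lemma P_mem_isotypicSpace {f : Lp ℂ 2 (bidiscMeasure lam)} (hf : f ∈ bergmanSpace lam) :
    μ.P lam f ∈ isotypicSpace lam μ := ⟨f, hf, rfl⟩

/-- The projection is self-adjoint, fixes `v` and commutes with multiplication, so orthogonality to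
the image of the isotypic space extends to the image of the whole space. This allows testing against
single monomials. -/
lemma IsDefect.inner_mulOne {v : Lp ℂ 2 (bidiscMeasure lam)} (hv : μ.IsDefect lam v)
    {f : Lp ℂ 2 (bidiscMeasure lam)} (hf : f ∈ bergmanSpace lam) :
    inner ℂ (mulOne k lam f) v = 0 := by
  rw [← (μ.mem_isotypicSpace.1 hv.1).2, ← inner_P_left, P_phiOne]
  exact (hv.2 _ (P_mem_isotypicSpace hf)).1

lemma IsDefect.inner_mulTwo {v : Lp ℂ 2 (bidiscMeasure lam)} (hv : μ.IsDefect lam v)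
    {f : Lp ℂ 2 (bidiscMeasure lam)} (hf : f ∈ bergmanSpace lam) :
    inner ℂ (mulTwo lam f) v = 0 := by
  rw [← (μ.mem_isotypicSpace.1 hv.1).2, ← inner_P_left, P_phiTwo]
  exact (hv.2 _ (P_mem_isotypicSpace hf)).2

/-- A monomial with both exponents below `k` and one of them zero occurs in no multiple of `φ₁` or
`φ₂`: the Taylor coefficients involved have a negative index. -/
lemma isDefect_P_mono (hlam : 1 ≤ lam) {a b : ℕ} (ha : a < k) (hb : b < k)
    (hab : a = 0 ∨ b = 0) : μ.IsDefect lam (μ.P lam (mono hlam a b)) := by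
  refine ⟨P_mem_isotypicSpace (mono_mem_bergmanSpace hlam a b), fun h hh => ?_⟩
  obtain ⟨hA, hP⟩ := μ.mem_isotypicSpace.1 hh
  obtain ⟨F, hF⟩ := mem_bergmanSpace_iff.1 hA
  constructor
  · rw [← inner_P_left, P_phiOne, hP, inner_eq_zero_symm, inner_mono_phiOne hlam k hF,
      taylorCoeff_of_neg_fst hF.1 (by omega), taylorCoeff_of_neg_snd hF.1 _ (by omega)]
    simp
  · rw [← inner_P_left, P_phiTwo, hP, inner_eq_zero_symm, inner_mono_phiTwo hlam hF]
    rcases hab with rfl | rfl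
    · rw [taylorCoeff_of_neg_fst hF.1 (by simp), zero_mul]
    · rw [taylorCoeff_of_neg_snd hF.1 _ (by simp), zero_mul]

lemma IsDefect.inner_mono_succ_succ (hlam : 1 ≤ lam) {v : Lp ℂ 2 (bidiscMeasure lam)}
    (hv : μ.IsDefect lam v) (a b : ℕ) : inner ℂ (mono hlam (a + 1) (b + 1)) v = 0 := by
  rw [← phiTwo_mono]
  exact hv.inner_mulTwo (mono_mem_bergmanSpace hlam a b)

lemma IsDefect.inner_mono_add (hlam : 1 ≤ lam) {v : Lp ℂ 2 (bidiscMeasure lam)}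
    (hv : μ.IsDefect lam v) (a b : ℕ) :
    inner ℂ (mono hlam (a + k) b) v + inner ℂ (mono hlam a (b + k)) v = 0 := by
  rw [← inner_add_left, ← phiOne_mono]
  exact hv.inner_mulOne (mono_mem_bergmanSpace hlam a b)

/-! ### Monomials occurring in defect vectors -/

variable {j : ℕ} {ε : ℂ} {e : Fin μ.deg → ℂ}

lemma HasType.inner_mono_eq_zero (h : μ.HasType j ε e) (hlam : 1 ≤ lam)
    {v : Lp ℂ 2 (bidiscMeasure lam)} (hv : μ.P lam v = v) {a b : ℕ}
    (h1 : (a : ZMod k) - (b : ZMod k) ≠ j) (h2 : (a : ZMod k) - (b : ZMod k) ≠ -j) :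
    inner ℂ (mono hlam a b) v = 0 := by
  rw [← hv, ← inner_P_left, P_mono, h.isWeight.E_eq_zero h1 h2]
  simp [entry]

lemma HasType.inner_mono_swap (h : μ.HasType j ε e) (hs : j = 0 ∨ 2 * j = k) (hlam : 1 ≤ lam)
    {v : Lp ℂ 2 (bidiscMeasure lam)} (hv : μ.P lam v = v) {a b : ℕ}
    (h1 : (a : ZMod k) - (b : ZMod k) = j) :
    inner ℂ (mono hlam b a) v = ε * inner ℂ (mono hlam a b) v := by
  have hJ := h.neg_eq_self hs
  have hE := h.isWeight.E_self hJ
  have h2 : (b : ZMod k) - (a : ZMod k) = j := by rw [hJ, ← h1, neg_sub]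
  have e1 : entry μ ((k : ℂ) • (1 : Matrix (Fin μ.deg) (Fin μ.deg) ℂ)) = k := by simp [entry]
  have e2 : entry μ (ε • (1 : Matrix (Fin μ.deg) (Fin μ.deg) ℂ) * ((k : ℂ) • 1)) = ε * k := by
    simp [entry, mul_comm]
  have hc : (starRingEnd ℂ) ε = ε := by rcases h.sign with rfl | rfl <;> simp
  have hε : ε * ε = 1 := by rcases h.sign with rfl | rfl <;> ring
  have key : ∀ {a b : ℕ}, (a : ZMod k) - (b : ZMod k) = j → inner ℂ (mono hlam a b) v =
      μ.scale * k * (inner ℂ (mono hlam a b) v + ε * inner ℂ (mono hlam b a) v) := by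
    intro a b hab
    conv_lhs => rw [← hv]
    rw [← inner_P_left, P_mono, hab, hE, h.M_sr_eq hs, e1, e2, inner_smul_left, inner_add_left,
      inner_smul_left, inner_smul_left, conj_scale, map_mul, hc, Complex.conj_natCast]
    ring
  have k1 := key h1
  have k2 := key h2
  -- With `A`, `B` the two inner products and `s = scale * k`, one has `A = s(A + εB)` and `B = s(B
  -- + εA)`. Since `ε² = 1`, multiplying the first by `ε` gives `εA = s(εA + B) = B`.
  linear_combination k2 - ε * k1 - μ.scale * k * inner ℂ (mono hlam b a) v * hε

/-- The exponents of the monomials that can occur in a vector orthogonal to the ranges. -/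
def defectSupport (k j : ℕ) : Finset (ℕ × ℕ) := {(j, 0), (0, j), (k - j, 0), (0, k - j)}

-- The bound includes `n = k`: for `j = 0` this is the exponent `k - j`, which occurs in `z₁ᵏ -
-- z₂ᵏ`.
omit [NeZero k] in
lemma natCast_eq_or_of_le {j n : ℕ} (hj : 2 * j ≤ k) (hn : n ≤ k)
    (h : (n : ZMod k) = j ∨ (n : ZMod k) = -j) : n = j ∨ n = k - j := by
  rcases Nat.eq_zero_or_pos k with rfl | hk
  · omega
  have h' : n ≡ j [MOD k] ∨ n ≡ k - j [MOD k] := by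
    rw [← ZMod.natCast_eq_natCast_iff, ← ZMod.natCast_eq_natCast_iff,
      Nat.cast_sub (by omega), ZMod.natCast_self, zero_sub]
    exact h
  rcases h' with h' | h'
  · rcases Nat.lt_or_ge n k with hlt | hge
    · exact Or.inl (Nat.ModEq.eq_of_lt_of_lt h' hlt (by omega))
    · have : n = k := le_antisymm hn hge
      subst this
      have h0 : j ≡ 0 [MOD n] := h'.symm.trans (by simp [Nat.ModEq])
      have := Nat.ModEq.eq_of_lt_of_lt h0 (by omega) hk
      omega
  · rcases Nat.lt_or_ge n k with hlt | hge
    · rcases Nat.eq_zero_or_pos j with rfl | hj0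
      · have h0 : n ≡ 0 [MOD k] := h'.trans (by simp [Nat.ModEq])
        exact Or.inl (Nat.ModEq.eq_of_lt_of_lt h0 hlt hk)
      · exact Or.inr (Nat.ModEq.eq_of_lt_of_lt h' hlt (by omega))
    · have : n = k := le_antisymm hn hge
      subst this
      have h0 : n - j ≡ 0 [MOD n] := h'.symm.trans (by simp [Nat.ModEq])
      rcases Nat.eq_zero_or_pos j with rfl | hj0
      · exact Or.inr rfl
      · have := Nat.ModEq.eq_of_lt_of_lt h0 (by omega) hk
        omega

/-- The weight of the monomial must be `±j`, and orthogonality to multiples of `φ₂` leaves only pure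
powers. For `c ≥ 0`, `φ₁z₁ᶜ⁺¹ = z₁ᶜ⁺¹⁺ᵏ + z₁ᶜ⁺¹z₂ᵏ`, where the second term is a multiple of `φ₂`.
Hence exponents above `k` are excluded as well, but not `k` itself. -/
lemma HasType.mem_defectSupport (h : μ.HasType j ε e) (hlam : 1 ≤ lam)
    {v : Lp ℂ 2 (bidiscMeasure lam)} (hv : μ.IsDefect lam v) {a b : ℕ}
    (hab : inner ℂ (mono hlam a b) v ≠ 0) : (a, b) ∈ defectSupport k j := by
  have hk : 0 < k := Nat.pos_of_ne_zero (NeZero.ne k)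
  have h1 : (a : ZMod k) - (b : ZMod k) = j ∨ (a : ZMod k) - (b : ZMod k) = -j := by
    by_contra hn
    push Not at hn
    exact hab (h.inner_mono_eq_zero hlam (μ.mem_isotypicSpace.1 hv.1).2 hn.1 hn.2)
  have h0 : a = 0 ∨ b = 0 := by
    by_contra hn
    push Not at hn
    obtain ⟨a, rfl⟩ := Nat.exists_eq_succ_of_ne_zero hn.1
    obtain ⟨b, rfl⟩ := Nat.exists_eq_succ_of_ne_zero hn.2
    exact hab (hv.inner_mono_succ_succ hlam a b)
  have hk1 : k - 1 + 1 = k := by omega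
  simp only [defectSupport, Finset.mem_insert, Finset.mem_singleton, Prod.mk.injEq]
  rcases h0 with rfl | rfl
  · have hb : b ≤ k := by
      by_contra hlt
      obtain ⟨c, rfl⟩ : ∃ c, b = (c + 1) + k := ⟨b - k - 1, by omega⟩
      have h2 := hv.inner_mono_add hlam 0 (c + 1)
      have h3 := hv.inner_mono_succ_succ hlam (k - 1) c
      rw [hk1] at h3
      rw [zero_add, h3, zero_add] at h2
      exact hab h2
    have := natCast_eq_or_of_le h.two_mul_le hb (by
      rw [Nat.cast_zero, zero_sub, neg_eq_iff_eq_neg, neg_inj] at h1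
      exact h1.symm)
    omega
  · have ha : a ≤ k := by
      by_contra hlt
      obtain ⟨c, rfl⟩ : ∃ c, a = (c + 1) + k := ⟨a - k - 1, by omega⟩
      have h2 := hv.inner_mono_add hlam (c + 1) 0
      have h3 := hv.inner_mono_succ_succ hlam c (k - 1)
      rw [hk1] at h3
      rw [zero_add, h3, add_zero] at h2
      exact hab h2
    have := natCast_eq_or_of_le h.two_mul_le ha (by
      rw [Nat.cast_zero, sub_zero] at h1
      exact h1)
    omega

/-! ### Pairings of defect vectors that detect the type -/

/-- The form `⟨M_{φ₁} v, M_{φ₂}ⁿ w⟩` vanishes for a type other than `n`. -/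
lemma HasType.inner_mulOne_mulTwo_pow_eq_zero (h : μ.HasType j ε e) (hlam : 1 ≤ lam)
    {v w : Lp ℂ 2 (bidiscMeasure lam)} (hv : μ.IsDefect lam v) (hw : μ.IsDefect lam w) {n : ℕ}
    (hn : 0 < n) (hnk : 2 * n ≤ k) (hnj : n ≠ j) :
    inner ℂ (mulOne k lam v) ((mulTwo lam ^ n) w) = 0 := by
  obtain ⟨x, rfl⟩ := eq_sum_mono hlam (μ.mem_isotypicSpace.1 hv.1).1 (defectSupport k j)
    fun a b => h.mem_defectSupport hlam hv
  obtain ⟨y, rfl⟩ := eq_sum_mono hlam (μ.mem_isotypicSpace.1 hw.1).1 (defectSupport k j)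
    fun a b => h.mem_defectSupport hlam hw
  rw [map_sum, map_sum, sum_inner]
  refine Finset.sum_eq_zero fun s hs => ?_
  rw [inner_sum]
  refine Finset.sum_eq_zero fun t ht => ?_
  rw [map_smul, map_smul, inner_smul_left, inner_smul_right, phiOne_mono, mulTwo_pow_mono,
    inner_add_left, inner_mono_mono, inner_mono_mono]
  have hj := h.two_mul_le
  obtain ⟨s1, s2⟩ := s
  obtain ⟨t1, t2⟩ := t
  simp only [defectSupport, Finset.mem_insert, Finset.mem_singleton, Prod.mk.injEq] at hs ht
  -- The smaller exponent is `n` in every monomial of `φ₂ⁿw`, and one of `0`, `j`, `k - j`, `k` in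
  -- those of `φ₁v`. For `0 < n ≤ k/2` only `n = j` permits a match, since `n = k - j` forces `2j =
  -- k` and `n = j`.
  rw [if_neg (by simp only; omega), if_neg (by simp only; omega)]
  simp

/-- The form `⟨M_{φ₁} v, M_{φ₂}ʲ w⟩` does not vanish for the type `j > 0`. -/
lemma HasType.exists_inner_mulOne_mulTwo_pow_ne_zero (h : μ.HasType j ε e) (hlam : 1 ≤ lam)
    (hj : 0 < j) : ∃ v w, μ.IsDefect lam v ∧ μ.IsDefect lam w ∧
      inner ℂ (mulOne k lam v) ((mulTwo lam ^ j) w) ≠ 0 := by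
  have hjk := h.two_mul_le
  have hk : (k : ℂ) ≠ 0 := by exact_mod_cast NeZero.ne k
  have hpow : ∀ (n : ℕ) (f : Lp ℂ 2 (bidiscMeasure lam)),
      μ.P lam ((mulTwo lam ^ n) f) = (mulTwo lam ^ n) (μ.P lam f) := by
    intro n f
    induction n with
    | zero => simp
    | succ n ih =>
      rw [pow_succ', mul_apply_eq_comp, mul_apply_eq_comp, P_phiTwo, ih]
  have hmove : ∀ f g : Lp ℂ 2 (bidiscMeasure lam),
      inner ℂ (mulOne k lam (μ.P lam f)) ((mulTwo lam ^ j) (μ.P lam g)) =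
      inner ℂ (mulOne k lam (μ.P lam f)) ((mulTwo lam ^ j) g) := by
    intro f g
    rw [← hpow, ← inner_P_left, P_phiOne, P_P]
  -- The first basis vector need not be an eigenvector of `μ(δ)`, but it has a nonzero component for
  -- one of the weights `±j`, because the corresponding projections add up to the identity.
  have hne : μ.entry (μ.E j) ≠ 0 ∨ μ.entry (μ.E (-j)) ≠ 0 := by
    by_contra hn
    push Not at hn
    by_cases hJ : (j : ZMod k) = -j
    · have h1 := hn.1
      rw [h.isWeight.E_self hJ] at h1
      simp [entry, hk] at h1
    · have h1 := congrArg μ.entry (h.isWeight.E_add hJ)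
      have h2 : μ.entry (μ.E j + μ.E (-j)) = μ.entry (μ.E j) + μ.entry (μ.E (-j)) := rfl
      rw [h2, hn.1, hn.2, add_zero] at h1
      simp [entry] at h1
      exact hk h1.symm
  have hpos : ∀ a b, (moment lam a : ℂ) * moment lam b ≠ 0 := fun a b => by
    exact_mod_cast mul_ne_zero (moment_pos hlam a).ne' (moment_pos hlam b).ne'
  rcases hne with hne | hne
  -- The witnesses come from `z₁ʲz₂ᵏ`, which is both a term of `φ₁z₁ʲ` and equal to `φ₂ʲz₂ᵏ⁻ʲ`. No
  -- other term of `φ₁ P(z₁ʲ)` matches it.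
  · refine ⟨_, _, isDefect_P_mono hlam (a := j) (b := 0) (by omega) (by omega) (Or.inr rfl),
      isDefect_P_mono hlam (a := 0) (b := k - j) (by omega) (by omega) (Or.inl rfl), ?_⟩
    rw [hmove, P_mono, mulTwo_pow_mono, map_smul, map_add, map_smul, map_smul, phiOne_mono,
      phiOne_mono, inner_smul_left, inner_add_left, inner_smul_left, inner_smul_left,
      inner_add_left, inner_add_left]
    simp only [inner_mono_mono]
    rw [if_neg (by omega), if_pos (by omega), if_neg (by omega), if_neg (by omega)]
    simp only [Nat.cast_zero, sub_zero, add_zero, zero_add, mul_zero, conj_scale]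
    exact mul_ne_zero μ.scale_ne_zero (mul_ne_zero (by simpa using hne) (hpos _ _))
  · refine ⟨_, _, isDefect_P_mono hlam (a := 0) (b := j) (by omega) (by omega) (Or.inl rfl),
      isDefect_P_mono hlam (a := k - j) (b := 0) (by omega) (by omega) (Or.inr rfl), ?_⟩
    rw [hmove, P_mono, mulTwo_pow_mono, map_smul, map_add, map_smul, map_smul, phiOne_mono,
      phiOne_mono, inner_smul_left, inner_add_left, inner_smul_left, inner_smul_left,
      inner_add_left, inner_add_left]
    simp only [inner_mono_mono]
    rw [if_pos (by omega), if_neg (by omega), if_neg (by omega), if_neg (by omega)]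
    simp only [Nat.cast_zero, zero_sub, add_zero, zero_add, mul_zero, conj_scale]
    exact mul_ne_zero μ.scale_ne_zero (mul_ne_zero (by simpa using hne) (hpos _ _))

/-- For `2j = k` the vectors orthogonal to the ranges are the multiples of `z₁ʲ + ε z₂ʲ`. -/
lemma HasType.eq_smul_of_two_mul_eq (h : μ.HasType j ε e) (hlam : 1 ≤ lam) (hj : 2 * j = k)
    {v : Lp ℂ 2 (bidiscMeasure lam)} (hv : μ.IsDefect lam v) :
    ∃ x : ℂ, v = x • (mono hlam j 0 + ε • mono hlam 0 j) := by
  have hk : 0 < k := Nat.pos_of_ne_zero (NeZero.ne k)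
  have hkj : k - j = j := by omega
  obtain ⟨x, hx⟩ := eq_sum_mono hlam (μ.mem_isotypicSpace.1 hv.1).1 {(j, 0), (0, j)}
    (fun a b hab => by
      have := h.mem_defectSupport hlam hv hab
      rw [defectSupport, hkj] at this
      simp only [Finset.mem_insert, Finset.mem_singleton] at this ⊢
      tauto)
  rw [Finset.sum_pair (by simp; omega)] at hx
  have hsw := h.inner_mono_swap (Or.inr hj) hlam (μ.mem_isotypicSpace.1 hv.1).2
    (a := j) (b := 0) (by simp)
  rw [hx] at hsw
  simp only [inner_add_right, inner_smul_right, inner_mono_mono] at hsw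
  have hpos : (moment lam 0 : ℂ) * moment lam j ≠ 0 := by
    exact_mod_cast mul_ne_zero (moment_pos hlam 0).ne' (moment_pos hlam j).ne'
  have hj0 : j ≠ 0 := by omega
  simp only [hj0, hj0.symm, and_self, if_true, if_false, mul_zero, zero_add,
    add_zero] at hsw
  refine ⟨x (j, 0), ?_⟩
  have h2 : x (0, j) = ε * x (j, 0) := by
    apply mul_right_cancel₀ hpos
    rw [hsw]; ring
  rw [hx, h2, smul_add, smul_smul, mul_comm ε]

lemma HasType.inner_of_two_mul_eq (h : μ.HasType j ε e) (hlam : 1 ≤ lam) (hj : 2 * j = k)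
    {v : Lp ℂ 2 (bidiscMeasure lam)} (hv : μ.IsDefect lam v) :
    ∃ x : ℂ, (x = 0 → v = 0) ∧ inner ℂ (mulOne k lam v) ((mulTwo lam ^ j) v) =
      ε * (‖x‖ ^ 2 * (2 * (moment lam k * moment lam j)) : ℝ) := by
  have hk : 0 < k := Nat.pos_of_ne_zero (NeZero.ne k)
  obtain ⟨x, rfl⟩ := h.eq_smul_of_two_mul_eq hlam hj hv
  refine ⟨x, fun h0 => by rw [h0, zero_smul], ?_⟩
  have hc : (starRingEnd ℂ) ε = ε := by rcases h.sign with rfl | rfl <;> simp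
  simp only [map_smul, map_add, phiOne_mono, mulTwo_pow_mono, inner_smul_left, inner_smul_right,
    inner_add_left, inner_add_right, inner_mono_mono, hc]
  have e1 : j + j = k := by omega
  have e2 : ¬ (j + k = k) := by omega
  have e3 : ¬ (k = j) := by omega
  have e4 : ¬ (j = k) := by omega
  have e5 : ¬ (0 = j) := by omega
  have e6 : ¬ (j + k = j) := by omega
  -- The products `φ₁(z₁ʲ + εz₂ʲ)` and `φ₂ʲ(z₁ʲ + εz₂ʲ)` share the monomials with exponents `(k, j)`
  -- and `(j, k)`, and each contributes `ε`.
  simp only [zero_add, e1, e2, e3, e4, e5, e6, and_false, false_and, if_true,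
    if_false, and_self, mul_zero, add_zero]
  push_cast
  rw [← Complex.mul_conj']
  ring

/-- For the type `0` the vectors orthogonal to the ranges are constants if `ε = 1`. -/
lemma HasType.eq_smul_of_eq_one (h : μ.HasType 0 1 e) (hlam : 1 ≤ lam)
    {v : Lp ℂ 2 (bidiscMeasure lam)} (hv : μ.IsDefect lam v) : ∃ x : ℂ, v = x • mono hlam 0 0 := by
  have hk : 0 < k := Nat.pos_of_ne_zero (NeZero.ne k)
  have h1 := hv.inner_mono_add hlam 0 0
  have hsw := h.inner_mono_swap (Or.inl rfl) hlam (μ.mem_isotypicSpace.1 hv.1).2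
    (a := k) (b := 0) (by simp)
  rw [one_mul] at hsw
  rw [zero_add, hsw] at h1
  -- The coefficients at `z₁ᵏ` and `z₂ᵏ` agree by symmetry, while orthogonality to `φ₁` makes their
  -- inner products add up to zero.
  have h2 : inner ℂ (mono hlam k 0) v = 0 := by linear_combination h1 / 2
  obtain ⟨x, hx⟩ := eq_sum_mono hlam (μ.mem_isotypicSpace.1 hv.1).1 {(0, 0)}
    (fun a b hab => by
      have := h.mem_defectSupport hlam hv hab
      simp only [defectSupport, tsub_zero, Finset.mem_insert, Finset.mem_singleton,
        Prod.mk.injEq] at this ⊢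
      rcases this with ⟨rfl, rfl⟩ | ⟨rfl, rfl⟩ | ⟨rfl, rfl⟩ | ⟨rfl, rfl⟩
      · simp
      · simp
      · exact absurd h2 hab
      · exact absurd (hsw.trans h2) hab)
  exact ⟨_, by simpa using hx⟩

/-- For the type `0` the vectors orthogonal to the ranges are the multiples of `z₁ᵏ - z₂ᵏ`
if `ε = -1`. -/
lemma HasType.eq_smul_of_eq_neg_one (h : μ.HasType 0 (-1) e) (hlam : 1 ≤ lam)
    {v : Lp ℂ 2 (bidiscMeasure lam)} (hv : μ.IsDefect lam v) :
    ∃ x : ℂ, v = x • (mono hlam k 0 - mono hlam 0 k) := by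
  have hk : 0 < k := Nat.pos_of_ne_zero (NeZero.ne k)
  have hk0 : k ≠ 0 := hk.ne'
  have hsw := h.inner_mono_swap (Or.inl rfl) hlam (μ.mem_isotypicSpace.1 hv.1).2
    (a := k) (b := 0) (by simp)
  have hsw0 := h.inner_mono_swap (Or.inl rfl) hlam (μ.mem_isotypicSpace.1 hv.1).2
    (a := 0) (b := 0) (by simp)
  -- Antisymmetry under the exchange of coordinates leaves no constant term.
  have h2 : inner ℂ (mono hlam 0 0) v = 0 := by linear_combination hsw0 / 2
  obtain ⟨x, hx⟩ := eq_sum_mono hlam (μ.mem_isotypicSpace.1 hv.1).1 {(k, 0), (0, k)}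
    (fun a b hab => by
      have := h.mem_defectSupport hlam hv hab
      simp only [defectSupport, tsub_zero, Finset.mem_insert, Finset.mem_singleton,
        Prod.mk.injEq] at this ⊢
      rcases this with ⟨rfl, rfl⟩ | ⟨rfl, rfl⟩ | ⟨rfl, rfl⟩ | ⟨rfl, rfl⟩
      · exact absurd h2 hab
      · exact absurd h2 hab
      · simp
      · simp)
  rw [Finset.sum_pair (by simp; omega)] at hx
  rw [hx] at hsw
  simp only [inner_add_right, inner_smul_right, inner_mono_mono, hk0, hk0.symm, and_self,
    if_true, if_false, mul_zero, zero_add, add_zero] at hsw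
  have hpos : (moment lam 0 : ℂ) * moment lam k ≠ 0 := by
    exact_mod_cast mul_ne_zero (moment_pos hlam 0).ne' (moment_pos hlam k).ne'
  refine ⟨x (k, 0), ?_⟩
  have h3 : x (0, k) = -x (k, 0) := by
    apply mul_right_cancel₀ hpos
    rw [hsw]; ring
  rw [hx, h3, smul_sub, neg_smul, sub_eq_add_neg]

lemma HasType.exists_isDefect_ne_zero (h : μ.HasType 0 1 e) (hlam : 1 ≤ lam) :
    ∃ v, μ.IsDefect lam v ∧ v ≠ 0 := by
  have hk : 0 < k := Nat.pos_of_ne_zero (NeZero.ne k)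
  refine ⟨_, isDefect_P_mono hlam (a := 0) (b := 0) hk hk (Or.inl rfl), fun h0 => ?_⟩
  have h1 : inner ℂ (mono hlam 0 0) (μ.P lam (mono hlam 0 0)) = 0 := by rw [h0, inner_zero_right]
  have hJ := h.neg_eq_self (Or.inl rfl)
  have hE := h.isWeight.E_self hJ
  have hk' : (k : ℂ) ≠ 0 := by exact_mod_cast hk.ne'
  rw [Nat.cast_zero] at hE
  rw [P_mono, Nat.cast_zero, sub_zero, hE, h.M_sr_eq (Or.inl rfl), one_smul, one_mul, ← add_smul,
    inner_smul_right, inner_smul_right, inner_mono_mono] at h1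
  have e1 : entry μ ((k : ℂ) • (1 : Matrix (Fin μ.deg) (Fin μ.deg) ℂ)) = k := by simp [entry]
  rw [e1, ← two_mul] at h1
  simp [μ.scale_ne_zero, hk.ne', (moment_pos hlam 0).ne'] at h1

end DihedralIrrep

/-! ### Comparison of two representations -/

namespace DihedralIrrep

variable {k : ℕ} [NeZero k] {lam : ℝ} {μ ν : DihedralIrrep k}

lemma coe_restrictedPhiTwo_pow (n : ℕ) (v : isotypicSpace lam μ) :
    ((restrictedPhiTwo lam μ ^ n) v : Lp ℂ 2 (bidiscMeasure lam)) =
      (mulTwo lam ^ n) (v : Lp ℂ 2 (bidiscMeasure lam)) := by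
  induction n with
  | zero => simp
  | succ n ih =>
    rw [pow_succ', mul_apply_eq_comp, pow_succ', mul_apply_eq_comp, ← ih]
    rfl

/-- A unitary equivalence induces a map of the vectors orthogonal to the ranges that preserves the
inner products of their images under the multiplication operators. -/
lemma exists_defect_map (hU : UnitarilyEquivalentPairs (restrictedPhiOne lam μ)
    (restrictedPhiTwo lam μ) (restrictedPhiOne lam ν) (restrictedPhiTwo lam ν)) :
    ∃ V : Lp ℂ 2 (bidiscMeasure lam) → Lp ℂ 2 (bidiscMeasure lam),
      ∀ v, μ.IsDefect lam v → ν.IsDefect lam (V v) ∧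
        inner ℂ (mulOne k lam (V v)) (mulOne k lam (V v)) =
          inner ℂ (mulOne k lam v) (mulOne k lam v) ∧
        ∀ n w, μ.IsDefect lam w →
          inner ℂ (mulOne k lam (V v)) ((mulTwo lam ^ n) (V w)) =
            inner ℂ (mulOne k lam v) ((mulTwo lam ^ n) w) ∧
          inner ℂ ((mulTwo lam ^ n) (V v)) ((mulTwo lam ^ n) (V w)) =
            inner ℂ ((mulTwo lam ^ n) v) ((mulTwo lam ^ n) w) := by
  classical
  obtain ⟨U, h1, h2⟩ := hU
  have h2n : ∀ (n : ℕ) x, U ((restrictedPhiTwo lam μ ^ n) x) =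
      (restrictedPhiTwo lam ν ^ n) (U x) := by
    intro n x
    induction n with
    | zero => simp
    | succ n ih => rw [pow_succ', mul_apply_eq_comp, h2, ih, pow_succ', mul_apply_eq_comp]
  -- The map is `U` on the isotypic space; the value `0` elsewhere is a default that plays no role.
  refine ⟨fun v => if hv : v ∈ isotypicSpace lam μ then
    (U ⟨v, hv⟩ : Lp ℂ 2 (bidiscMeasure lam)) else 0, ?_⟩
  intro v hv
  simp only [dif_pos hv.1]
  refine ⟨⟨(U ⟨v, hv.1⟩).2, fun h hh => ?_⟩, ?_, ?_⟩
  · obtain ⟨g, hg⟩ := U.surjective ⟨h, hh⟩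
    constructor
    · have e : inner ℂ (restrictedPhiOne lam ν (U g)) (U ⟨v, hv.1⟩) = 0 := by
        rw [← h1, U.inner_map_map]
        exact (hv.2 g.1 g.2).1
      rw [hg] at e
      exact e
    · have e : inner ℂ (restrictedPhiTwo lam ν (U g)) (U ⟨v, hv.1⟩) = 0 := by
        rw [← h2, U.inner_map_map]
        exact (hv.2 g.1 g.2).2
      rw [hg] at e
      exact e
  · have e := U.inner_map_map (restrictedPhiOne lam μ ⟨v, hv.1⟩) (restrictedPhiOne lam μ ⟨v, hv.1⟩)
    rw [h1] at e
    exact e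
  · intro n w hw
    simp only [dif_pos hw.1]
    constructor
    · have e := U.inner_map_map (restrictedPhiOne lam μ ⟨v, hv.1⟩)
        ((restrictedPhiTwo lam μ ^ n) ⟨w, hw.1⟩)
      rw [h1, h2n, Submodule.coe_inner, Submodule.coe_inner, coe_restrictedPhiTwo_pow,
        coe_restrictedPhiTwo_pow] at e
      exact e
    · have e := U.inner_map_map ((restrictedPhiTwo lam μ ^ n) ⟨v, hv.1⟩)
        ((restrictedPhiTwo lam μ ^ n) ⟨w, hw.1⟩)
      rw [h2n, h2n, Submodule.coe_inner, Submodule.coe_inner, coe_restrictedPhiTwo_pow,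
        coe_restrictedPhiTwo_pow, coe_restrictedPhiTwo_pow, coe_restrictedPhiTwo_pow] at e
      exact e

omit [NeZero k] in
lemma _root_.UnitarilyEquivalentPairs.symm {H H' : Type*} [NormedAddCommGroup H]
    [InnerProductSpace ℂ H] [NormedAddCommGroup H'] [InnerProductSpace ℂ H']
    {T₁ T₂ : H →L[ℂ] H} {S₁ S₂ : H' →L[ℂ] H'} (h : UnitarilyEquivalentPairs T₁ T₂ S₁ S₂) :
    UnitarilyEquivalentPairs S₁ S₂ T₁ T₂ := by
  obtain ⟨U, h1, h2⟩ := h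
  refine ⟨U.symm, fun x => ?_, fun x => ?_⟩
  · rw [LinearIsometryEquiv.symm_apply_eq, h1, LinearIsometryEquiv.apply_symm_apply]
  · rw [LinearIsometryEquiv.symm_apply_eq, h2, LinearIsometryEquiv.apply_symm_apply]

variable {j j' : ℕ} {ε ε' : ℂ} {e : Fin μ.deg → ℂ} {e' : Fin ν.deg → ℂ}

/-- The pairing with `n = j` is not identically zero for `μ`, but it vanishes for any `ν` of a
different type. -/
lemma HasType.exponent_eq_of_pos (h : μ.HasType j ε e) (h' : ν.HasType j' ε' e') (hlam : 1 ≤ lam)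
    (hU : UnitarilyEquivalentPairs (restrictedPhiOne lam μ)
      (restrictedPhiTwo lam μ) (restrictedPhiOne lam ν) (restrictedPhiTwo lam ν)) (hj : 0 < j) :
    j = j' := by
  by_contra hne
  obtain ⟨V, hV⟩ := exists_defect_map hU
  obtain ⟨v, w, hv, hw, h0⟩ := h.exists_inner_mulOne_mulTwo_pow_ne_zero hlam hj
  rw [← ((hV v hv).2.2 j w hw).1] at h0
  exact h0 (h'.inner_mulOne_mulTwo_pow_eq_zero hlam (hV v hv).1 (hV w hw).1 hj h.two_mul_le hne)

lemma HasType.exponent_eq (h : μ.HasType j ε e) (h' : ν.HasType j' ε' e') (hlam : 1 ≤ lam)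
    (hU : UnitarilyEquivalentPairs (restrictedPhiOne lam μ)
      (restrictedPhiTwo lam μ) (restrictedPhiOne lam ν) (restrictedPhiTwo lam ν)) : j = j' := by
  rcases Nat.eq_zero_or_pos j with h0 | hj
  · rcases Nat.eq_zero_or_pos j' with h0' | hj'
    · omega
    · exact (h'.exponent_eq_of_pos h hlam hU.symm hj').symm
  · exact h.exponent_eq_of_pos h' hlam hU hj

/-- A preserved number would be positive for one representation and at most zero for the other. -/
lemma HasType.false_of_two_mul_eq (h : μ.HasType j 1 e) (h' : ν.HasType j (-1) e')
    (hlam : 1 ≤ lam) (hj : 2 * j = k) (hU : UnitarilyEquivalentPairs (restrictedPhiOne lam μ)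
      (restrictedPhiTwo lam μ) (restrictedPhiOne lam ν) (restrictedPhiTwo lam ν)) : False := by
  have hk : 0 < k := Nat.pos_of_ne_zero (NeZero.ne k)
  obtain ⟨V, hV⟩ := exists_defect_map hU
  obtain ⟨v, w, hv, hw, h0⟩ := h.exists_inner_mulOne_mulTwo_pow_ne_zero hlam (by omega)
  obtain ⟨x, hx0, hx⟩ := h.inner_of_two_mul_eq hlam hj hv
  obtain ⟨y, -, hy⟩ := h'.inner_of_two_mul_eq hlam hj (hV v hv).1
  rw [((hV v hv).2.2 j v hv).1, hx] at hy
  have hm := mul_pos (moment_pos hlam k) (moment_pos hlam j)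
  have hy' : ‖x‖ ^ 2 * (2 * (moment lam k * moment lam j)) =
      -(‖y‖ ^ 2 * (2 * (moment lam k * moment lam j))) := by
    rw [one_mul, neg_one_mul] at hy
    exact_mod_cast hy
  have hx2 : ‖x‖ ^ 2 = 0 := by
    by_contra hne
    have : 0 < ‖x‖ ^ 2 := lt_of_le_of_ne (sq_nonneg _) (Ne.symm hne)
    have h3 := mul_pos this hm
    have h4 := mul_nonneg (sq_nonneg ‖y‖) hm.le
    nlinarith
  have hxz : x = 0 := by simpa using hx2
  rw [hx0 hxz] at h0
  simp at h0

lemma HasType.false_of_zero (h : μ.HasType 0 1 e) (h' : ν.HasType 0 (-1) e') (hlam : 1 ≤ lam)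
    (hU : UnitarilyEquivalentPairs (restrictedPhiOne lam μ)
      (restrictedPhiTwo lam μ) (restrictedPhiOne lam ν) (restrictedPhiTwo lam ν)) : False := by
  have hk : 0 < k := Nat.pos_of_ne_zero (NeZero.ne k)
  obtain ⟨V, hV⟩ := exists_defect_map hU
  obtain ⟨v, hv, hv0⟩ := h.exists_isDefect_ne_zero hlam
  obtain ⟨hD, e2, e3⟩ := hV v hv
  have e4 := (e3 k v hv).2
  obtain ⟨x, rfl⟩ := h.eq_smul_of_eq_one hlam hv
  obtain ⟨y, hy⟩ := h'.eq_smul_of_eq_neg_one hlam hD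
  rw [hy] at e2 e4
  have n1 : ¬ (k = 0) := by omega
  have n2 : ¬ (0 = k) := by omega
  have n3 : ¬ (k + k = k) := by omega
  have n4 : ¬ (k = k + k) := by omega
  have n5 : ¬ (k + k = 0) := by omega
  have n6 : ¬ (0 = k + k) := by omega
  simp only [map_smul, map_sub, phiOne_mono, mulTwo_pow_mono, inner_smul_left,
    inner_smul_right, inner_add_left, inner_add_right, inner_sub_left, inner_sub_right,
    inner_mono_mono, zero_add, n1, n2, n3, n4, n5, n6, and_self, if_true,
    if_false, sub_zero, zero_sub, add_zero] at e2 e4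
  have hx : x ≠ 0 := by
    rintro rfl
    exact hv0 (zero_smul _ _)
  set a : ℂ := (moment lam 0 : ℂ)
  set b : ℂ := (moment lam k : ℂ)
  set c : ℂ := (moment lam (k + k) : ℂ)
  have ha : a ≠ 0 := Complex.ofReal_ne_zero.2 (moment_pos hlam 0).ne'
  have hb : b ≠ 0 := Complex.ofReal_ne_zero.2 (moment_pos hlam k).ne'
  set X : ℂ := (starRingEnd ℂ) x * x with hX
  have hX0 : X ≠ 0 := mul_ne_zero (by simpa using hx) hx
  set Y : ℂ := (starRingEnd ℂ) y * y with hY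
  -- These are the norms of `M₁v` and `M₂ᵏv` computed on both sides. The first gives `Yc = Xb`, and
  -- then the second reads `2Xb² = Xb²`.
  have f2 : 2 * (Y * (c * a)) = 2 * (X * (b * a)) := by
    rw [hX, hY]; linear_combination e2
  have f4 : 2 * (Y * (c * b)) = X * (b * b) := by
    rw [hX, hY]; linear_combination e4
  have : X * (b * b * a) = 0 := by linear_combination a * f4 - b * f2
  simp [hX0, ha, hb] at this

lemma not_unitarilyEquivalentPairs (hlam : 1 ≤ lam) (hne : ¬ μ.Equivalent ν) :
    ¬ UnitarilyEquivalentPairs (restrictedPhiOne lam μ) (restrictedPhiTwo lam μ)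
      (restrictedPhiOne lam ν) (restrictedPhiTwo lam ν) := by
  intro hU
  obtain ⟨j, ε, e, h⟩ := μ.exists_hasType
  obtain ⟨j', ε', e', h'⟩ := ν.exists_hasType
  obtain rfl := h.exponent_eq h' hlam hU
  by_cases hs : (j = 0 ∨ 2 * j = k) ∧ ε ≠ ε'
  swap
  · exact hne (h.equivalent h' fun hs' => by
      by_contra hε
      exact hs ⟨hs', hε⟩)
  obtain ⟨hs, hε⟩ := hs
  rcases h.sign with rfl | rfl <;> rcases h'.sign with rfl | rfl
  · exact hε rfl
  · rcases hs with rfl | hs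
    · exact h.false_of_zero h' hlam hU
    · exact h.false_of_two_mul_eq h' hlam hs hU
  · rcases hs with rfl | hs
    · exact h'.false_of_zero h hlam hU.symm
    · exact h'.false_of_two_mul_eq h hlam hs hU.symm
  · exact hε rfl

end DihedralIrrep

/-! ### The spectral set -/

/-- Dilates of a point of the closed bidisc lie in the open one. Boundary points matter because for
`λ = 1` the measure lives on the torus. -/
lemma phi_mem_closure_dihedralDomain (k : ℕ) {z : ℂ × ℂ} (h1 : ‖z.1‖ ≤ 1) (h2 : ‖z.2‖ ≤ 1) :
    (phiOne k z, phiTwo z) ∈ closure (dihedralDomain k) := by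
  have hc : Continuous fun r : ℝ => (phiOne k (r • z), phiTwo (r • z)) := by
    unfold phiOne phiTwo
    fun_prop
  have ht : Tendsto (fun r : ℝ => (phiOne k (r • z), phiTwo (r • z))) (𝓝[<] 1)
      (𝓝 (phiOne k z, phiTwo z)) := by
    have := (hc.tendsto 1).mono_left (nhdsWithin_le_nhds (s := Set.Iio 1))
    simpa using this
  refine mem_closure_of_tendsto ht ?_
  filter_upwards [self_mem_nhdsWithin,
    nhdsWithin_le_nhds (eventually_gt_nhds (zero_lt_one' ℝ))] with r hr1 hr0
  exact ⟨r • z, smul_mem_bidisc h1 h2 hr0 hr1, rfl⟩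

namespace DihedralIrrep

variable {k : ℕ} [NeZero k] (lam : ℝ) (μ : DihedralIrrep k)

lemma restrictedPhiOne_coeFn (f : isotypicSpace lam μ) :
    (restrictedPhiOne lam μ f : Lp ℂ 2 (bidiscMeasure lam)) =ᵐ[bidiscMeasure lam]
      fun z => phiOne k z * (f : Lp ℂ 2 (bidiscMeasure lam)) z :=
  mulOperator_coeFn _ _ _

lemma restrictedPhiTwo_coeFn (f : isotypicSpace lam μ) :
    (restrictedPhiTwo lam μ f : Lp ℂ 2 (bidiscMeasure lam)) =ᵐ[bidiscMeasure lam]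
      fun z => phiTwo z * (f : Lp ℂ 2 (bidiscMeasure lam)) z :=
  mulOperator_coeFn _ _ _

lemma pow_mul_pow_coeFn (a b : ℕ) (f : isotypicSpace lam μ) :
    ((restrictedPhiOne lam μ ^ a * restrictedPhiTwo lam μ ^ b) f :
      Lp ℂ 2 (bidiscMeasure lam)) =ᵐ[bidiscMeasure lam]
      fun z => phiOne k z ^ a * phiTwo z ^ b * (f : Lp ℂ 2 (bidiscMeasure lam)) z := by
  induction a with
  | zero =>
    induction b with
    | zero => simp
    | succ b ih =>
      rw [pow_zero, one_mul] at ih ⊢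
      rw [pow_succ', mul_apply_eq_comp]
      filter_upwards [restrictedPhiTwo_coeFn lam μ ((restrictedPhiTwo lam μ ^ b) f), ih]
        with z h1 h2
      rw [h1, h2]; ring
  | succ a ih =>
    rw [pow_succ', mul_assoc, mul_apply_eq_comp]
    filter_upwards [restrictedPhiOne_coeFn lam μ
      ((restrictedPhiOne lam μ ^ a * restrictedPhiTwo lam μ ^ b) f), ih] with z h1 h2
    rw [h1, h2]; ring

lemma polyEval_coeFn (p : MvPolynomial (Fin 2) ℂ) (f : isotypicSpace lam μ) :
    (polyEval (restrictedPhiOne lam μ) (restrictedPhiTwo lam μ) p f :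
      Lp ℂ 2 (bidiscMeasure lam)) =ᵐ[bidiscMeasure lam]
      fun z => MvPolynomial.eval ![phiOne k z, phiTwo z] p *
        (f : Lp ℂ 2 (bidiscMeasure lam)) z := by
  have key : ∀ s : Finset (Fin 2 →₀ ℕ),
      (((∑ m ∈ s, p.coeff m • (restrictedPhiOne lam μ ^ m 0 * restrictedPhiTwo lam μ ^ m 1)) f :
        isotypicSpace lam μ) : Lp ℂ 2 (bidiscMeasure lam)) =ᵐ[bidiscMeasure lam]
      fun z => (∑ m ∈ s, p.coeff m * (phiOne k z ^ m 0 * phiTwo z ^ m 1)) *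
        (f : Lp ℂ 2 (bidiscMeasure lam)) z := by
    classical
    intro s
    induction s using Finset.induction_on with
    | empty =>
      simp only [Finset.sum_empty, zero_mul]
      exact Lp.coeFn_zero ℂ 2 (bidiscMeasure lam)
    | insert m s hm ih =>
      rw [Finset.sum_insert hm, add_apply, smul_apply]
      filter_upwards [ih, pow_mul_pow_coeFn lam μ (m 0) (m 1) f,
        Lp.coeFn_smul (p.coeff m) ((restrictedPhiOne lam μ ^ m 0 * restrictedPhiTwo lam μ ^ m 1) f :
          Lp ℂ 2 (bidiscMeasure lam)),
        Lp.coeFn_add ((p.coeff m • (restrictedPhiOne lam μ ^ m 0 * restrictedPhiTwo lam μ ^ m 1) f :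
          isotypicSpace lam μ) : Lp ℂ 2 (bidiscMeasure lam))
          (((∑ m ∈ s, p.coeff m • (restrictedPhiOne lam μ ^ m 0 * restrictedPhiTwo lam μ ^ m 1)) f :
        isotypicSpace lam μ) : Lp ℂ 2 (bidiscMeasure lam))] with z h1 h2 h3 h4
      rw [Submodule.coe_add, h4, Pi.add_apply, h1, Submodule.coe_smul, h3, Pi.smul_apply, h2,
        Finset.sum_insert hm, smul_eq_mul]
      ring
  filter_upwards [key p.support] with z hz
  rw [polyEval, hz, MvPolynomial.eval_eq']
  simp [Fin.prod_univ_two]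

lemma isDihedralContraction :
    IsDihedralContraction k (restrictedPhiOne lam μ) (restrictedPhiTwo lam μ) := by
  constructor
  · apply ContinuousLinearMap.ext
    intro f
    apply Subtype.ext
    apply Lp.ext
    rw [mul_apply_eq_comp, mul_apply_eq_comp]
    filter_upwards [restrictedPhiOne_coeFn lam μ (restrictedPhiTwo lam μ f),
      restrictedPhiTwo_coeFn lam μ f, restrictedPhiTwo_coeFn lam μ (restrictedPhiOne lam μ f),
      restrictedPhiOne_coeFn lam μ f] with z h1 h2 h3 h4
    rw [h1, h2, h3, h4]
    ring
  · intro p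
    set C : ℝ≥0∞ := ⨆ w ∈ closure (dihedralDomain k), ‖MvPolynomial.eval ![w.1, w.2] p‖ₑ with hC
    -- The supremum is taken in `[0, ∞]`; its finiteness need not be proved, since an infinite bound
    -- is trivial.
    rcases eq_or_ne C ∞ with htop | hfin
    · rw [htop]; exact le_top
    lift C to NNReal using hfin with c hc
    rw [enorm_le_coe]
    refine ContinuousLinearMap.opNNNorm_le_bound _ _ fun f => ?_
    have hae : ∀ᵐ z ∂(bidiscMeasure lam),
        ‖(polyEval (restrictedPhiOne lam μ) (restrictedPhiTwo lam μ) p f :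
          Lp ℂ 2 (bidiscMeasure lam)) z‖₊ ≤ c * ‖(f : Lp ℂ 2 (bidiscMeasure lam)) z‖₊ := by
      filter_upwards [polyEval_coeFn lam μ p f, bidiscMeasure_ae_norm_le lam] with z h1 h2
      rw [h1, nnnorm_mul]
      gcongr
      rw [← enorm_le_coe, hC]
      exact le_iSup₂_of_le (phiOne k z, phiTwo z)
        (phi_mem_closure_dihedralDomain k h2.1 h2.2) le_rfl
    exact Lp.nnnorm_le_mul_nnnorm_of_ae_le_mul hae

end DihedralIrrep

theorem mainTheorem6 (k : ℕ) [NeZero k] (lam : ℝ) (hlam : 1 ≤ lam) :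
    (∀ μ : DihedralIrrep k,
      IsDihedralContraction k (restrictedPhiOne lam μ) (restrictedPhiTwo lam μ)) ∧
    (∀ μ ν : DihedralIrrep k, ¬ μ.Equivalent ν →
      ¬ UnitarilyEquivalentPairs (restrictedPhiOne lam μ) (restrictedPhiTwo lam μ)
        (restrictedPhiOne lam ν) (restrictedPhiTwo lam ν)) :=
  ⟨fun μ => μ.isDihedralContraction lam,
    fun _ _ hne => DihedralIrrep.not_unitarilyEquivalentPairs hlam hne⟩
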